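/- **Conventions.** Fix $d\ge 1$ and let functions and polynomial coefficients be real or complex. A cube is a closed cube $Q\subset\mathbb R^d$ with edges parallel to the coordinate axes and side length $\ell(Q)>0$; $\mathcal P_n$ is the space of polynomials on $\mathbb R^d$ of degree at most $n$; $\mathcal P_n(D)=\{\chi_D P: P\in\mathcal P_n\}$; and $\|g\|_{L^1(Q,dx/|Q|)}=\frac1{|Q|}\int_Q|g|\,dx$. *Lipschitz domains.* A bounded domain (nonempty, open, connected) $D\subset\mathbb R^d$ is Lipschitz if there are $\delta\ge0$, $R>0$ such that for every $a\in\partial D$, in suitable Cartesian coordinates $(x,y)\in\mathbb R^{d-1}\times\mathbb R$ centred at $a$ (obtained by an isometry), there is a $\delta$-Lipschitz function $A:\mathbb R^{d-1}\to\mathbb R$ such that, inside the cube of side $R$ centred at $a$ with edges parallel to the new axes, $D$ coincides with $\{y>A(x)\}$. *Moduli.* A continuous increasing function $\omega:[0,\infty)\to[0,\infty)$ with $\omega(0)=0$ is a modulus of continuity of order $n$ if $n$ is the smallest positive integer such that (1) for some $q\in[n,n+1)$ there is $C>0$ with $\omega(st)<Cs^q\omega(t)$ for all $s>1$, $t>0$;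 and (2) for some $r\in(n-1,n)$ there is $C>0$ with $\omega(st)<Cs^r\omega(t)$ for all $0<s<1$, $t>0$. The associated modulus is $$\widetilde\omega(x)=\frac{\omega(x)}{\max\{1,\int_x^1\omega(t)t^{-n-1}\,dt\}},\qquad x>0.$$ *Zygmund spaces.* $\mathcal C_\omega(D)$ consists of the $f\in L^1_{loc}(D)$ with $$\|f\|_{\omega,D}=\sup_{Q\subset D}\ \inf_{P\in\mathcal P_n}\frac1{\omega(\ell(Q))}\|f-P\|_{L^1(Q,dx/|Q|)}<\infty,$$ and is equipped with the norm $\|f\|=\|f\|_{\omega,D}+\|f\|_{L^1(D)}$. *Operators.* A homogeneous $C^{k}$-smooth Calderón–Zygmund operator is $Tf(y)=\lim_{\varepsilon\to0+}\int_{|x-y|>\varepsilon}f(x)K(y-x)\,dx$, where $K(x)=\Omega(x)/|x|^d$ for $x\ne0$ and $\Omega$ is homogeneous of degree $0$, of class $C^k$ on $\mathbb R^d\setminus\{0\}$, with zero integral over the unit sphere. For a function $f$ on $D$, extended by zero outside $D$, put $T_Df=(Tf)\chi_D$. **Theorem.** Let $\omega$ be a modulus of continuity of order $n\in\mathbb N$,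 $n\ge1$, let $D\subset\mathbb R^d$ be a bounded Lipschitz domain, and let $T$ be a homogeneous $C^{n+1}$-smooth Calderón–Zygmund operator. Then $T_D$ is well defined on $\mathcal C_\omega(D)$ (every $f\in\mathcal C_\omega(D)$ is integrable over $D$, and the principal value $T_Df(y)$ exists for every $y\in D$), and $T_D$ is bounded on $\mathcal C_\omega(D)$ (that is, it maps $\mathcal C_\omega(D)$ into itself and $\|T_Df\|\le C\|f\|$ with $C$ independent of $f$) if and only if the following two properties hold: (i) $T_DP\in\mathcal C_\omega(D)$ for every $P\in\mathcal P_n(D)$; (ii) there is a constant $C$ such that for every cube $Q\subset D$, with centre $x_0$, and every polynomial $P_{x_0}$ that is homogeneous of degree $n$ in $x-x_0$ (or zero), there is a polynomial $S_Q\in\mathcal P_n$ with $$\|T_D(\chi_DP_{x_0})-S_Q\|_{L^1(Q,dx/|Q|)}\le C\,\Big(\sup_{x\in D}|P_{x_0}(x)|\Big)\,\widetilde\omega(\ell(Q)).$$ -/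

import Mathlib

open MeasureTheory Set Filter Topology
open scoped NNReal ENNReal

noncomputable section

namespace ZygmundTP

/-- Euclidean space `ℝ^d`. -/
abbrev Rn (d : ℕ) : Type := EuclideanSpace ℝ (Fin d)

/-! ### Moduli of continuity -/

/-- `ω(t) / t^q` is almost decreasing on `(0, ∞)`. -/
def AlmostDecreasing (ω : ℝ → ℝ) (q : ℝ) : Prop :=
  ∃ C : ℝ, 0 < C ∧ ∀ s t : ℝ, 1 < s → 0 < t → ω (s * t) < C * s ^ q * ω t

/-- `ω(t) / t^r` is almost increasing on `(0, ∞)`. -/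
def AlmostIncreasing (ω : ℝ → ℝ) (r : ℝ) : Prop :=
  ∃ C : ℝ, 0 < C ∧ ∀ s t : ℝ, 0 < s → s < 1 → 0 < t → ω (s * t) < C * s ^ r * ω t

/-- The two regularity properties attached to the integer `n`. -/
def RegularOfOrder (ω : ℝ → ℝ) (n : ℕ) : Prop :=
  (∃ q : ℝ, (n : ℝ) ≤ q ∧ q < n + 1 ∧ AlmostDecreasing ω q) ∧
  (∃ r : ℝ, (n : ℝ) - 1 < r ∧ r < n ∧ AlmostIncreasing ω r)

/-- `ω` (only its restriction to `[0, ∞)` matters) is a modulus of continuity of order `n`: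
`n` is the smallest positive integer for which the two regularity properties hold. -/
structure IsModulusOfOrder (ω : ℝ → ℝ) (n : ℕ) : Prop where
  continuousOn : ContinuousOn ω (Ici 0)
  monotoneOn : MonotoneOn ω (Ici 0)
  map_zero : ω 0 = 0
  isLeast : IsLeast {m : ℕ | 1 ≤ m ∧ RegularOfOrder ω m} n

/-- The associated modulus `ω(x) / max {1, ∫_x^1 ω(t) t^{-n-1} dt}` (an oriented integral, so it
equals `ω(x)` for `x ≥ 1`). -/
def assocModulus (ω : ℝ → ℝ) (n : ℕ) (x : ℝ) : ℝ :=
  ω x / max 1 (∫ t in x..1, ω t / t ^ (n + 1))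

/-! ### Lipschitz domains -/

/-- `D` is a bounded `(δ, R)`-Lipschitz domain: after a shift and a rotation `U` taking the boundary
point `a` to the origin, inside the cube of side `R` centred at the origin (with edges parallel to
the new axes) `D` is the region above the graph of a `δ`-Lipschitz function `A` of the coordinates
other than the `j`-th one. -/
structure IsLipschitzDomainWith {d : ℕ} (δ : ℝ≥0) (R : ℝ) (D : Set (Rn d)) : Prop where
  isOpen : IsOpen D
  isConnected : IsConnected D
  isBounded : Bornology.IsBounded D
  window : ∀ a ∈ frontier D, ∃ (U : Rn d ≃ₗᵢ[ℝ] Rn d) (j : Fin d)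
    (A : EuclideanSpace ℝ {i : Fin d // i ≠ j} → ℝ), LipschitzWith δ A ∧
      ∀ x : Rn d, (∀ i, |U (x - a) i| ≤ R / 2) →
        (x ∈ D ↔ A (WithLp.toLp 2 fun i => U (x - a) i.1) < U (x - a) j)

/-- Bounded Lipschitz domain, with unspecified Lipschitz parameters. -/
def IsBoundedLipschitzDomain {d : ℕ} (D : Set (Rn d)) : Prop :=
  ∃ (δ : ℝ≥0) (R : ℝ), 0 < R ∧ IsLipschitzDomainWith δ R D

section Spaces

variable {𝕜 : Type*} [RCLike 𝕜] {d : ℕ}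

/-! ### Cubes, polynomials and Zygmund spaces -/

/-- The closed cube with centre `x₀`, side length `ℓ` and edges parallel to the axes. -/
def cube (x₀ : Rn d) (ℓ : ℝ) : Set (Rn d) := {x | ∀ i, |x i - x₀ i| ≤ ℓ / 2}

/-- The function on `ℝ^d` defined by a polynomial. -/
def polyFun (P : MvPolynomial (Fin d) 𝕜) (x : Rn d) : 𝕜 :=
  MvPolynomial.eval (fun i => ((x i : ℝ) : 𝕜)) P

/-- The normalized norm of `f` in `L¹(Q, dx/|Q|)`. -/
def avgL1 (Q : Set (Rn d)) (f : Rn d → 𝕜) : ℝ≥0∞ :=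
  (∫⁻ x in Q, ‖f x‖ₑ) / volume Q

/-- The Campanato type seminorm `‖f‖_{ω,D}` with approximating polynomials of degree `≤ n`. -/
def zygmundSeminorm (ω : ℝ → ℝ) (n : ℕ) (D : Set (Rn d)) (f : Rn d → 𝕜) : ℝ≥0∞ :=
  ⨆ (x₀ : Rn d) (ℓ : ℝ) (_ : 0 < ℓ) (_ : cube x₀ ℓ ⊆ D),
    ⨅ (P : MvPolynomial (Fin d) 𝕜) (_ : P.totalDegree ≤ n),
      avgL1 (cube x₀ ℓ) (fun x => f x - polyFun P x) / ENNReal.ofReal (ω ℓ)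

/-- `f ∈ C_ω(D)`. Only the values of `f` on `D` matter. -/
def MemZygmund (ω : ℝ → ℝ) (n : ℕ) (D : Set (Rn d)) (f : Rn d → 𝕜) : Prop :=
  LocallyIntegrableOn f D ∧ zygmundSeminorm ω n D f < ∞

/-- The norm `‖f‖_{ω,D} + ‖f‖_{L¹(D)}` of the inhomogeneous space `C_ω(D)`. -/
def zygmundNorm (ω : ℝ → ℝ) (n : ℕ) (D : Set (Rn d)) (f : Rn d → 𝕜) : ℝ≥0∞ :=
  zygmundSeminorm ω n D f + ∫⁻ x in D, ‖f x‖ₑ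

/-! ### Homogeneous Calderón–Zygmund operators -/

/-- `Ω` is homogeneous of degree `0`, `C^k` off the origin, and has zero integral over the unit
sphere with respect to surface measure. -/
structure IsCZSymbol (k : ℕ) (Ω : Rn d → 𝕜) : Prop where
  homogeneous : ∀ (t : ℝ) (x : Rn d), 0 < t → x ≠ 0 → Ω (t • x) = Ω x
  contDiffOn : ContDiffOn ℝ k Ω {0}ᶜ
  integral_sphere : ∫ θ : Metric.sphere (0 : Rn d) 1, Ω θ ∂(volume : Measure (Rn d)).toSphere = 0

/-- The Calderón–Zygmund kernel `K(x) = Ω(x) / |x|^d`. -/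
def czKernel (Ω : Rn d → 𝕜) (x : Rn d) : 𝕜 := Ω x / ((‖x‖ ^ d : ℝ) : 𝕜)

/-- The truncated integral `∫_{|y - x| > ε} f(x) K(y - x) dx`. -/
def czTruncated (Ω : Rn d → 𝕜) (f : Rn d → 𝕜) (y : Rn d) (ε : ℝ) : 𝕜 :=
  ∫ x in {x | ε < ‖y - x‖}, f x * czKernel Ω (y - x)

/-- `Tf(y) = PV ∫ f(x) K(y - x) dx`. -/
def czOperator (Ω : Rn d → 𝕜) (f : Rn d → 𝕜) (y : Rn d) : 𝕜 :=
  limUnder (𝓝[>] (0 : ℝ)) (czTruncated Ω f y)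

/-- The restricted operator `T_D f = χ_D · T(χ_D f)`: functions on `D` are extended by zero. -/
def restrictedCZ (Ω : Rn d → 𝕜) (D : Set (Rn d)) (f : Rn d → 𝕜) : Rn d → 𝕜 :=
  D.indicator (czOperator Ω (D.indicator f))

/-- `T_D` is well defined on `C_ω(D)`: every `f ∈ C_ω(D)` is integrable over `D`, and the principal
value defining `T_D f` exists at every point of `D`. -/
def RestrictedCZWellDefined (ω : ℝ → ℝ) (n : ℕ) (Ω : Rn d → 𝕜) (D : Set (Rn d)) : Prop :=
  ∀ f : Rn d → 𝕜, MemZygmund ω n D f → IntegrableOn f D ∧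
    ∀ y ∈ D, ∃ v : 𝕜, Tendsto (czTruncated Ω (D.indicator f) y) (𝓝[>] 0) (𝓝 v)

/-- `T_D` is a bounded operator on `C_ω(D)`. -/
def RestrictedCZBounded (ω : ℝ → ℝ) (n : ℕ) (Ω : Rn d → 𝕜) (D : Set (Rn d)) : Prop :=
  ∃ C : ℝ≥0, ∀ f : Rn d → 𝕜, MemZygmund ω n D f →
    MemZygmund ω n D (restrictedCZ Ω D f) ∧
      zygmundNorm ω n D (restrictedCZ Ω D f) ≤ C * zygmundNorm ω n D f

end Spaces

end ZygmundTP

end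

open MeasureTheory Set Filter Topology
open scoped NNReal ENNReal

noncomputable section

namespace ZygmundTP

variable {𝕜 : Type*} [RCLike 𝕜] {d : ℕ}

/-! ### Polynomials and their coefficient norms -/

/-! Let `P` be a nearly best polynomial for `f` on a cube of side `ℓ` centred at `x₀`, and write
`T_D f = T_D (f - P) + T_D P`. The proof rests on comparing such polynomials across scales.
Overlapping cubes of comparable size share a cube on which all norms of polynomials of degree at
most `n` are equivalent (`exists_pnorm_sub_le`), so passing from scale `t` to a comparable scale
changes a coefficient of degree `k` by at most a constant times `ω(t) t^{-k}`. In a Lipschitz domain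
each point is the tip of a chain of cubes growing along an interior cone and ending in a fixed
compact core. Summing along the chain bounds the coefficients of degree `k < n` uniformly, because
`k ≤ n - 1 < r`; in degree `n` the sum is comparable to the logarithmic integral in the associated
modulus (`ConeDomain.exists_coeff_bound`). It also shows that `f - P` grows on all of `D` no faster
than `ω(ℓ) (1 + |x - x₀| / ℓ)^q` with `q < n + 1` (`ConeDomain.exists_growth_bound`).

The error term `T_D (f - P)` is then within `O(ω(ℓ))` of a polynomial on the half cube, whatever the
domain does to polynomials (`ConeDomain.exists_error_approx`). Near `y` one uses local Hölder
regularity and the cancellation of the kernel; at distances comparable to `ℓ`, the size of the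
kernel; far away, its Taylor expansion, whose remainder decays like `|x|^{-d-n-1}` and beats the
growth of order `q`.

Sufficiency: `P` splits into its homogeneous part of degree `n` about `x₀`, no larger than the
logarithmic factor, and a remainder with bounded coefficients (`exists_split`). Condition (ii) has
exactly this factor in its denominator, and condition (i), applied to the monomials, handles the
remainder. This settles cubes whose doubles lie in `D`; `GoodModulus.exists_inner_bound` passes to
all cubes.

Necessity: polynomials have zero seminorm, so (i) is immediate. For (ii), given a homogeneous `H`,
one adds to `H(x - x₀)` cut-off copies of `H` at the dyadic scales `2^j ℓ ≤ 1`, with amplitudes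
`ω(2^j ℓ)` (`testFun`). Its norm is bounded by the size of `H`, yet near the cube it equals `W · H(x
- x₀)` with `W` at least a constant times the logarithmic factor. The difference from `W · H(x -
x₀)` vanishes near the cube and grows with an exponent below `n + 1`, so it costs `O(ω(ℓ))`
(`ConeDomain.exists_testRem_approx`). Dividing by `W` gives the logarithmic gain. -/

lemma norm_le_of_abs_le {x : Rn d} {τ : ℝ} (hτ : 0 ≤ τ) (h : ∀ i, |x i| ≤ τ) : ‖x‖ ≤ d * τ := by
  refine abs_le_of_sq_le_sq' ?_ (by positivity) |>.2
  rw [EuclideanSpace.real_norm_sq_eq]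
  calc ∑ i, x i ^ 2 ≤ ∑ _i : Fin d, τ ^ 2 :=
        Finset.sum_le_sum fun i _ => sq_le_sq' (neg_le_of_abs_le (h i)) (le_of_abs_le (h i))
    _ = d * τ ^ 2 := by simp
    _ ≤ (d * τ) ^ 2 := by
        rw [mul_pow]
        gcongr
        exact_mod_cast Nat.le_self_pow two_ne_zero d

lemma abs_apply_le_norm (x : Rn d) (i : Fin d) : |x i| ≤ ‖x‖ := PiLp.norm_apply_le x i

/-- The multi-indices of degree at most `n`. -/
def multiIdx (d n : ℕ) : Finset (Fin d →₀ ℕ) := (Finsupp.finite_of_degree_le n).toFinset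

@[simp] lemma mem_multiIdx {n : ℕ} {α : Fin d →₀ ℕ} : α ∈ multiIdx d n ↔ α.degree ≤ n := by
  simp [multiIdx]

/-- The monomial function `x ↦ x ^ α`. -/
def mono (𝕜 : Type*) [RCLike 𝕜] (α : Fin d →₀ ℕ) (x : Rn d) : 𝕜 := ∏ i, ((x i : ℝ) : 𝕜) ^ α i

lemma continuous_mono (α : Fin d →₀ ℕ) : Continuous (mono 𝕜 α) := by
  unfold mono
  have : ∀ i : Fin d, Continuous fun x : Rn d => ((x i : ℝ) : 𝕜) := fun i =>
    RCLike.continuous_ofReal.comp (by fun_prop)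
  exact continuous_finsetProd _ fun i _ => (this i).pow _

lemma norm_mono (α : Fin d →₀ ℕ) (x : Rn d) : ‖mono 𝕜 α x‖ = ∏ i, |x i| ^ α i := by
  simp [mono]

lemma norm_mono_le {α : Fin d →₀ ℕ} {x : Rn d} {τ : ℝ} (h : ∀ i, |x i| ≤ τ) :
    ‖mono 𝕜 α x‖ ≤ τ ^ α.degree := by
  rw [norm_mono, Finsupp.degree_eq_sum, ← Finset.prod_pow_eq_pow_sum]
  exact Finset.prod_le_prod (fun i _ => by positivity) fun i _ => by gcongr; exact h i

lemma mono_smul (α : Fin d →₀ ℕ) (t : ℝ) (x : Rn d) :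
    mono 𝕜 α (t • x) = ((t ^ α.degree : ℝ) : 𝕜) * mono 𝕜 α x := by
  rw [Finsupp.degree_eq_sum, ← Finset.prod_pow_eq_pow_sum]
  simp [mono, mul_pow, Finset.prod_mul_distrib]

lemma support_subset_multiIdx {n : ℕ} {P : MvPolynomial (Fin d) 𝕜} (hP : P.totalDegree ≤ n) :
    P.support ⊆ multiIdx d n := fun α hα => by
  rw [mem_multiIdx, Finsupp.degree_eq_sum]
  have := (MvPolynomial.le_totalDegree hα).trans hP
  rwa [Finsupp.sum_fintype _ _ (by simp)] at this

lemma polyFun_eq_sum {n : ℕ} {P : MvPolynomial (Fin d) 𝕜} (hP : P.totalDegree ≤ n) (x : Rn d) :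
    polyFun P x = ∑ α ∈ multiIdx d n, P.coeff α * mono 𝕜 α x := by
  rw [polyFun, MvPolynomial.eval_eq']
  refine Finset.sum_subset (support_subset_multiIdx hP) fun α _ hα => ?_
  rw [MvPolynomial.notMem_support_iff.1 hα, zero_mul]

lemma polyFun_add (P Q : MvPolynomial (Fin d) 𝕜) (x : Rn d) :
    polyFun (P + Q) x = polyFun P x + polyFun Q x := by simp [polyFun]

lemma polyFun_sub (P Q : MvPolynomial (Fin d) 𝕜) (x : Rn d) :
    polyFun (P - Q) x = polyFun P x - polyFun Q x := by simp [polyFun]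

lemma polyFun_C_mul (a : 𝕜) (P : MvPolynomial (Fin d) 𝕜) (x : Rn d) :
    polyFun (MvPolynomial.C a * P) x = a * polyFun P x := by simp [polyFun]

@[simp] lemma polyFun_C (a : 𝕜) (x : Rn d) :
    polyFun (MvPolynomial.C a : MvPolynomial (Fin d) 𝕜) x = a := by simp [polyFun]

@[simp] lemma polyFun_zero (x : Rn d) : polyFun (0 : MvPolynomial (Fin d) 𝕜) x = 0 := by
  simp [polyFun]

lemma polyFun_sum {ι : Type*} (s : Finset ι) (P : ι → MvPolynomial (Fin d) 𝕜) (x : Rn d) :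
    polyFun (∑ i ∈ s, P i) x = ∑ i ∈ s, polyFun (P i) x := by simp [polyFun]

lemma polyFun_monomial (α : Fin d →₀ ℕ) (a : 𝕜) (x : Rn d) :
    polyFun (MvPolynomial.monomial α a) x = a * mono 𝕜 α x := by
  rw [polyFun, MvPolynomial.eval_monomial, Finsupp.prod_fintype _ _ (by simp), mono]

lemma continuous_polyFun (P : MvPolynomial (Fin d) 𝕜) : Continuous (polyFun P) := by
  have : polyFun P = fun x => ∑ α ∈ multiIdx d P.totalDegree, P.coeff α * mono 𝕜 α x :=
    funext fun x => polyFun_eq_sum le_rfl x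
  rw [this]
  exact continuous_finsetSum _ fun α _ => (continuous_mono α).const_mul _

/-- The translated polynomial `x ↦ P (x + a)`. -/
def shift (a : Rn d) (P : MvPolynomial (Fin d) 𝕜) : MvPolynomial (Fin d) 𝕜 :=
  MvPolynomial.aeval (fun i => MvPolynomial.X i + MvPolynomial.C ((a i : ℝ) : 𝕜)) P

lemma shift_add (a : Rn d) (P Q : MvPolynomial (Fin d) 𝕜) :
    shift a (P + Q) = shift a P + shift a Q := by simp [shift]

lemma polyFun_shift (a : Rn d) (P : MvPolynomial (Fin d) 𝕜) (x : Rn d) :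
    polyFun (shift a P) x = polyFun P (x + a) := by
  simp only [polyFun, shift, MvPolynomial.aeval_def]
  rw [MvPolynomial.eval₂_eq', MvPolynomial.eval_eq' _ P]
  simp

/-- The open set contains a box, which is a product of infinite sets, and a polynomial is determined
by its values on such a product. -/
lemma polyFun_injective {P Q : MvPolynomial (Fin d) 𝕜} {U : Set (Rn d)} (hU : IsOpen U)
    (hne : U.Nonempty) (h : ∀ x ∈ U, polyFun P x = polyFun Q x) : P = Q := by
  obtain ⟨a, ha⟩ := hne
  obtain ⟨ε, hε, hball⟩ := Metric.isOpen_iff.1 hU a ha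
  set δ := ε / (d + 1) with hδ
  have hδ0 : 0 < δ := by positivity
  refine MvPolynomial.funext_set (fun i => (fun t : ℝ => ((a i + t : ℝ) : 𝕜)) '' Ioo 0 δ)
    (fun i => (Ioo_infinite hδ0).image ?_) fun x hx => ?_
  · intro s _ t _ hst
    simpa using hst
  · choose t ht htx using fun i => hx i (mem_univ i)
    have := h (WithLp.toLp 2 fun i => a i + t i) (hball ?_)
    · simpa [polyFun, htx] using this
    · rw [Metric.mem_ball, dist_eq_norm]
      refine (norm_le_of_abs_le (τ := δ) hδ0.le fun i => ?_).trans_lt ?_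
      · simp [abs_of_pos (ht i).1, (ht i).2.le]
      · rw [hδ, mul_div_assoc', div_lt_iff₀ (by positivity)]
        nlinarith

lemma totalDegree_shift_le (a : Rn d) (P : MvPolynomial (Fin d) 𝕜) :
    (shift a P).totalDegree ≤ P.totalDegree := by
  rw [shift, MvPolynomial.aeval_def, MvPolynomial.eval₂_eq']
  refine MvPolynomial.totalDegree_finsetSum_le fun α hα => ?_
  refine (MvPolynomial.totalDegree_mul _ _).trans ?_
  simp only [MvPolynomial.algebraMap_eq, MvPolynomial.totalDegree_C, zero_add]
  refine (MvPolynomial.totalDegree_finsetProd _ _).trans ?_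
  refine le_trans ?_ (MvPolynomial.le_totalDegree hα)
  rw [Finsupp.sum_fintype _ _ (by simp)]
  refine Finset.sum_le_sum fun i _ => (MvPolynomial.totalDegree_pow _ _).trans ?_
  have : (MvPolynomial.X i + MvPolynomial.C ((a i : ℝ) : 𝕜)).totalDegree ≤ 1 :=
    (MvPolynomial.totalDegree_add _ _).trans (by simp)
  nlinarith

lemma shift_shift (a b : Rn d) (P : MvPolynomial (Fin d) 𝕜) :
    shift a (shift b P) = shift (a + b) P :=
  polyFun_injective isOpen_univ univ_nonempty fun x _ => by
    simp [polyFun_shift, add_assoc]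

/-- The weighted coefficient norm `∑ |c_α| τ ^ |α|` of a polynomial of degree at most `n`. -/
def pnorm (n : ℕ) (τ : ℝ) (P : MvPolynomial (Fin d) 𝕜) : ℝ :=
  ∑ α ∈ multiIdx d n, ‖P.coeff α‖ * τ ^ α.degree

lemma pnorm_nonneg {n : ℕ} {τ : ℝ} (hτ : 0 ≤ τ) (P : MvPolynomial (Fin d) 𝕜) :
    0 ≤ pnorm n τ P := Finset.sum_nonneg fun _ _ => by positivity

lemma norm_coeff_mul_le_pnorm {n : ℕ} {τ : ℝ} (hτ : 0 ≤ τ) (P : MvPolynomial (Fin d) 𝕜)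
    {α : Fin d →₀ ℕ} (hα : α.degree ≤ n) : ‖P.coeff α‖ * τ ^ α.degree ≤ pnorm n τ P :=
  Finset.single_le_sum (f := fun α => ‖P.coeff α‖ * τ ^ α.degree) (fun _ _ => by positivity)
    (mem_multiIdx.2 hα)

lemma norm_coeff_le_pnorm {n : ℕ} {τ : ℝ} (hτ : 0 < τ) (P : MvPolynomial (Fin d) 𝕜)
    {α : Fin d →₀ ℕ} (hα : α.degree ≤ n) : ‖P.coeff α‖ ≤ pnorm n τ P / τ ^ α.degree := by
  rw [le_div_iff₀ (by positivity)]
  exact norm_coeff_mul_le_pnorm hτ.le P hα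

lemma pnorm_le_of_le {n : ℕ} {τ μ : ℝ} (hτ : 0 ≤ τ) (h : τ ≤ μ) (P : MvPolynomial (Fin d) 𝕜) :
    pnorm n τ P ≤ pnorm n μ P :=
  Finset.sum_le_sum fun _ _ => by gcongr

lemma pnorm_mul_le {n : ℕ} {τ μ : ℝ} (hτ : 0 ≤ τ) (hμ : 1 ≤ μ) (P : MvPolynomial (Fin d) 𝕜) :
    pnorm n (μ * τ) P ≤ μ ^ n * pnorm n τ P := by
  rw [pnorm, pnorm, Finset.mul_sum]
  refine Finset.sum_le_sum fun α hα => ?_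
  rw [mul_pow, mul_left_comm]
  gcongr
  exact mem_multiIdx.1 hα

lemma norm_polyFun_le {n : ℕ} {P : MvPolynomial (Fin d) 𝕜} (hP : P.totalDegree ≤ n)
    {a x : Rn d} {τ : ℝ} (h : ∀ i, |x i - a i| ≤ τ) :
    ‖polyFun P x‖ ≤ pnorm n τ (shift a P) := by
  have : polyFun P x = polyFun (shift a P) (x - a) := by rw [polyFun_shift, sub_add_cancel]
  rw [this, polyFun_eq_sum ((totalDegree_shift_le a P).trans hP)]
  refine (norm_sum_le _ _).trans (Finset.sum_le_sum fun α _ => ?_)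
  rw [norm_mul]
  gcongr
  exact norm_mono_le (by simpa using h)

/-- The constant terms cancel and every other monomial carries at least one factor `μ ≤ 1`. This
linear gain later absorbs polynomial corrections into a Hölder estimate. -/
lemma norm_polyFun_sub_le {n : ℕ} {P : MvPolynomial (Fin d) 𝕜} (hP : P.totalDegree ≤ n)
    {a x : Rn d} {τ μ : ℝ} (hτ : 0 ≤ τ) (hμ : 0 ≤ μ) (hμ1 : μ ≤ 1)
    (h : ∀ i, |x i - a i| ≤ μ * τ) :
    ‖polyFun P x - polyFun P a‖ ≤ μ * pnorm n τ (shift a P) := by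
  have h1 : polyFun P x = polyFun (shift a P) (x - a) := by rw [polyFun_shift, sub_add_cancel]
  have h2 : polyFun P a = polyFun (shift a P) 0 := by rw [polyFun_shift, zero_add]
  have hd := (totalDegree_shift_le a P).trans hP
  rw [h1, h2, polyFun_eq_sum hd, polyFun_eq_sum hd, ← Finset.sum_sub_distrib, pnorm,
    Finset.mul_sum]
  refine (norm_sum_le _ _).trans (Finset.sum_le_sum fun α _ => ?_)
  rw [← mul_sub, norm_mul, mul_left_comm]
  refine mul_le_mul_of_nonneg_left ?_ (norm_nonneg _)
  rcases eq_or_ne α 0 with rfl | hα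
  · simp [mono]; exact hμ
  · have h0 : mono 𝕜 α (0 : Rn d) = 0 := by
      obtain ⟨i, hi⟩ := Finsupp.ne_iff.1 hα
      exact Finset.prod_eq_zero (Finset.mem_univ i) (by simpa using hi)
    have hdeg : 1 ≤ α.degree := by
      rwa [Nat.one_le_iff_ne_zero, Ne, Finsupp.degree_eq_zero_iff]
    rw [h0, sub_zero]
    refine (norm_mono_le (τ := μ * τ) (by simpa using h)).trans ?_
    rw [mul_pow]
    gcongr
    calc μ ^ α.degree ≤ μ ^ 1 := pow_le_pow_of_le_one hμ hμ1 hdeg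
      _ = μ := pow_one μ

/-! ### Cubes and normalized averages -/

lemma mem_cube {a x : Rn d} {ℓ : ℝ} : x ∈ cube a ℓ ↔ ∀ i, |x i - a i| ≤ ℓ / 2 := Iff.rfl

lemma self_mem_cube (a : Rn d) {ℓ : ℝ} (hℓ : 0 ≤ ℓ) : a ∈ cube a ℓ := fun i => by
  simp; positivity

lemma cube_eq_preimage (a : Rn d) (ℓ : ℝ) :
    cube a ℓ = (@WithLp.ofLp 2 (Fin d → ℝ)) ⁻¹'
      Set.Icc (fun i => a i - ℓ / 2) (fun i => a i + ℓ / 2) := by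
  ext x
  simp only [mem_cube, mem_preimage, mem_Icc, Pi.le_def, abs_le]
  constructor
  · exact fun h => ⟨fun i => by linarith [(h i).1], fun i => by linarith [(h i).2]⟩
  · exact fun h i => ⟨by linarith [h.1 i], by linarith [h.2 i]⟩

lemma isClosed_cube (a : Rn d) (ℓ : ℝ) : IsClosed (cube a ℓ) := by
  rw [cube_eq_preimage]
  exact isClosed_Icc.preimage (PiLp.continuous_ofLp 2 _)

lemma measurableSet_cube (a : Rn d) (ℓ : ℝ) : MeasurableSet (cube a ℓ) :=
  (isClosed_cube a ℓ).measurableSet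

lemma volume_cube (a : Rn d) {ℓ : ℝ} (hℓ : 0 ≤ ℓ) : volume (cube a ℓ) = ENNReal.ofReal (ℓ ^ d) := by
  rw [cube_eq_preimage, (PiLp.volume_preserving_ofLp (Fin d)).measure_preimage
    measurableSet_Icc.nullMeasurableSet, Real.volume_Icc_pi]
  simp [ENNReal.ofReal_pow hℓ]

lemma cube_subset_closedBall (a : Rn d) {ℓ : ℝ} (hℓ : 0 ≤ ℓ) :
    cube a ℓ ⊆ Metric.closedBall a (d * (ℓ / 2)) := fun x hx => by
  rw [Metric.mem_closedBall, dist_eq_norm]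
  exact norm_le_of_abs_le (by positivity) fun i => hx i

lemma cube_subset_ball (hd : 0 < d) (a : Rn d) {ℓ : ℝ} (hℓ : 0 < ℓ) :
    cube a ℓ ⊆ Metric.ball a (d * ℓ) :=
  (cube_subset_closedBall a hℓ.le).trans <| Metric.closedBall_subset_ball <| by
    have : (0 : ℝ) < d := by exact_mod_cast hd
    nlinarith [mul_pos this hℓ]

lemma closedBall_subset_cube (a : Rn d) (ℓ : ℝ) : Metric.closedBall a (ℓ / 2) ⊆ cube a ℓ :=
  fun x hx i => by
    rw [Metric.mem_closedBall, dist_eq_norm] at hx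
    exact (abs_apply_le_norm (x - a) i).trans hx

lemma isCompact_cube (a : Rn d) {ℓ : ℝ} (hℓ : 0 ≤ ℓ) : IsCompact (cube a ℓ) :=
  (isCompact_closedBall a _).of_isClosed_subset (isClosed_cube a ℓ) (cube_subset_closedBall a hℓ)

lemma cube_subset_cube {a b : Rn d} {ℓ m : ℝ} (h : ∀ i, |a i - b i| ≤ (m - ℓ) / 2) :
    cube a ℓ ⊆ cube b m := fun x hx i => by
  have := abs_sub_le (x i) (a i) (b i)
  linarith [hx i, h i]

lemma cube_subset_cube_self (a : Rn d) {ℓ m : ℝ} (h : ℓ ≤ m) : cube a ℓ ⊆ cube a m :=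
  cube_subset_cube fun i => by simp; linarith

lemma lintegral_cube (a : Rn d) {τ : ℝ} (hτ : 0 < τ) (F : Rn d → ℝ≥0∞) :
    ∫⁻ x in cube a τ, F x = ENNReal.ofReal (τ ^ d) * ∫⁻ x in cube (0 : Rn d) 1, F (a + τ • x) := by
  have hemb : MeasurableEmbedding (fun x : Rn d => a + τ • x) :=
    (measurableEmbedding_addLeft a).comp (measurableEmbedding_const_smul₀ hτ.ne')
  have hmap : (volume : Measure (Rn d)).map (fun x => a + τ • x)
      = ENNReal.ofReal ((τ ^ d)⁻¹) • volume := by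
    have h1 : (fun x : Rn d => a + τ • x) = (fun x => a + x) ∘ (fun x => τ • x) := rfl
    rw [h1, ← Measure.map_map (measurable_const_add a) (measurable_const_smul τ),
      Measure.map_addHaar_smul _ hτ.ne', Measure.map_smul, map_add_left_eq_self]
    simp [abs_of_pos hτ]
  have hpre : (fun x : Rn d => a + τ • x) ⁻¹' cube a τ = cube 0 1 := by
    ext x
    simp only [mem_preimage, mem_cube]
    refine forall_congr' fun i => ?_
    simp only [PiLp.add_apply, PiLp.smul_apply, smul_eq_mul, add_sub_cancel_left, abs_mul,
      abs_of_pos hτ, PiLp.zero_apply, sub_zero]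
    constructor <;> intro h <;> nlinarith
  have hτd : 0 < τ ^ d := by positivity
  rw [← hpre, ← hemb.lintegral_map (F), ← hemb.restrict_map, hmap, Measure.restrict_smul,
    lintegral_smul_measure, smul_eq_mul, ← mul_assoc, ← ENNReal.ofReal_mul hτd.le,
    mul_inv_cancel₀ hτd.ne', ENNReal.ofReal_one, one_mul]

lemma avgL1_cube (a : Rn d) {τ : ℝ} (hτ : 0 < τ) (f : Rn d → 𝕜) :
    avgL1 (cube a τ) f = ∫⁻ x in cube (0 : Rn d) 1, ‖f (a + τ • x)‖ₑ := by
  rw [avgL1, lintegral_cube a hτ, volume_cube a hτ.le, mul_comm, ENNReal.mul_div_cancel_right]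
  · simpa using by positivity
  · simp

lemma avgL1_congr {Q : Set (Rn d)} (hQ : MeasurableSet Q) {f g : Rn d → 𝕜}
    (h : ∀ x ∈ Q, f x = g x) : avgL1 Q f = avgL1 Q g := by
  rw [avgL1, avgL1, setLIntegral_congr_fun hQ fun x hx => by rw [h x hx]]

lemma avgL1_le_of_ae_le {Q : Set (Rn d)} {f : Rn d → 𝕜} {M : ℝ}
    (h : ∀ᵐ x ∂(volume.restrict Q), ‖f x‖ ≤ M) : avgL1 Q f ≤ ENNReal.ofReal M := by
  refine ENNReal.div_le_of_le_mul ?_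
  refine (lintegral_mono_ae (g := fun _ => ENNReal.ofReal M) ?_).trans ?_
  · filter_upwards [h] with x hx
    rw [← ofReal_norm]
    exact ENNReal.ofReal_le_ofReal hx
  · simp

lemma avgL1_add_le {Q : Set (Rn d)} {f g : Rn d → 𝕜}
    (hf : AEStronglyMeasurable f (volume.restrict Q)) :
    avgL1 Q (fun x => f x + g x) ≤ avgL1 Q f + avgL1 Q g := by
  rw [avgL1, avgL1, avgL1, ← ENNReal.add_div]
  refine ENNReal.div_le_div_right ?_ _
  rw [← lintegral_add_left' hf.enorm]
  exact lintegral_mono fun x => enorm_add_le _ _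

lemma avgL1_const_mul (Q : Set (Rn d)) (a : 𝕜) (f : Rn d → 𝕜) :
    avgL1 Q (fun x => a * f x) = ‖a‖ₑ * avgL1 Q f := by
  rw [avgL1, avgL1, mul_div_assoc']
  simp_rw [enorm_mul]
  rw [lintegral_const_mul' _ _ enorm_ne_top]

lemma avgL1_sum_le {ι : Type*} (s : Finset ι) {Q : Set (Rn d)} {f : ι → Rn d → 𝕜}
    (hf : ∀ i ∈ s, AEStronglyMeasurable (f i) (volume.restrict Q)) :
    avgL1 Q (fun x => ∑ i ∈ s, f i x) ≤ ∑ i ∈ s, avgL1 Q (f i) := by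
  classical
  induction s using Finset.induction_on with
  | empty => simp [avgL1]
  | insert i s hi ih =>
    simp only [Finset.sum_insert hi]
    refine (avgL1_add_le (hf i (Finset.mem_insert_self i s))).trans ?_
    gcongr
    exact ih fun j hj => hf j (Finset.mem_insert_of_mem hj)

lemma avgL1_subset_cube_le {τ m : ℝ} (hτ : 0 < τ) (hm : 0 ≤ m) {S : Set (Rn d)}
    {b : Rn d} (h : cube b τ ⊆ S) (hS : volume S ≤ ENNReal.ofReal (m * τ ^ d)) (f : Rn d → 𝕜) :
    avgL1 (cube b τ) f ≤ ENNReal.ofReal m * avgL1 S f := by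
  have h1 : 0 < ENNReal.ofReal (τ ^ d) := by simpa using by positivity
  have h2 : volume S ≠ 0 := fun h0 => by
    have := measure_mono_null h h0
    rw [volume_cube b hτ.le] at this
    exact h1.ne' this
  have h3 : volume S ≠ ∞ := (hS.trans_lt ENNReal.ofReal_lt_top).ne
  rw [avgL1, avgL1, volume_cube b hτ.le]
  refine ENNReal.div_le_of_le_mul ?_
  calc ∫⁻ x in cube b τ, ‖f x‖ₑ ≤ ∫⁻ x in S, ‖f x‖ₑ := lintegral_mono_set h
    _ = (∫⁻ x in S, ‖f x‖ₑ) / volume S * volume S := (ENNReal.div_mul_cancel h2 h3).symm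
    _ ≤ (∫⁻ x in S, ‖f x‖ₑ) / volume S * ENNReal.ofReal (m * τ ^ d) := by gcongr
    _ = _ := by
      rw [ENNReal.ofReal_mul hm]
      ring

lemma avgL1_subcube_le {a b : Rn d} {τ κ : ℝ} (hτ : 0 < τ) (hκ : 0 < κ)
    (h : cube b τ ⊆ cube a (κ * τ)) (f : Rn d → 𝕜) :
    avgL1 (cube b τ) f ≤ ENNReal.ofReal (κ ^ d) * avgL1 (cube a (κ * τ)) f :=
  avgL1_subset_cube_le hτ (by positivity) h
    (by rw [volume_cube a (by positivity), mul_pow]) f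

/-- Equivalence of norms in finite dimension: the `L¹` norm over the unit cube is continuous in the
coefficients and positive off zero, so it has a positive minimum on the unit sphere. -/
lemma exists_coeff_bound (𝕜 : Type*) [RCLike 𝕜] (d n : ℕ) : ∃ C : ℝ, 0 < C ∧
    ∀ c : (Fin d →₀ ℕ) → 𝕜, ENNReal.ofReal (∑ α ∈ multiIdx d n, ‖c α‖) ≤ ENNReal.ofReal C *
      ∫⁻ x in cube (0 : Rn d) 1, ‖∑ α ∈ multiIdx d n, c α * mono 𝕜 α x‖ₑ := by
  let ev : (multiIdx d n → 𝕜) → Rn d → 𝕜 := fun c x => ∑ α, c α * mono 𝕜 α.1 x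
  have hcont : Continuous (Function.uncurry fun c x => ‖ev c x‖) := by
    refine Continuous.norm (continuous_finsetSum _ fun α _ => ?_)
    exact ((continuous_apply α).comp continuous_fst).mul ((continuous_mono _).comp continuous_snd)
  have hcontx : ∀ c, Continuous (ev c) := fun c =>
    continuous_finsetSum _ fun α _ => (continuous_mono _).const_mul _
  have hK := isCompact_cube (0 : Rn d) (ℓ := 1) zero_le_one
  let φ : (multiIdx d n → 𝕜) → ℝ := fun c => ∫ x in cube (0 : Rn d) 1, ‖ev c x‖
  have hφ : Continuous φ := continuous_parametric_integral_of_continuous hcont hK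
  have hφpos : ∀ c, c ≠ 0 → 0 < φ c := by
    intro c hc
    refine lt_of_le_of_ne (integral_nonneg fun _ => norm_nonneg _) fun h0 => hc ?_
    have h1 := (setIntegral_eq_zero_iff_of_nonneg_ae (ae_of_all _ fun _ => norm_nonneg _)
      ((hcontx c).norm.continuousOn.integrableOn_compact hK)).1 h0.symm
    have h2 : EqOn (ev c) (fun _ => 0) (Metric.ball (0 : Rn d) (1 / 2)) := by
      refine Measure.eqOn_open_of_ae_eq (μ := volume) ?_ Metric.isOpen_ball
        (hcontx c).continuousOn continuousOn_const
      refine ae_restrict_of_ae_restrict_of_subset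
        (Metric.ball_subset_closedBall.trans (closedBall_subset_cube 0 1)) ?_
      filter_upwards [h1] with x hx
      simpa using hx
    let P : MvPolynomial (Fin d) 𝕜 := ∑ α : multiIdx d n, MvPolynomial.monomial α.1 (c α)
    have hP : P = 0 := by
      refine polyFun_injective (U := Metric.ball (0 : Rn d) (1 / 2)) Metric.isOpen_ball
        (Metric.nonempty_ball.2 (by norm_num)) fun x hx => ?_
      rw [polyFun_sum, polyFun_zero]
      simp_rw [polyFun_monomial]
      exact h2 hx
    funext α
    have h3 := congrArg (MvPolynomial.coeff α.1) hP
    simp only [P, MvPolynomial.coeff_sum, MvPolynomial.coeff_monomial,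
      MvPolynomial.coeff_zero] at h3
    rw [Finset.sum_eq_single α (fun β _ hβ => if_neg fun h => hβ (Subtype.ext h)) (by simp)] at h3
    simpa using h3
  have key : ∃ m : ℝ, 0 < m ∧ ∀ c, m * ‖c‖ ≤ φ c := by
    rcases (Metric.sphere (0 : multiIdx d n → 𝕜) 1).eq_empty_or_nonempty with he | hne
    · refine ⟨1, one_pos, fun c => ?_⟩
      rcases eq_or_ne c 0 with rfl | hc
      · simpa using integral_nonneg fun _ => norm_nonneg _
      · exact absurd (show (((‖c‖⁻¹ : ℝ) : 𝕜) • c) ∈ Metric.sphere (0 : multiIdx d n → 𝕜) 1 by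
          simp [norm_smul, hc]) (he ▸ notMem_empty _)
    · obtain ⟨c₀, hc₀, hmin⟩ := (isCompact_sphere (0 : multiIdx d n → 𝕜) 1).exists_isMinOn hne
        hφ.continuousOn
      refine ⟨φ c₀, hφpos c₀ (by rintro rfl; simp at hc₀), fun c => ?_⟩
      rcases eq_or_ne c 0 with rfl | hc
      · simpa using integral_nonneg fun _ => norm_nonneg _
      · have h1 := hmin (show (((‖c‖⁻¹ : ℝ) : 𝕜) • c) ∈ Metric.sphere (0 : multiIdx d n → 𝕜) 1 by
          simp [norm_smul, hc])
        have h2 : φ (((‖c‖⁻¹ : ℝ) : 𝕜) • c) = ‖c‖⁻¹ * φ c := by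
          simp only [φ, ev, Pi.smul_apply, smul_eq_mul, mul_assoc, ← Finset.mul_sum, norm_mul]
          rw [integral_const_mul]
          simp
        simp only [mem_ofPred_eq, h2] at h1
        rwa [inv_mul_eq_div, le_div_iff₀ (norm_pos_iff.2 hc)] at h1
  obtain ⟨m, hm, hmφ⟩ := key
  refine ⟨(multiIdx d n).card / m + 1, by positivity, fun c => ?_⟩
  let c' : multiIdx d n → 𝕜 := fun α => c α.1
  have hev : ∀ x, ∑ α ∈ multiIdx d n, c α * mono 𝕜 α x = ev c' x := fun x =>
    (Finset.sum_coe_sort (multiIdx d n) fun α => c α * mono 𝕜 α x).symm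
  have hintg : ∫⁻ x in cube (0 : Rn d) 1, ‖∑ α ∈ multiIdx d n, c α * mono 𝕜 α x‖ₑ
      = ENNReal.ofReal (φ c') := by
    simp_rw [hev]
    rw [ofReal_integral_norm_eq_lintegral_enorm]
    exact (hcontx c').continuousOn.integrableOn_compact hK
  rw [hintg, ← ENNReal.ofReal_mul (by positivity)]
  refine ENNReal.ofReal_le_ofReal ?_
  have hφ0 : 0 ≤ φ c' := integral_nonneg fun _ => norm_nonneg _
  calc ∑ α ∈ multiIdx d n, ‖c α‖ ≤ ∑ _α ∈ multiIdx d n, ‖c'‖ :=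
        Finset.sum_le_sum fun α hα => norm_le_pi_norm c' ⟨α, hα⟩
    _ = (multiIdx d n).card * ‖c'‖ := by simp
    _ ≤ (multiIdx d n).card * (φ c' / m) := by
        gcongr
        rw [le_div_iff₀ hm, mul_comm]
        exact hmφ c'
    _ = (multiIdx d n).card / m * φ c' := by ring
    _ ≤ _ := by nlinarith

/-- On polynomials of degree at most `n` the coefficient norm is controlled by `L¹` averages. -/
lemma exists_pnorm_le_avgL1 (𝕜 : Type*) [RCLike 𝕜] (d n : ℕ) : ∃ C : ℝ, 0 < C ∧
    ∀ P : MvPolynomial (Fin d) 𝕜, P.totalDegree ≤ n → ∀ (a : Rn d) (τ : ℝ), 0 < τ →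
      ENNReal.ofReal (pnorm n τ (shift a P)) ≤
        ENNReal.ofReal C * avgL1 (cube a τ) (polyFun P) := by
  obtain ⟨C, hC, h⟩ := exists_coeff_bound 𝕜 d n
  refine ⟨C, hC, fun P hP a τ hτ => ?_⟩
  have h1 := h fun α => (shift a P).coeff α * ((τ ^ α.degree : ℝ) : 𝕜)
  rw [avgL1_cube a hτ]
  convert h1 using 4 with α hα x
  · exact Finset.sum_congr rfl fun α _ => by simp [abs_of_pos hτ]
  · rw [add_comm, ← polyFun_shift, polyFun_eq_sum ((totalDegree_shift_le a P).trans hP)]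
    simp_rw [mono_smul, mul_assoc]

lemma pnorm_le_of_norm_le {n : ℕ} {C : ℝ} (hC : 0 < C)
    (h : ∀ P : MvPolynomial (Fin d) 𝕜, P.totalDegree ≤ n → ∀ (a : Rn d) (τ : ℝ), 0 < τ →
      ENNReal.ofReal (pnorm n τ (shift a P)) ≤ ENNReal.ofReal C * avgL1 (cube a τ) (polyFun P))
    {P : MvPolynomial (Fin d) 𝕜} (hP : P.totalDegree ≤ n) {a : Rn d} {τ M : ℝ} (hτ : 0 < τ)
    (hM : ∀ x ∈ cube a τ, ‖polyFun P x‖ ≤ M) : pnorm n τ (shift a P) ≤ C * M := by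
  have hM0 : 0 ≤ M := (norm_nonneg _).trans (hM a (self_mem_cube a hτ.le))
  have h1 := (h P hP a τ hτ).trans (mul_le_mul_right (avgL1_le_of_ae_le (M := M)
    ((ae_restrict_mem (measurableSet_cube a τ)).mono hM)) _)
  rw [← ENNReal.ofReal_mul hC.le] at h1
  exact (ENNReal.ofReal_le_ofReal_iff (by positivity)).1 h1

/-- Changing the centre of the coefficient norm. -/
lemma exists_pnorm_shift_le (𝕜 : Type*) [RCLike 𝕜] (d n : ℕ) : ∃ C : ℝ, 0 < C ∧
    ∀ P : MvPolynomial (Fin d) 𝕜, P.totalDegree ≤ n → ∀ (a b : Rn d) (τ κ : ℝ), 0 < τ → 1 ≤ κ →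
      (∀ i, |a i - b i| ≤ κ * τ) → pnorm n τ (shift a P) ≤ C * κ ^ n * pnorm n τ (shift b P) := by
  obtain ⟨C, hC, h⟩ := exists_pnorm_le_avgL1 𝕜 d n
  refine ⟨C * 2 ^ n, by positivity, fun P hP a b τ κ hτ hκ hab => ?_⟩
  -- Points of the cube of side `τ` about `a` lie within `τ / 2 + κ τ ≤ 2 κ τ` of `b` in each
  -- coordinate.
  have h1 : pnorm n τ (shift a P) ≤ C * pnorm n (2 * κ * τ) (shift b P) := by
    refine pnorm_le_of_norm_le hC h hP hτ fun x hx => norm_polyFun_le hP fun i => ?_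
    have := abs_sub_le (x i) (a i) (b i)
    nlinarith [hx i, hab i]
  have h2 := pnorm_mul_le (n := n) (μ := 2 * κ) hτ.le (by linarith) (shift b P)
  calc _ ≤ C * ((2 * κ) ^ n * pnorm n τ (shift b P)) := by
        refine h1.trans ?_
        gcongr
    _ = _ := by rw [mul_pow]; ring

/-! ### Moduli of continuity -/

/-- Quantitative form of the regularity properties of a modulus of order `n`. -/
structure GoodModulus (ω : ℝ → ℝ) (n : ℕ) (q r C : ℝ) : Prop where
  one_le_order : 1 ≤ n
  continuousOn : ContinuousOn ω (Ici 0)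
  monotoneOn : MonotoneOn ω (Ici 0)
  pos : ∀ t, 0 < t → 0 < ω t
  lt_q : (n : ℝ) < q
  q_lt : q < n + 1
  lt_r : (n : ℝ) - 1 < r
  r_lt : r < n
  one_le_const : 1 ≤ C
  le_of_ge : ∀ s t, 0 < s → s ≤ t → ω t ≤ C * (t / s) ^ q * ω s
  le_of_le : ∀ s t, 0 < s → s ≤ t → ω s ≤ C * (s / t) ^ r * ω t

lemma IsModulusOfOrder.exists_goodModulus {ω : ℝ → ℝ} {n : ℕ} (h : IsModulusOfOrder ω n) :
    ∃ q r C, GoodModulus ω n q r C := by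
  obtain ⟨⟨hn, ⟨q, hq1, hq2, C₁, hC₁, h₁⟩, ⟨r, hr1, hr2, C₂, hC₂, h₂⟩⟩, -⟩ := h.isLeast
  have hnn : ∀ t, 0 ≤ t → 0 ≤ ω t := fun t ht => by
    simpa [h.map_zero] using h.monotoneOn (mem_Ici.2 le_rfl) (mem_Ici.2 ht) ht
  -- The strict inequality in the growth condition at `s = 2` forces positivity.
  have hpos : ∀ t, 0 < t → 0 < ω t := fun t ht => by
    have h3 := (hnn (2 * t) (by positivity)).trans_lt (h₁ 2 t one_lt_two ht)
    exact pos_of_mul_pos_right h3 (by positivity)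
  -- The given exponent may equal `n`, but the geometric sums for coefficients of degree `n` need an
  -- exponent strictly above `n`; the midpoint with `n + 1` is still admissible.
  refine ⟨(q + (n + 1)) / 2, r, max 1 (max C₁ C₂), hn, h.continuousOn, h.monotoneOn, hpos,
    by linarith, by linarith, hr1, hr2, le_max_left _ _, fun s t hs hst => ?_, fun s t hs hst => ?_⟩
  · have hω := hpos s hs
    have hts : 1 ≤ t / s := (one_le_div hs).2 hst
    rcases hst.eq_or_lt with rfl | hlt
    · rw [div_self hs.ne', Real.one_rpow, mul_one]
      exact le_mul_of_one_le_left hω.le (le_max_left _ _)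
    · have h4 := h₁ (t / s) s ((one_lt_div hs).2 hlt) hs
      rw [div_mul_cancel₀ _ hs.ne'] at h4
      refine h4.le.trans ?_
      gcongr
      · exact (le_max_left _ _).trans (le_max_right _ _)
      · linarith
  · have ht := hs.trans_le hst
    have hω := hpos t ht
    rcases hst.eq_or_lt with rfl | hlt
    · rw [div_self hs.ne', Real.one_rpow, mul_one]
      exact le_mul_of_one_le_left hω.le (le_max_left _ _)
    · have h4 := h₂ (s / t) t (by positivity) ((div_lt_one ht).2 hlt) ht
      rw [div_mul_cancel₀ _ ht.ne'] at h4
      refine h4.le.trans ?_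
      gcongr
      exact (le_max_right _ _).trans (le_max_right _ _)

namespace GoodModulus

variable {ω : ℝ → ℝ} {n : ℕ} {q r C : ℝ}

lemma r_pos (h : GoodModulus ω n q r C) : 0 < r := by
  have : (1 : ℝ) ≤ n := by exact_mod_cast h.one_le_order
  linarith [h.lt_r]

lemma mono (h : GoodModulus ω n q r C) {s t : ℝ} (hs : 0 ≤ s) (hst : s ≤ t) : ω s ≤ ω t :=
  h.monotoneOn (mem_Ici.2 hs) (mem_Ici.2 (hs.trans hst)) hst

lemma const_pos (h : GoodModulus ω n q r C) : 0 < C := one_pos.trans_le h.one_le_const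

lemma le_of_le_of_exponent_le (h : GoodModulus ω n q r C) {p : ℝ} (hp : p ≤ r) {s t : ℝ}
    (hs : 0 < s) (hst : s ≤ t) : ω s ≤ C * (s / t) ^ p * ω t := by
  have ht := hs.trans_le hst
  refine (h.le_of_le s t hs hst).trans ?_
  have := (h.pos t ht).le
  have hC := h.const_pos
  refine mul_le_mul_of_nonneg_right (mul_le_mul_of_nonneg_left ?_ hC.le) this
  exact Real.rpow_le_rpow_of_exponent_ge (by positivity) ((div_le_one ht).2 hst) hp

lemma le_mul_of_le (h : GoodModulus ω n q r C) {κ : ℝ} (hκ : 1 ≤ κ) {s t : ℝ} (hs : 0 < s)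
    (hst : t ≤ κ * s) (ht : 0 ≤ t) : ω t ≤ C * κ ^ q * ω s := by
  have h0 : s ≤ κ * s := le_mul_of_one_le_left hs.le hκ
  refine (h.mono ht hst).trans ((h.le_of_ge s _ hs h0).trans_eq ?_)
  rw [mul_div_cancel_right₀ _ hs.ne']

lemma q_pos (h : GoodModulus ω n q r C) : 0 < q := (Nat.cast_nonneg n).trans_lt h.lt_q

end GoodModulus

lemma pow_rpow_comm {x : ℝ} (hx : 0 ≤ x) (γ : ℝ) (j : ℕ) : (x ^ j) ^ γ = (x ^ γ) ^ j := by
  rw [← Real.rpow_natCast, ← Real.rpow_mul hx, mul_comm, Real.rpow_mul hx, Real.rpow_natCast]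

lemma sum_pow_rpow_le_of_pos {x γ : ℝ} (hx : 1 < x) (hγ : 0 < γ) (m : ℕ) :
    ∑ j ∈ Finset.range m, (x ^ j) ^ γ ≤ (x ^ γ - 1)⁻¹ * (x ^ m) ^ γ := by
  have hy : 1 < x ^ γ := Real.one_lt_rpow hx hγ
  simp_rw [pow_rpow_comm (zero_le_one.trans hx.le)]
  rw [geom_sum_eq hy.ne', inv_mul_eq_div]
  gcongr
  linarith

lemma sum_pow_rpow_le_of_neg {x γ : ℝ} (hx : 1 < x) (hγ : γ < 0) (m : ℕ) :
    ∑ j ∈ Finset.range m, (x ^ j) ^ γ ≤ (1 - x ^ γ)⁻¹ := by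
  have hy : x ^ γ < 1 := Real.rpow_lt_one_of_one_lt_of_neg hx hγ
  have hy0 : 0 < x ^ γ := by positivity
  simp_rw [pow_rpow_comm (zero_le_one.trans hx.le)]
  rw [geom_sum_eq hy.ne, ← neg_div_neg_eq, inv_eq_one_div, neg_sub, neg_sub]
  have : 0 < (x ^ γ) ^ m := by positivity
  gcongr
  linarith

/-! ### Sums over geometric scales and the logarithmic factor -/

section Sums

variable {ω : ℝ → ℝ} {n : ℕ} {q r C x s : ℝ}

/-- For `k < r` the terms are dominated by a geometrically growing sequence, so the largest scale
controls the sum. -/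
lemma GoodModulus.sum_le_top (h : GoodModulus ω n q r C) (hx : 1 < x) (hs : 0 < s) {k : ℕ}
    (hk : (k : ℝ) < r) (m : ℕ) :
    ∑ j ∈ Finset.range m, ω (x ^ j * s) / (x ^ j * s) ^ k ≤
      C * (x ^ (r - k) - 1)⁻¹ * (ω (x ^ m * s) / (x ^ m * s) ^ k) := by
  have hx0 : 0 < x := one_pos.trans hx
  have hC := h.const_pos
  have hω := h.pos (x ^ m * s) (by positivity)
  have key : ∀ j ∈ Finset.range m, ω (x ^ j * s) / (x ^ j * s) ^ k ≤
      C * (ω (x ^ m * s) / (x ^ m * s) ^ k) * ((x ^ m) ^ (r - k))⁻¹ * (x ^ j) ^ (r - k) := by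
    intro j hj
    have hjm : x ^ j * s ≤ x ^ m * s := by
      gcongr
      · exact hx.le
      · exact (Finset.mem_range.1 hj).le
    have h1 := h.le_of_le _ _ (by positivity) hjm
    rw [mul_div_mul_right _ _ hs.ne', Real.div_rpow (by positivity) (by positivity)] at h1
    rw [div_le_iff₀ (by positivity)]
    refine h1.trans_eq ?_
    rw [Real.rpow_sub (by positivity), Real.rpow_sub (by positivity), Real.rpow_natCast,
      Real.rpow_natCast, mul_pow, mul_pow]
    field_simp
  refine (Finset.sum_le_sum key).trans ?_
  rw [← Finset.mul_sum]
  have h2 := sum_pow_rpow_le_of_pos hx (sub_pos.2 hk) m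
  refine (mul_le_mul_of_nonneg_left h2 (by positivity)).trans_eq ?_
  have : (x ^ m) ^ (r - k) ≠ 0 := by positivity
  field_simp

/-- The same sum measured from the smallest scale: the upper growth exponent `q` is used instead of
`r`, so every degree `k ≤ n` is allowed. -/
lemma GoodModulus.sum_le_bottom (h : GoodModulus ω n q r C) (hx : 1 < x) (hs : 0 < s) {k : ℕ}
    (hk : (k : ℝ) < q) (m : ℕ) :
    ∑ j ∈ Finset.range m, ω (x ^ j * s) / (x ^ j * s) ^ k ≤
      C * (x ^ (q - k) - 1)⁻¹ * (ω s * (x ^ m) ^ q / (x ^ m * s) ^ k) := by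
  have hx0 : 0 < x := one_pos.trans hx
  have hC := h.const_pos
  have hω := h.pos s hs
  have key : ∀ j ∈ Finset.range m, ω (x ^ j * s) / (x ^ j * s) ^ k ≤
      C * (ω s / s ^ k) * (x ^ j) ^ (q - k) := by
    intro j hj
    have hjm : s ≤ x ^ j * s := le_mul_of_one_le_left hs.le (one_le_pow₀ hx.le)
    have h1 := h.le_of_ge _ _ hs hjm
    rw [mul_div_cancel_right₀ _ hs.ne'] at h1
    rw [div_le_iff₀ (by positivity)]
    refine h1.trans_eq ?_
    rw [Real.rpow_sub (by positivity), Real.rpow_natCast, mul_pow]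
    field_simp
  refine (Finset.sum_le_sum key).trans ?_
  rw [← Finset.mul_sum]
  have h2 := sum_pow_rpow_le_of_pos hx (sub_pos.2 hk) m
  refine (mul_le_mul_of_nonneg_left h2 (by positivity)).trans_eq ?_
  rw [Real.rpow_sub (by positivity : 0 < x ^ m), Real.rpow_natCast, mul_pow]
  field_simp

/-- Since `q < n + 1` the terms now decay geometrically and the smallest scale controls the sum. -/
lemma GoodModulus.sum_div_pow_succ_le (h : GoodModulus ω n q r C) (hx : 1 < x) (hs : 0 < s)
    (m : ℕ) :
    ∑ j ∈ Finset.range m, ω (x ^ j * s) / (x ^ j * s) ^ (n + 1) ≤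
      C * (1 - x ^ (q - (n + 1)))⁻¹ * (ω s / s ^ (n + 1)) := by
  have hx0 : 0 < x := one_pos.trans hx
  have hC := h.const_pos
  have hω := h.pos s hs
  have key : ∀ j ∈ Finset.range m, ω (x ^ j * s) / (x ^ j * s) ^ (n + 1) ≤
      C * (ω s / s ^ (n + 1)) * (x ^ j) ^ (q - (n + 1)) := by
    intro j hj
    have hjm : s ≤ x ^ j * s := le_mul_of_one_le_left hs.le (one_le_pow₀ hx.le)
    have h1 := h.le_of_ge _ _ hs hjm
    rw [mul_div_cancel_right₀ _ hs.ne'] at h1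
    rw [div_le_iff₀ (by positivity)]
    refine h1.trans_eq ?_
    have : ((n : ℝ) + 1) = ((n + 1 : ℕ) : ℝ) := by push_cast; ring
    rw [this, Real.rpow_sub (by positivity), Real.rpow_natCast, mul_pow]
    field_simp
  refine (Finset.sum_le_sum key).trans ?_
  rw [← Finset.mul_sum]
  have h2 := sum_pow_rpow_le_of_neg hx (sub_neg.2 h.q_lt) m
  refine (mul_le_mul_of_nonneg_left h2 (by positivity)).trans_eq ?_
  ring

lemma sum_rpow_div_pow_le {p : ℝ} (hx : 1 < x) (hs : 0 < s) {k : ℕ} (hk : p < k) (m : ℕ) :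
    ∑ j ∈ Finset.range m, (x ^ j * s) ^ p / (x ^ j * s) ^ k ≤
      (1 - x ^ (p - k))⁻¹ * (s ^ p / s ^ k) := by
  have hx0 : 0 < x := one_pos.trans hx
  have key : ∀ j ∈ Finset.range m, (x ^ j * s) ^ p / (x ^ j * s) ^ k ≤
      (s ^ p / s ^ k) * (x ^ j) ^ (p - k) := by
    intro j _
    rw [Real.mul_rpow (by positivity) hs.le, Real.rpow_sub (by positivity), Real.rpow_natCast,
      mul_pow]
    apply le_of_eq
    field_simp
  refine (Finset.sum_le_sum key).trans ?_
  rw [← Finset.mul_sum, mul_comm]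
  exact mul_le_mul_of_nonneg_right (sum_pow_rpow_le_of_neg hx (sub_neg.2 hk) m) (by positivity)

lemma GoodModulus.intervalIntegrable (h : GoodModulus ω n q r C) {a b : ℝ} (ha : 0 < a)
    (hb : 0 < b) (k : ℕ) : IntervalIntegrable (fun t => ω t / t ^ k) volume a b := by
  refine ContinuousOn.intervalIntegrable fun t ht => ?_
  have ht0 : 0 < t := (lt_min ha hb).trans_le ht.1
  have h1 : ContinuousAt ω t := h.continuousOn.continuousAt (Ici_mem_nhds ht0)
  exact (h1.div (by fun_prop) (by positivity)).continuousWithinAt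

lemma GoodModulus.integral_mono_left (h : GoodModulus ω n q r C) {a b c : ℝ} (ha : 0 < a)
    (hab : a ≤ b) (hc : 0 < c) (k : ℕ) :
    ∫ t in b..c, ω t / t ^ k ≤ ∫ t in a..c, ω t / t ^ k := by
  have hb := ha.trans_le hab
  rw [← intervalIntegral.integral_add_adjacent_intervals (h.intervalIntegrable ha hb k)
    (h.intervalIntegrable hb hc k)]
  have := intervalIntegral.integral_nonneg (μ := volume) (f := fun t => ω t / t ^ k) hab
    fun t ht => by
      have ht0 := ha.trans_le ht.1
      have := h.pos t ht0
      positivity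
  linarith

lemma GoodModulus.le_integral_step (h : GoodModulus ω n q r C) (hx : 1 < x) (hs : 0 < s) :
    ω s / s ^ n ≤ x ^ (n + 1) * (x - 1)⁻¹ * ∫ t in s..(x * s), ω t / t ^ (n + 1) := by
  have hx0 : 0 < x := one_pos.trans hx
  have hsx : s ≤ x * s := le_mul_of_one_le_left hs.le hx.le
  have h1 : ∫ _t in s..(x * s), ω s / (x * s) ^ (n + 1) ≤ ∫ t in s..(x * s), ω t / t ^ (n + 1) := by
    refine intervalIntegral.integral_mono_on hsx (by simp)
      (h.intervalIntegrable hs (by positivity) _) fun t ht => ?_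
    have ht0 := hs.trans_le ht.1
    have hω := h.pos t ht0
    have := h.mono hs.le ht.1
    gcongr
    exact ht.2
  rw [intervalIntegral.integral_const, smul_eq_mul] at h1
  have hx1 : 0 < x - 1 := sub_pos.2 hx
  calc ω s / s ^ n = x ^ (n + 1) * (x - 1)⁻¹ * ((x * s - s) * (ω s / (x * s) ^ (n + 1))) := by
        rw [mul_pow, pow_succ s]
        field_simp
    _ ≤ _ := by gcongr

/-- In the critical degree `n` neither end dominates. This lemma and `GoodModulus.integral_le_sum`
identify the sum, up to constants, with the logarithmic integral. -/
lemma GoodModulus.sum_le_integral (h : GoodModulus ω n q r C) (hx : 1 < x) (hs : 0 < s) (m : ℕ) :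
    ∑ j ∈ Finset.range m, ω (x ^ j * s) / (x ^ j * s) ^ n ≤
      x ^ (n + 1) * (x - 1)⁻¹ * ∫ t in s..(x ^ m * s), ω t / t ^ (n + 1) := by
  have hx0 : 0 < x := one_pos.trans hx
  induction m with
  | zero => simp
  | succ m ih =>
    rw [Finset.sum_range_succ]
    have h1 := h.le_integral_step (s := x ^ m * s) hx (by positivity)
    rw [← mul_assoc, ← pow_succ'] at h1
    refine (add_le_add ih h1).trans_eq ?_
    rw [← mul_add, intervalIntegral.integral_add_adjacent_intervals
      (h.intervalIntegrable hs (by positivity) _)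
      (h.intervalIntegrable (by positivity) (by positivity) _)]

lemma GoodModulus.integral_le_sum (h : GoodModulus ω n q r C) (hx : 1 < x) (hs : 0 < s) (m : ℕ) :
    ∫ t in s..(x ^ m * s), ω t / t ^ (n + 1) ≤
      C * x ^ q * (x - 1) * ∑ j ∈ Finset.range m, ω (x ^ j * s) / (x ^ j * s) ^ n := by
  have hx0 : 0 < x := one_pos.trans hx
  have hx1 : 0 < x - 1 := sub_pos.2 hx
  induction m with
  | zero => simp
  | succ m ih =>
    have hs' : 0 < x ^ m * s := by positivity
    rw [Finset.sum_range_succ, mul_add, ← intervalIntegral.integral_add_adjacent_intervals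
      (h.intervalIntegrable hs hs' _) (h.intervalIntegrable hs' (by positivity) _)]
    refine add_le_add ih ?_
    generalize hu : x ^ m * s = u at hs' ⊢
    have hu' : x ^ (m + 1) * s = x * u := by rw [← hu]; ring
    rw [hu']
    have hux : u ≤ x * u := le_mul_of_one_le_left hs'.le hx.le
    have h1 : ∫ t in u..(x * u), ω t / t ^ (n + 1) ≤
        ∫ _t in u..(x * u), C * x ^ q * ω u / u ^ (n + 1) := by
      refine intervalIntegral.integral_mono_on hux
        (h.intervalIntegrable hs' (by positivity) _) (by simp) fun t ht => ?_
      have ht0 := hs'.trans_le ht.1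
      have hω := h.pos u hs'
      have := h.le_mul_of_le hx.le hs' ht.2 ht0.le
      have hC := h.const_pos
      gcongr
      exact ht.1
    refine h1.trans_eq ?_
    rw [intervalIntegral.integral_const, smul_eq_mul, pow_succ u]
    field_simp

/-- The denominator `max {1, ∫_x^1 ω(t) t^{-n-1} dt}` of the associated modulus. -/
def logFactor (ω : ℝ → ℝ) (n : ℕ) (x : ℝ) : ℝ := max 1 (∫ t in x..1, ω t / t ^ (n + 1))

lemma one_le_logFactor (ω : ℝ → ℝ) (n : ℕ) (x : ℝ) : 1 ≤ logFactor ω n x := le_max_left _ _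

lemma integral_le_logFactor (ω : ℝ → ℝ) (n : ℕ) (x : ℝ) :
    ∫ t in x..1, ω t / t ^ (n + 1) ≤ logFactor ω n x := le_max_right _ _

/-- If `2s ≤ 1`, the interval from `s` to `2s` alone contributes this much to the integral.
Otherwise `s` is bounded below and the `1` in the maximum suffices. -/
lemma GoodModulus.div_pow_le_logFactor (h : GoodModulus ω n q r C) {M : ℝ} (hM : 1 ≤ M) (hs : 0 < s)
    (hsM : s ≤ M) : ω s / s ^ n ≤ (2 ^ (n + 1) + ω M * 2 ^ n) * logFactor ω n s := by
  have hJ := one_le_logFactor ω n s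
  have hωM := h.pos M (by linarith)
  rcases le_total (2 * s) 1 with h1 | h1
  · have h2 := h.le_integral_step one_lt_two hs
    have h3 : ∫ t in s..(2 * s), ω t / t ^ (n + 1) ≤ ∫ t in s..1, ω t / t ^ (n + 1) := by
      rw [← intervalIntegral.integral_add_adjacent_intervals
        (h.intervalIntegrable hs (by positivity : 0 < 2 * s) _)
        (h.intervalIntegrable (by positivity) one_pos _)]
      have := intervalIntegral.integral_nonneg (μ := volume)
        (f := fun t => ω t / t ^ (n + 1)) h1 fun t ht => by
          have ht0 : 0 < t := (by positivity : 0 < 2 * s).trans_le ht.1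
          have := h.pos t ht0
          positivity
      linarith
    have h4 := integral_le_logFactor ω n s
    have h5 : (2 - 1 : ℝ)⁻¹ = 1 := by norm_num
    rw [h5, mul_one] at h2
    calc ω s / s ^ n ≤ 2 ^ (n + 1) * logFactor ω n s := h2.trans (by gcongr; linarith)
      _ ≤ _ := by
        gcongr
        have : 0 < ω M * 2 ^ n := by positivity
        linarith
  · have h2 := h.mono hs.le hsM
    calc ω s / s ^ n ≤ ω M / (1 / 2) ^ n := by gcongr; linarith
      _ = ω M * 2 ^ n := by rw [one_div, inv_pow, div_inv_eq_mul]
      _ ≤ (2 ^ (n + 1) + ω M * 2 ^ n) * 1 := by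
        have : (0 : ℝ) < 2 ^ (n + 1) := by positivity
        linarith
      _ ≤ _ := by gcongr

/-- The additional piece of the integral, from `η s` to `s`, is of size `ω(s) / s ^ n`, which the
factor at `s` already dominates. -/
lemma GoodModulus.exists_logFactor_mul_le (h : GoodModulus ω n q r C) {M η : ℝ} (hM : 1 ≤ M)
    (hη : 0 < η) (hη1 : η ≤ 1) : ∃ B : ℝ, 0 < B ∧ ∀ s, 0 < s → s ≤ M →
      logFactor ω n (η * s) ≤ B * logFactor ω n s := by
  have hωM := h.pos M (by linarith)
  refine ⟨1 + (η ^ (n + 1))⁻¹ * (2 ^ (n + 1) + ω M * 2 ^ n), by positivity, fun s hs hsM => ?_⟩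
  have hJ := one_le_logFactor ω n s
  have hηs : 0 < η * s := by positivity
  have hle : η * s ≤ s := mul_le_of_le_one_left hs.le hη1
  have h0 := h.div_pow_le_logFactor hM hs hsM
  have h1 : ∫ t in (η * s)..s, ω t / t ^ (n + 1) ≤ (η ^ (n + 1))⁻¹ * (ω s / s ^ n) := by
    have h2 : ∫ t in (η * s)..s, ω t / t ^ (n + 1) ≤
        ∫ _t in (η * s)..s, ω s / (η * s) ^ (n + 1) := by
      refine intervalIntegral.integral_mono_on hle
        (h.intervalIntegrable hηs hs _) (by simp) fun t ht => ?_
      have ht0 := hηs.trans_le ht.1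
      have hω := h.pos s hs
      have := h.mono ht0.le ht.2
      gcongr
      exact ht.1
    refine h2.trans ?_
    rw [intervalIntegral.integral_const, smul_eq_mul, mul_pow]
    have hω := h.pos s hs
    calc (s - η * s) * (ω s / (η ^ (n + 1) * s ^ (n + 1)))
        ≤ s * (ω s / (η ^ (n + 1) * s ^ (n + 1))) := by gcongr; linarith
      _ = _ := by rw [pow_succ s]; field_simp
  refine max_le ?_ ?_
  · have : 0 < (η ^ (n + 1))⁻¹ * (2 ^ (n + 1) + ω M * 2 ^ n) := by positivity
    nlinarith
  · rw [← intervalIntegral.integral_add_adjacent_intervals (h.intervalIntegrable hηs hs _)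
      (h.intervalIntegrable hs one_pos _)]
    have h3 := integral_le_logFactor ω n s
    have h4 : (η ^ (n + 1))⁻¹ * (ω s / s ^ n) ≤
      (η ^ (n + 1))⁻¹ * ((2 ^ (n + 1) + ω M * 2 ^ n) * logFactor ω n s) := by gcongr
    linarith

lemma GoodModulus.sum_le_logFactor (h : GoodModulus ω n q r C) (hx : 1 < x) (hs : 0 < s) {m : ℕ}
    (hm : x ^ m * s ≤ 1) : ∑ j ∈ Finset.range m, ω (x ^ j * s) / (x ^ j * s) ^ n ≤
      x ^ (n + 1) * (x - 1)⁻¹ * logFactor ω n s := by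
  have hx0 : 0 < x := one_pos.trans hx
  have hx1 : 0 < x - 1 := sub_pos.2 hx
  refine (h.sum_le_integral hx hs m).trans ?_
  gcongr
  refine le_trans ?_ (integral_le_logFactor ω n s)
  have hp : 0 < x ^ m * s := by positivity
  rw [← intervalIntegral.integral_add_adjacent_intervals (h.intervalIntegrable hs hp _)
    (h.intervalIntegrable hp one_pos _)]
  have := intervalIntegral.integral_nonneg (μ := volume) (f := fun t => ω t / t ^ (n + 1)) hm
    fun t ht => by
      have ht0 := hp.trans_le ht.1
      have := h.pos t ht0
      positivity
  linarith

lemma GoodModulus.logFactor_le_sum (h : GoodModulus ω n q r C) (hs : 0 < s) {m : ℕ}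
    (hm : 1 ≤ 2 ^ m * s) : logFactor ω n s ≤
      C * 2 ^ q * (1 + ∑ j ∈ Finset.range m, ω (2 ^ j * s) / (2 ^ j * s) ^ n) := by
  have hC := h.one_le_const
  have h2q : (1 : ℝ) ≤ 2 ^ q := Real.one_le_rpow one_le_two h.q_pos.le
  have hC2 : 1 ≤ C * 2 ^ q := one_le_mul_of_one_le_of_one_le hC h2q
  have hsum : 0 ≤ ∑ j ∈ Finset.range m, ω (2 ^ j * s) / (2 ^ j * s) ^ n :=
    Finset.sum_nonneg fun j _ => by
      have := h.pos (2 ^ j * s) (by positivity)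
      positivity
  refine max_le (by nlinarith) ?_
  have h1 := h.integral_le_sum one_lt_two hs m
  have hp : 0 < 2 ^ m * s := by positivity
  have h2 : ∫ t in s..1, ω t / t ^ (n + 1) ≤ ∫ t in s..(2 ^ m * s), ω t / t ^ (n + 1) := by
    rw [← intervalIntegral.integral_add_adjacent_intervals (h.intervalIntegrable hs one_pos _)
      (h.intervalIntegrable one_pos hp _)]
    have := intervalIntegral.integral_nonneg (μ := volume) (f := fun t => ω t / t ^ (n + 1)) hm
      fun t ht => by
        have ht0 : 0 < t := one_pos.trans_le ht.1
        have := h.pos t ht0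
        positivity
    linarith
  have h3 : C * 2 ^ q * (2 - 1) * ∑ j ∈ Finset.range m, ω (2 ^ j * s) / (2 ^ j * s) ^ n
    ≤ C * 2 ^ q * (1 + ∑ j ∈ Finset.range m, ω (2 ^ j * s) / (2 ^ j * s) ^ n) := by nlinarith
  linarith

end Sums

/-! ### The uniform interior cone property -/

/-- Near every point of `D`, cones with a common direction and fixed aperture lie in `D`. -/
structure UniformCone (D : Set (Rn d)) (c ρ : ℝ) : Prop where
  c_pos : 0 < c
  c_le : c ≤ 1
  ρ_pos : 0 < ρ
  exists_direction : ∀ x ∈ D, ∃ e : Rn d, ‖e‖ ≤ 1 ∧ ∀ x' ∈ D, ‖x' - x‖ ≤ ρ →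
    ∀ t, 0 < t → t ≤ ρ → Metric.ball (x' + t • e) (c * t) ⊆ D

/-- The segment from `x` to a point of the ball outside `D` is connected, hence meets the frontier,
and it stays in the ball. -/
lemma exists_frontier_of_not_ball_subset {D : Set (Rn d)} (hD : IsOpen D) {x : Rn d} (hx : x ∈ D) {ε : ℝ}
    (h : ¬ Metric.ball x ε ⊆ D) : ∃ a ∈ frontier D, ‖x - a‖ < ε := by
  obtain ⟨z, hz, hzD⟩ := not_subset.1 h
  have hε : 0 < ε := dist_nonneg.trans_lt hz
  have hmeet : ∃ a ∈ segment ℝ x z, a ∈ frontier D := by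
    by_contra! hno
    rw [hD.frontier_eq] at hno
    obtain ⟨w, -, hw1, hw2⟩ := (convex_segment (𝕜 := ℝ) x z).isPreconnected D (closure D)ᶜ hD
      isClosed_closure.isOpen_compl
      (fun w hw => or_iff_not_imp_left.2 fun h1 h2 => hno w hw ⟨h2, h1⟩)
      ⟨x, left_mem_segment ℝ x z, hx⟩
      ⟨z, right_mem_segment ℝ x z, fun h2 => hno z (right_mem_segment ℝ x z) ⟨h2, hzD⟩⟩
    exact hw2 (subset_closure hw1)
  obtain ⟨a, ha, haD⟩ := hmeet
  refine ⟨a, haD, ?_⟩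
  have := (convex_ball x ε).segment_subset (Metric.mem_ball_self hε) hz ha
  rwa [Metric.mem_ball, dist_comm, dist_eq_norm] at this

lemma IsBoundedLipschitzDomain.exists_uniformCone {D : Set (Rn d)}
    (hD : IsBoundedLipschitzDomain D) : ∃ c ρ, ρ ≤ 1 ∧ UniformCone D c ρ := by
  obtain ⟨δ, R, hR, h⟩ := hD
  -- Moving up by `t` raises the height above the graph by `t`, while a perturbation `v` costs at
  -- most `(1 + δ) ‖v‖`; this choice makes balls of radius `c t` affordable.
  set c : ℝ := (1 + δ)⁻¹ with hc
  have hδ : (0 : ℝ) ≤ δ := δ.2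
  have hc0 : 0 < c := by positivity
  have hc1 : c ≤ 1 := inv_le_one_of_one_le₀ (by linarith)
  refine ⟨c, min 1 (R / 16), min_le_left _ _, hc0, hc1, by positivity, fun x hx => ?_⟩
  by_cases hball : Metric.ball x (R / 8) ⊆ D
  -- Well inside `D` the zero direction works: all the balls concerned stay in the ball of radius `R
  -- / 8` about `x`.
  · refine ⟨0, by simp, fun x' _ hxx' t ht ht' => ?_⟩
    refine Subset.trans (Metric.ball_subset_ball' ?_) hball
    have h1 := ht'.trans (min_le_right _ _)
    have h2 := hxx'.trans (min_le_right _ _)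
    rw [smul_zero, add_zero, dist_eq_norm]
    nlinarith
  · obtain ⟨a, ha, hxa⟩ := exists_frontier_of_not_ball_subset h.isOpen hx hball
    obtain ⟨U, j, A, hA, hw⟩ := h.window a ha
    -- Near the boundary the direction is the vertical axis of the local graph, common to all nearby
    -- points.
    refine ⟨U.symm (EuclideanSpace.single j 1), by simp, fun x' hx' hxx' t ht ht' y hy => ?_⟩
    have h1 := ht'.trans (min_le_right _ _)
    have h2 := hxx'.trans (min_le_right _ _)
    set v : Rn d := y - (x' + t • U.symm (EuclideanSpace.single j 1)) with hv
    have hvn : ‖v‖ < c * t := by rwa [Metric.mem_ball, dist_eq_norm] at hy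
    have hyv : U (y - a) = U (x' - a) + t • EuclideanSpace.single j 1 + U v := by
      have : y - a = (x' - a) + t • U.symm (EuclideanSpace.single j 1) + v := by rw [hv]; abel
      rw [this]
      simp
    have hx'a : ‖x' - a‖ ≤ R / 8 + R / 16 := by
      calc ‖x' - a‖ ≤ ‖x' - x‖ + ‖x - a‖ := norm_sub_le_norm_sub_add_norm_sub _ _ _
        _ ≤ _ := by linarith
    have hw' : ∀ i, |U (x' - a) i| ≤ R / 2 := fun i => by
      refine (abs_apply_le_norm _ i).trans ?_
      rw [LinearIsometryEquiv.norm_map]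
      linarith
    have hwy : ∀ i, |U (y - a) i| ≤ R / 2 := fun i => by
      refine (abs_apply_le_norm _ i).trans ?_
      rw [hyv]
      refine (norm_add₃_le).trans ?_
      rw [LinearIsometryEquiv.norm_map, LinearIsometryEquiv.norm_map, norm_smul,
        PiLp.norm_single, Real.norm_of_nonneg ht.le]
      norm_num
      nlinarith
    rw [hw y hwy]
    have h3 := (hw x' hw').1 hx'
    have h4 : dist (A (WithLp.toLp 2 fun i => U (y - a) i.1))
        (A (WithLp.toLp 2 fun i => U (x' - a) i.1)) ≤ δ * ‖v‖ := by
      refine (hA.dist_le_mul _ _).trans ?_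
      gcongr
      rw [dist_eq_norm, ← LinearIsometryEquiv.norm_map U v]
      refine abs_le_of_sq_le_sq' ?_ (norm_nonneg _) |>.2
      rw [EuclideanSpace.real_norm_sq_eq, EuclideanSpace.real_norm_sq_eq]
      have h5 : ∀ i : {i : Fin d // i ≠ j}, ((WithLp.toLp 2 fun i => U (y - a) i.1) -
          (WithLp.toLp 2 fun i => U (x' - a) i.1) :
            EuclideanSpace ℝ {i : Fin d // i ≠ j}) i = U v i.1 := fun i => by
        simp [hyv, i.2]
      simp_rw [h5]
      calc ∑ i : {i : Fin d // i ≠ j}, U v i.1 ^ 2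
          = ∑ i ∈ Finset.univ.filter (fun i => i ≠ j), U v i ^ 2 :=
            (Finset.sum_subtype _ (by simp) fun i => U v i ^ 2).symm
        _ ≤ ∑ i, U v i ^ 2 :=
            Finset.sum_le_sum_of_subset_of_nonneg (Finset.filter_subset _ _)
              fun _ _ _ => sq_nonneg _
    have h5 : U (y - a) j = U (x' - a) j + t + U v j := by
      simp [hyv]
    have h6 : |U v j| ≤ ‖v‖ := by
      rw [← LinearIsometryEquiv.norm_map U v]
      exact abs_apply_le_norm _ j
    rw [Real.dist_eq] at h4
    have h7 : (1 + δ) * ‖v‖ < t := by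
      calc (1 + δ) * ‖v‖ < (1 + δ) * (c * t) := by gcongr
        _ = t := by rw [hc]; field_simp
    rw [h5]
    linarith [le_of_abs_le h4, neg_le_of_abs_le h6]

/-! ### Lebesgue points -/

/-- `x` is a Lebesgue point of `h`. -/
def LebesguePoint (h : Rn d → 𝕜) (x : Rn d) : Prop :=
  Tendsto (fun ρ => avgL1 (cube x ρ) fun y => h y - h x) (𝓝[>] 0) (𝓝 0)

/-- A cube and its circumscribed ball have comparable volumes, so convergence of averages over balls
passes to cubes. -/
lemma lebesguePoint_of_tendsto_closedBall (hd : 0 < d) {h : Rn d → 𝕜} {x : Rn d}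
    (hx : Tendsto (fun ρ => avgL1 (Metric.closedBall x ρ) fun y => h y - h x) (𝓝[>] 0) (𝓝 0)) :
    LebesguePoint h x := by
  have hd' : (0 : ℝ) < d := by exact_mod_cast hd
  have hlim : Tendsto (fun ρ : ℝ => d * (ρ / 2)) (𝓝[>] 0) (𝓝[>] 0) := by
    refine tendsto_nhdsWithin_iff.2 ⟨?_, ?_⟩
    · have : Tendsto (fun ρ : ℝ => d * (ρ / 2)) (𝓝 0) (𝓝 (d * (0 / 2))) :=
        Continuous.tendsto (by fun_prop) 0
      simpa using this.mono_left nhdsWithin_le_nhds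
    · filter_upwards [self_mem_nhdsWithin] with ρ hρ
      have : (0 : ℝ) < ρ := hρ
      exact mem_Ioi.2 (by positivity)
  have h1 := ENNReal.Tendsto.const_mul (a := ENNReal.ofReal ((d : ℝ) ^ d)) (hx.comp hlim)
    (Or.inr ENNReal.ofReal_ne_top)
  rw [mul_zero] at h1
  refine tendsto_of_tendsto_of_tendsto_of_le_of_le' tendsto_const_nhds h1
    (Eventually.of_forall fun _ => zero_le) ?_
  filter_upwards [self_mem_nhdsWithin] with ρ hρ
  have hρ : (0 : ℝ) < ρ := hρ
  refine avgL1_subset_cube_le hρ (by positivity) (cube_subset_closedBall x hρ.le) ?_ _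
  refine (measure_mono (?_ : _ ⊆ cube x (d * ρ))).trans ?_
  · refine Subset.trans ?_ (closedBall_subset_cube x _)
    rw [mul_div_assoc]
  · rw [volume_cube x (by positivity), mul_pow]

/-- The differentiation theorem is applied to countably many truncations of `h`, each integrable on
the whole space; near a given point of `D` one of them coincides with `h`. -/
lemma ae_lebesguePoint (hd : 0 < d) {D : Set (Rn d)} (hD : IsOpen D) {h : Rn d → 𝕜}
    (hh : LocallyIntegrableOn h D) : ∀ᵐ x, x ∈ D → LebesguePoint h x := by
  obtain ⟨u, u_open, hu, hintg⟩ := hh.exists_nat_integrableOn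
  let F := IsUnifLocDoublingMeasure.vitaliFamily (volume : Measure (Rn d)) 1
  have key : ∀ n, ∀ᵐ x : Rn d, Tendsto (fun a => (∫⁻ y in a,
      ‖(u n ∩ D).indicator h y - (u n ∩ D).indicator h x‖ₑ) / volume a) (F.filterAt x) (𝓝 0) :=
    fun n => F.ae_tendsto_lintegral_enorm_sub_div_of_integrable
      ((integrable_indicator_iff ((u_open n).inter hD).measurableSet).2 (hintg n))
  filter_upwards [ae_all_iff.2 key] with x hx hxD
  obtain ⟨n, hn⟩ := mem_iUnion.1 (hu hxD)
  have hopen := ((u_open n).inter hD).mem_nhds ⟨hn, hxD⟩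
  refine lebesguePoint_of_tendsto_closedBall hd ?_
  have hlim := IsUnifLocDoublingMeasure.tendsto_closedBall_filterAt (volume : Measure (Rn d))
    (K := 1) (x := x) (l := 𝓝[>] (0 : ℝ)) (fun _ => x) (fun ρ => ρ) tendsto_id (by
      filter_upwards [self_mem_nhdsWithin] with ρ hρ
      have : (0 : ℝ) < ρ := hρ
      exact Metric.mem_closedBall_self (by linarith))
  refine Tendsto.congr' ?_ ((hx n).comp hlim)
  filter_upwards [hlim.eventually (F.eventually_filterAt_subset_of_nhds hopen)] with ρ hρ
  simp only [Function.comp_apply, avgL1]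
  congr 1
  refine setLIntegral_congr_fun Metric.isClosed_closedBall.measurableSet fun y hy => ?_
  rw [indicator_of_mem (hρ hy), indicator_of_mem (show x ∈ u n ∩ D from ⟨hn, hxD⟩)]

/-! ### Comparison of approximating polynomials along chains of cubes -/

/-- Polynomials approximating the same function on overlapping cubes are close. -/
lemma exists_pnorm_sub_le (𝕜 : Type*) [RCLike 𝕜] (d n : ℕ) : ∃ C : ℝ, 0 < C ∧
    ∀ (h : Rn d → 𝕜) (P P' : MvPolynomial (Fin d) 𝕜) (a a' c : Rn d) (τ τ' μ κ M : ℝ),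
      P.totalDegree ≤ n → P'.totalDegree ≤ n → 0 < μ → 0 ≤ κ → 0 ≤ τ → 0 ≤ τ' → 0 ≤ M →
      τ ≤ κ * μ → τ' ≤ κ * μ →
      cube c μ ⊆ cube a τ → cube c μ ⊆ cube a' τ' →
      AEStronglyMeasurable h (volume.restrict (cube c μ)) →
      avgL1 (cube a τ) (fun x => h x - polyFun P x) ≤ ENNReal.ofReal M →
      avgL1 (cube a' τ') (fun x => h x - polyFun P' x) ≤ ENNReal.ofReal M →
      pnorm n μ (shift c (P - P')) ≤ C * κ ^ d * M := by
  obtain ⟨C, hC, hne⟩ := exists_pnorm_le_avgL1 𝕜 d n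
  refine ⟨C * 2, by positivity, fun h P P' a a' c τ τ' μ κ M hP hP' hμ hκ hτ hτ' hM hκτ hκτ'
    hsub hsub' hmeas h1 h2 => ?_⟩
  have hvol : ∀ (b : Rn d) (σ : ℝ), 0 ≤ σ → σ ≤ κ * μ →
      volume (cube b σ) ≤ ENNReal.ofReal (κ ^ d * μ ^ d) := fun b σ hσ h => by
    rw [volume_cube b hσ, ← mul_pow]
    gcongr
  have e1 := (avgL1_subset_cube_le hμ (by positivity) hsub (hvol a τ hτ hκτ)
    fun x => h x - polyFun P x).trans (mul_le_mul_right h1 _)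
  have e2 := (avgL1_subset_cube_le hμ (by positivity) hsub' (hvol a' τ' hτ' hκτ')
    fun x => h x - polyFun P' x).trans (mul_le_mul_right h2 _)
  have e3 : avgL1 (cube c μ) (polyFun (P - P')) ≤
      avgL1 (cube c μ) (fun x => h x - polyFun P' x) +
        avgL1 (cube c μ) (fun x => h x - polyFun P x) := by
    have : avgL1 (cube c μ) (fun x => h x - polyFun P x) =
        avgL1 (cube c μ) (fun x => polyFun P x - h x) := by
      simp_rw [avgL1, ← enorm_neg (h _ - polyFun P _), neg_sub]
    rw [this]
    refine le_trans (le_of_eq ?_) (avgL1_add_le ?_)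
    · congr 1
      funext x
      rw [polyFun_sub]
      ring
    · exact hmeas.sub (continuous_polyFun P').aestronglyMeasurable
  have e4 := (hne (P - P') ((MvPolynomial.totalDegree_sub _ _).trans (max_le hP hP')) c μ hμ).trans
    (mul_le_mul_right (e3.trans (add_le_add e2 e1)) _)
  rw [← ENNReal.ofReal_mul (by positivity), ← ENNReal.ofReal_add (by positivity) (by positivity),
    ← ENNReal.ofReal_mul hC.le, ENNReal.ofReal_le_ofReal_iff (by positivity)] at e4
  linarith

/-- The polynomials `P t`, `0 < t ≤ T`, approximate `h` on cubes of side `σ t` centred at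
`x + t v`. -/
structure ApproxChain (ω : ℝ → ℝ) (n : ℕ) (N : ℝ) (h : Rn d → 𝕜) (x v : Rn d) (σ T : ℝ)
    (P : ℝ → MvPolynomial (Fin d) 𝕜) : Prop where
  totalDegree_le : ∀ t, 0 < t → t ≤ T → (P t).totalDegree ≤ n
  aestronglyMeasurable : ∀ t, 0 < t → t ≤ T →
    AEStronglyMeasurable h (volume.restrict (cube (x + t • v) (σ * t)))
  avg_le : ∀ t, 0 < t → t ≤ T →
    avgL1 (cube (x + t • v) (σ * t)) (fun y => h y - polyFun (P t) y) ≤ ENNReal.ofReal (N * ω t)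

/-- The ratio of consecutive scales of a chain. -/
def chainRatio (σ V : ℝ) : ℝ := 1 + σ / (4 * V)

lemma one_lt_chainRatio {σ V : ℝ} (hσ : 0 < σ) (hV : 1 ≤ V) : 1 < chainRatio σ V := by
  have : 0 < σ / (4 * V) := by positivity
  rw [chainRatio]
  linarith

lemma chainRatio_le_two {σ V : ℝ} (hσ1 : σ ≤ 1) (hV : 1 ≤ V) :
    chainRatio σ V ≤ 2 := by
  have : σ / (4 * V) ≤ 1 := (div_le_one (by positivity)).2 (by linarith)
  rw [chainRatio]
  linarith

section Chain

variable {ω : ℝ → ℝ} {n : ℕ} {q r Cω : ℝ}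

/-- The two polynomials are compared on a cube common to consecutive cubes of the chain; the result
is recentred at the tip `x`, which is at distance of order `V t`. -/
lemma GoodModulus.exists_chain_step (hω : GoodModulus ω n q r Cω) (𝕜 : Type*) [RCLike 𝕜] (d : ℕ)
    {σ V : ℝ} (hσ : 0 < σ) (hσ1 : σ ≤ 1) (hV : 1 ≤ V) : ∃ C : ℝ, 0 < C ∧
    ∀ (N : ℝ) (h : Rn d → 𝕜) (x v : Rn d) (T : ℝ) (P : ℝ → MvPolynomial (Fin d) 𝕜), 0 ≤ N →
      (∀ i, |v i| ≤ V) → ApproxChain ω n N h x v σ T P →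
      ∀ t, 0 < t → chainRatio σ V * t ≤ T →
        pnorm n t (shift x (P t - P (chainRatio σ V * t))) ≤ C * N * ω t := by
  obtain ⟨C₁, hC₁, hsub⟩ := exists_pnorm_sub_le 𝕜 d n
  obtain ⟨C₂, hC₂, hshift⟩ := exists_pnorm_shift_le 𝕜 d n
  set l := chainRatio σ V with hl
  have hl1 : 1 < l := one_lt_chainRatio hσ hV
  have hl2 : l ≤ 2 := chainRatio_le_two hσ1 hV
  have hCω := hω.const_pos
  have hCω1 := hω.one_le_const
  have h2q : (1 : ℝ) ≤ 2 ^ q := Real.one_le_rpow one_le_two hω.q_pos.le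
  refine ⟨C₂ * V ^ n * ((2 / σ) ^ n * (C₁ * 4 ^ d * (Cω * 2 ^ q))), by positivity,
    fun N h x v T P hN hv hch t ht htT => ?_⟩
  have hlt : 0 < l * t := by positivity
  have htT' : t ≤ T := le_trans (le_mul_of_one_le_left ht.le hl1.le) htT
  have hωt := hω.pos t ht
  have hcub1 : cube (x + t • v) (σ * t / 2) ⊆ cube (x + t • v) (σ * t) :=
    cube_subset_cube_self _ (by nlinarith [mul_pos hσ ht])
  -- The chain ratio is chosen so that consecutive centres differ by at most `σ t / 4` in each
  -- coordinate, hence the half cube lies in both cubes.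
  have hcub2 : cube (x + t • v) (σ * t / 2) ⊆ cube (x + (l * t) • v) (σ * (l * t)) := by
    refine cube_subset_cube fun i => ?_
    have e1 : (x + t • v) i - (x + (l * t) • v) i = -((l - 1) * t * v i) := by
      simp only [PiLp.add_apply, PiLp.smul_apply, smul_eq_mul]; ring
    have e2 : l - 1 = σ / (4 * V) := by rw [hl, chainRatio]; ring
    rw [e1, abs_neg, abs_mul, abs_of_pos (mul_pos (by linarith) ht), e2]
    have e3 : σ / (4 * V) * t * |v i| ≤ σ / (4 * V) * t * V := by gcongr; exact hv i
    have e4 : σ / (4 * V) * t * V = σ * t / 4 := by field_simp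
    have e5 : 0 < σ * t := by positivity
    nlinarith
  have hle : N * ω t ≤ N * (Cω * 2 ^ q * ω t) := by
    gcongr
    exact le_mul_of_one_le_left hωt.le (one_le_mul_of_one_le_of_one_le hCω1 h2q)
  have hle' : N * ω (l * t) ≤ N * (Cω * 2 ^ q * ω t) := by
    gcongr
    exact hω.le_mul_of_le one_le_two ht (by gcongr) hlt.le
  have hp := hsub h (P t) (P (l * t)) (x + t • v) (x + (l * t) • v) (x + t • v) (σ * t)
    (σ * (l * t)) (σ * t / 2) 4 (N * (Cω * 2 ^ q * ω t)) (hch.totalDegree_le t ht htT')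
    (hch.totalDegree_le _ hlt htT) (by positivity) (by positivity) (by positivity) (by positivity)
    (by positivity) (by nlinarith [mul_pos hσ ht]) (by nlinarith [mul_pos hσ ht]) hcub1 hcub2
    ((hch.aestronglyMeasurable t ht htT').mono_measure (Measure.restrict_mono hcub1 le_rfl))
    ((hch.avg_le t ht htT').trans (ENNReal.ofReal_le_ofReal hle))
    ((hch.avg_le _ hlt htT).trans (ENNReal.ofReal_le_ofReal hle'))
  have hdeg : (P t - P (l * t)).totalDegree ≤ n := (MvPolynomial.totalDegree_sub _ _).trans
    (max_le (hch.totalDegree_le t ht htT') (hch.totalDegree_le _ hlt htT))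
  have hscale := pnorm_mul_le (n := n) (τ := σ * t / 2) (μ := 2 / σ) (by positivity)
    (by rw [le_div_iff₀ hσ]; linarith) (shift (x + t • v) (P t - P (l * t)))
  have e6 : 2 / σ * (σ * t / 2) = t := by field_simp
  rw [e6] at hscale
  have hcen := hshift (P t - P (l * t)) hdeg x (x + t • v) t V ht hV fun i => by
    simp only [PiLp.add_apply, PiLp.smul_apply, smul_eq_mul]
    rw [sub_add_cancel_left, abs_neg, abs_mul, abs_of_pos ht, mul_comm]
    gcongr
    exact hv i
  calc _ ≤ C₂ * V ^ n * pnorm n t (shift (x + t • v) (P t - P (l * t))) := hcen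
    _ ≤ C₂ * V ^ n * ((2 / σ) ^ n * (C₁ * 4 ^ d * (N * (Cω * 2 ^ q * ω t)))) := by
      gcongr
      exact hscale.trans (by gcongr)
    _ = _ := by ring

/-- Telescoping along the chain. Reading off a coefficient of degree `k` at scale `t` costs a factor
`t ^ (-k)`; the coefficients are all taken about the same tip, so no recentring error accumulates.
-/
lemma GoodModulus.exists_chain_coeff (hω : GoodModulus ω n q r Cω) (𝕜 : Type*) [RCLike 𝕜] (d : ℕ)
    {σ V : ℝ} (hσ : 0 < σ) (hσ1 : σ ≤ 1) (hV : 1 ≤ V) : ∃ C : ℝ, 0 < C ∧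
    ∀ (N : ℝ) (h : Rn d → 𝕜) (x v : Rn d) (T : ℝ) (P : ℝ → MvPolynomial (Fin d) 𝕜), 0 ≤ N →
      (∀ i, |v i| ≤ V) → ApproxChain ω n N h x v σ T P →
      ∀ (s : ℝ) (m : ℕ), 0 < s → chainRatio σ V ^ m * s ≤ T → ∀ α : Fin d →₀ ℕ, α.degree ≤ n →
        ‖(shift x (P s - P (chainRatio σ V ^ m * s))).coeff α‖ ≤ C * N *
          ∑ j ∈ Finset.range m, ω (chainRatio σ V ^ j * s) / (chainRatio σ V ^ j * s) ^ α.degree := by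
  obtain ⟨C, hC, hstep⟩ := hω.exists_chain_step 𝕜 d hσ hσ1 hV
  have hl1 : 1 < chainRatio σ V := one_lt_chainRatio hσ hV
  refine ⟨C, hC, fun N h x v T P hN hv hch s m hs hsT α hα => ?_⟩
  induction m with
  | zero => simp [shift]
  | succ m ih =>
    have hp : 0 < chainRatio σ V ^ m * s := by positivity
    have hle : chainRatio σ V ^ m * s ≤ T := le_trans (by gcongr; exacts [hl1.le, m.le_succ]) hsT
    have e1 : chainRatio σ V ^ (m + 1) * s = chainRatio σ V * (chainRatio σ V ^ m * s) := by ring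
    have h1 := hstep N h x v T P hN hv hch _ hp (e1 ▸ hsT)
    have h2 := (norm_coeff_le_pnorm (n := n) hp
      (shift x (P (chainRatio σ V ^ m * s) - P (chainRatio σ V * (chainRatio σ V ^ m * s)))) hα)
    have h3 : P s - P (chainRatio σ V ^ (m + 1) * s) = (P s - P (chainRatio σ V ^ m * s)) +
        (P (chainRatio σ V ^ m * s) - P (chainRatio σ V * (chainRatio σ V ^ m * s))) := by
      rw [e1]; ring
    rw [h3, shift_add, MvPolynomial.coeff_add, Finset.sum_range_succ, mul_add]
    refine (norm_add_le _ _).trans (add_le_add (ih hle) (h2.trans ?_))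
    rw [mul_div_assoc']
    gcongr

lemma norm_coeff_zero_shift (x : Rn d) (P : MvPolynomial (Fin d) 𝕜) :
    (shift x P).coeff 0 = polyFun P x := by
  have h := polyFun_shift x P 0
  rw [zero_add] at h
  rw [← h, polyFun, ← MvPolynomial.constantCoeff_eq, ← MvPolynomial.eval_zero]
  congr 2
  funext i
  simp

/-- Along a chain shrinking to `x` the values `P t x` vary by at most `N ω(T)`. -/
lemma GoodModulus.exists_chain_value (hω : GoodModulus ω n q r Cω) (𝕜 : Type*) [RCLike 𝕜] (d : ℕ)
    {σ V : ℝ} (hσ : 0 < σ) (hσ1 : σ ≤ 1) (hV : 1 ≤ V) : ∃ C : ℝ, 0 < C ∧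
    ∀ (N : ℝ) (h : Rn d → 𝕜) (x v : Rn d) (T : ℝ) (P : ℝ → MvPolynomial (Fin d) 𝕜), 0 ≤ N →
      (∀ i, |v i| ≤ V) → ApproxChain ω n N h x v σ T P →
      ∀ (s : ℝ) (m : ℕ), 0 < s → chainRatio σ V ^ m * s ≤ T →
        ‖polyFun (P s) x - polyFun (P (chainRatio σ V ^ m * s)) x‖ ≤
          C * N * ω (chainRatio σ V ^ m * s) := by
  obtain ⟨C, hC, hco⟩ := hω.exists_chain_coeff 𝕜 d hσ hσ1 hV
  have hl1 : 1 < chainRatio σ V := one_lt_chainRatio hσ hV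
  have hr : ((0 : ℕ) : ℝ) < r := by simpa using hω.r_pos
  have hpos : 0 < (chainRatio σ V ^ (r - (0 : ℕ)) - 1)⁻¹ :=
    inv_pos.2 (sub_pos.2 (Real.one_lt_rpow hl1 (by simpa using hω.r_pos)))
  have hCω := hω.const_pos
  refine ⟨C * (Cω * (chainRatio σ V ^ (r - (0 : ℕ)) - 1)⁻¹), by positivity,
    fun N h x v T P hN hv hch s m hs hsT => ?_⟩
  have h1 := hco N h x v T P hN hv hch s m hs hsT 0 (by simp)
  rw [norm_coeff_zero_shift, polyFun_sub] at h1
  -- The value at the tip is the coefficient of degree `0 < r`, so the largest scale dominates.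
  have h2 := hω.sum_le_top hl1 hs hr m
  simp only [pow_zero, div_one, map_zero] at h1 h2
  calc _ ≤ C * N * (Cω * (chainRatio σ V ^ (r - (0 : ℕ)) - 1)⁻¹ * ω (chainRatio σ V ^ m * s)) :=
        h1.trans (by gcongr)
    _ = _ := by ring

lemma GoodModulus.tendsto_zero (hω : GoodModulus ω n q r Cω) : Tendsto ω (𝓝[>] 0) (𝓝 0) := by
  have h1 : Tendsto (fun s : ℝ => Cω * s ^ r * ω 1) (𝓝[>] 0) (𝓝 (Cω * 0 ^ r * ω 1)) := by
    refine Tendsto.mul_const _ (Tendsto.const_mul _ ?_)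
    exact (Real.continuousAt_rpow_const 0 r (Or.inr hω.r_pos.le)).tendsto.mono_left
      nhdsWithin_le_nhds
  rw [Real.zero_rpow hω.r_pos.ne', mul_zero, zero_mul] at h1
  refine tendsto_of_tendsto_of_tendsto_of_le_of_le' tendsto_const_nhds h1 ?_ ?_
  · filter_upwards [self_mem_nhdsWithin] with s hs using (hω.pos s hs).le
  · filter_upwards [Ioc_mem_nhdsGT one_pos] with s hs
    simpa using hω.le_of_le s 1 hs.1 hs.2

/-- After subtracting the constant `h x`, the polynomial at scale `t` is controlled by its average
over its cube, hence by the approximation error plus the mean oscillation of `h` about `x` on a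
comparable cube. Both tend to zero. -/
lemma ApproxChain.tendsto_of_lebesguePoint (hω : GoodModulus ω n q r Cω) {N : ℝ}
    {h : Rn d → 𝕜} {x v : Rn d} {σ V T : ℝ} {P : ℝ → MvPolynomial (Fin d) 𝕜} (hσ : 0 < σ)
    (hV : 1 ≤ V) (hT : 0 < T) (hv : ∀ i, |v i| ≤ V)
    (hch : ApproxChain ω n N h x v σ T P) (hx : LebesguePoint h x) :
    Tendsto (fun t => polyFun (P t) x) (𝓝[>] 0) (𝓝 (h x)) := by
  obtain ⟨C₁, hC₁, hne⟩ := exists_pnorm_le_avgL1 𝕜 d n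
  -- The dilation that makes the cube centred at `x` contain the cube of the chain at the same
  -- scale.
  set κ := 2 * V / σ + 1 with hκ
  have hκ0 : 0 < κ := by positivity
  have hbound : ∀ t, 0 < t → t ≤ T → ‖polyFun (P t) x - h x‖ₑ ≤
      ENNReal.ofReal ((V / σ + 1) ^ n) * (ENNReal.ofReal C₁ * (ENNReal.ofReal (N * ω t) +
        ENNReal.ofReal (κ ^ d) * avgL1 (cube x (κ * (σ * t))) fun y => h y - h x)) := by
    intro t ht htT
    set a := x + t • v
    have hσt : 0 < σ * t := by positivity
    have hdeg : (P t - MvPolynomial.C (h x)).totalDegree ≤ n :=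
      (MvPolynomial.totalDegree_sub_C_le _ _).trans (hch.totalDegree_le t ht htT)
    have e1 : ‖polyFun (P t) x - h x‖ ≤
        (V / σ + 1) ^ n * pnorm n (σ * t) (shift a (P t - MvPolynomial.C (h x))) := by
      have e2 : polyFun (P t) x - h x = polyFun (P t - MvPolynomial.C (h x)) x := by
        simp [polyFun_sub]
      rw [e2]
      refine (norm_polyFun_le hdeg (τ := (V / σ + 1) * (σ * t)) fun i => ?_).trans
        (pnorm_mul_le hσt.le (le_add_of_nonneg_left (by positivity)) _)
      have e3 : x i - a i = -(t * v i) := by simp [a]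
      rw [e3, abs_neg, abs_mul, abs_of_pos ht]
      have e4 : (V / σ + 1) * (σ * t) = t * V + σ * t := by field_simp
      rw [e4]
      nlinarith [hv i]
    have hcub : cube a (σ * t) ⊆ cube x (κ * (σ * t)) := by
      refine cube_subset_cube fun i => ?_
      have e3 : a i - x i = t * v i := by simp [a]
      rw [e3, abs_mul, abs_of_pos ht]
      have e4 : (κ * (σ * t) - σ * t) / 2 = t * V := by rw [hκ]; field_simp; ring
      rw [e4]
      gcongr
      exact hv i
    have e5 : avgL1 (cube a (σ * t)) (polyFun (P t - MvPolynomial.C (h x))) ≤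
        ENNReal.ofReal (N * ω t) +
        ENNReal.ofReal (κ ^ d) * avgL1 (cube x (κ * (σ * t))) fun y => h y - h x := by
      refine le_trans ?_ (add_le_add (hch.avg_le t ht htT) (avgL1_subcube_le hσt hκ0 hcub _))
      have e6 : avgL1 (cube a (σ * t)) (fun y => h y - polyFun (P t) y) =
          avgL1 (cube a (σ * t)) (fun y => polyFun (P t) y - h y) := by
        simp_rw [avgL1, ← enorm_neg (h _ - polyFun (P t) _), neg_sub]
      rw [e6]
      refine le_trans (le_of_eq ?_) (avgL1_add_le ?_)
      · congr 1
        funext y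
        simp [polyFun_sub]
      · exact (continuous_polyFun _).aestronglyMeasurable.sub (hch.aestronglyMeasurable t ht htT)
    calc ‖polyFun (P t) x - h x‖ₑ ≤ ENNReal.ofReal ((V / σ + 1) ^ n *
          pnorm n (σ * t) (shift a (P t - MvPolynomial.C (h x)))) := by
          rw [← ofReal_norm]
          exact ENNReal.ofReal_le_ofReal e1
      _ = ENNReal.ofReal ((V / σ + 1) ^ n) *
          ENNReal.ofReal (pnorm n (σ * t) (shift a (P t - MvPolynomial.C (h x)))) :=
          ENNReal.ofReal_mul (by positivity)
      _ ≤ _ := by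
          gcongr
          exact (hne _ hdeg a _ hσt).trans (by gcongr)
  have hlim1 : Tendsto (fun t => ENNReal.ofReal (N * ω t)) (𝓝[>] 0) (𝓝 0) := by
    have := ENNReal.tendsto_ofReal (hω.tendsto_zero.const_mul N)
    simpa using this
  have hlim2 : Tendsto (fun t => avgL1 (cube x (κ * (σ * t))) fun y => h y - h x)
      (𝓝[>] 0) (𝓝 0) := by
    refine hx.comp (tendsto_nhdsWithin_iff.2 ⟨?_, ?_⟩)
    · have : Tendsto (fun t : ℝ => κ * (σ * t)) (𝓝 0) (𝓝 (κ * (σ * 0))) :=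
        Continuous.tendsto (by fun_prop) 0
      simpa using this.mono_left nhdsWithin_le_nhds
    · filter_upwards [self_mem_nhdsWithin] with t ht
      have : (0 : ℝ) < t := ht
      exact mem_Ioi.2 (by positivity)
  have hlim := ENNReal.Tendsto.const_mul (a := ENNReal.ofReal ((V / σ + 1) ^ n))
    (ENNReal.Tendsto.const_mul (a := ENNReal.ofReal C₁) (hlim1.add
      (ENNReal.Tendsto.const_mul (a := ENNReal.ofReal (κ ^ d)) hlim2
        (Or.inr ENNReal.ofReal_ne_top))) (Or.inr ENNReal.ofReal_ne_top))
    (Or.inr ENNReal.ofReal_ne_top)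
  simp only [mul_zero, add_zero] at hlim
  rw [tendsto_iff_edist_tendsto_0]
  refine tendsto_of_tendsto_of_tendsto_of_le_of_le' tendsto_const_nhds hlim
    (Eventually.of_forall fun _ => zero_le) ?_
  filter_upwards [Ioc_mem_nhdsGT hT] with t ht
  rw [edist_eq_enorm_sub]
  exact hbound t ht.1 ht.2

lemma tendsto_pow_inv_mul {l T : ℝ} (hl : 1 < l) (hT : 0 < T) :
    Tendsto (fun j : ℕ => (l ^ j)⁻¹ * T) atTop (𝓝[>] 0) := by
  refine tendsto_nhdsWithin_iff.2 ⟨?_, Eventually.of_forall fun j => mem_Ioi.2 (by positivity)⟩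
  have := (tendsto_inv_atTop_zero.comp (tendsto_pow_atTop_atTop_of_one_lt hl)).mul_const T
  simpa using this

/-- At a Lebesgue point, the end of a chain approximates the value of the function. -/
lemma GoodModulus.exists_chain_lebesgue (hω : GoodModulus ω n q r Cω) (𝕜 : Type*) [RCLike 𝕜]
    (d : ℕ) {σ V : ℝ} (hσ : 0 < σ) (hσ1 : σ ≤ 1) (hV : 1 ≤ V) : ∃ C : ℝ, 0 < C ∧
    ∀ (N : ℝ) (h : Rn d → 𝕜) (x v : Rn d) (T : ℝ) (P : ℝ → MvPolynomial (Fin d) 𝕜), 0 ≤ N →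
      0 < T → (∀ i, |v i| ≤ V) → ApproxChain ω n N h x v σ T P → LebesguePoint h x →
        ‖h x - polyFun (P T) x‖ ≤ C * N * ω T := by
  obtain ⟨C, hC, hval⟩ := hω.exists_chain_value 𝕜 d hσ hσ1 hV
  have hl1 : 1 < chainRatio σ V := one_lt_chainRatio hσ hV
  refine ⟨C, hC, fun N h x v T P hN hT hv hch hx => ?_⟩
  -- Compare the top of the chain with the scales `l^{-j} T` and let `j` tend to infinity.
  have h1 := (hch.tendsto_of_lebesguePoint hω hσ hV hT hv hx).comp (tendsto_pow_inv_mul hl1 hT)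
  refine le_of_tendsto ((h1.sub_const (polyFun (P T) x)).norm) (Eventually.of_forall fun j => ?_)
  have e : chainRatio σ V ^ j * ((chainRatio σ V ^ j)⁻¹ * T) = T := by
    have : chainRatio σ V ^ j ≠ 0 := by positivity
    field_simp
  have h2 := hval N h x v T P hN hv hch ((chainRatio σ V ^ j)⁻¹ * T) j (by positivity) e.le
  rwa [e] at h2

end Chain

/-! ### Functions approximable on the cubes of a domain -/

/-- The polynomials `p a ℓ` approximate `h` on the cubes whose `κ`-dilates lie in `D`. -/
def CubeApprox (ω : ℝ → ℝ) (n : ℕ) (D : Set (Rn d)) (κ N : ℝ) (h : Rn d → 𝕜)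
    (p : Rn d → ℝ → MvPolynomial (Fin d) 𝕜) : Prop :=
  ∀ a ℓ, 0 < ℓ → cube a (κ * ℓ) ⊆ D → (p a ℓ).totalDegree ≤ n ∧
    avgL1 (cube a ℓ) (fun y => h y - polyFun (p a ℓ) y) ≤ ENNReal.ofReal (N * ω ℓ)

lemma aestronglyMeasurable_cube {D : Set (Rn d)} {h : Rn d → 𝕜} (hh : LocallyIntegrableOn h D)
    {a : Rn d} {ℓ : ℝ} (hD : cube a ℓ ⊆ D) :
    AEStronglyMeasurable h (volume.restrict (cube a ℓ)) :=
  hh.aestronglyMeasurable.mono_measure (Measure.restrict_mono hD le_rfl)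

section Approx

variable {ω : ℝ → ℝ} {n : ℕ} {q r Cω : ℝ}

/-- Approximation on the cubes lying deep in `D` yields pointwise approximation on all cubes. -/
lemma GoodModulus.exists_inner_bound (hω : GoodModulus ω n q r Cω) (𝕜 : Type*) [RCLike 𝕜] (d : ℕ)
    {κ : ℝ} (hκ : 1 ≤ κ) : ∃ C : ℝ, 0 < C ∧
    ∀ (D : Set (Rn d)) (N : ℝ) (h : Rn d → 𝕜) (p : Rn d → ℝ → MvPolynomial (Fin d) 𝕜), 0 ≤ N →
      LocallyIntegrableOn h D → CubeApprox ω n D κ N h p → ∀ a ℓ x, 0 < ℓ → cube a ℓ ⊆ D →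
      x ∈ cube a ℓ → LebesguePoint h x → ‖h x - polyFun (p a (ℓ / κ)) x‖ ≤ C * N * ω ℓ := by
  have hκ0 : 0 < κ := one_pos.trans_le hκ
  obtain ⟨C, hC, hleb⟩ := hω.exists_chain_lebesgue 𝕜 d (σ := κ⁻¹) (V := 1) (by positivity)
    (inv_le_one_of_one_le₀ hκ) le_rfl
  refine ⟨C, hC, fun D N h p hN hh hp a ℓ x hℓ hD hx hxL => ?_⟩
  -- The cubes of side `t` centred at `x + t v` are the images of the whole cube under homotheties
  -- centred at `x`, so they stay inside it. Shrinking them by `κ` gives cubes whose `κ`-dilates lie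
  -- in `D`, where approximation is available.
  set v : Rn d := ℓ⁻¹ • (a - x) with hv
  have hvi : ∀ i, v i = (a i - x i) / ℓ := fun i => by simp [hv]; ring
  have hcub : ∀ t, 0 < t → t ≤ ℓ → cube (x + t • v) t ⊆ cube a ℓ := by
    intro t ht htℓ
    refine cube_subset_cube fun i => ?_
    have e1 : (x + t • v) i - a i = (1 - t / ℓ) * (x i - a i) := by
      simp only [PiLp.add_apply, PiLp.smul_apply, smul_eq_mul, hvi]
      field_simp
      ring
    have e2 : 0 ≤ 1 - t / ℓ := sub_nonneg.2 ((div_le_one hℓ).2 htℓ)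
    rw [e1, abs_mul, abs_of_nonneg e2]
    calc (1 - t / ℓ) * |x i - a i| ≤ (1 - t / ℓ) * (ℓ / 2) := by gcongr; exact hx i
      _ = (ℓ - t) / 2 := by field_simp
  have hsub : ∀ t, 0 < t → t ≤ ℓ → cube (x + t • v) (κ * (κ⁻¹ * t)) ⊆ D := fun t ht htℓ => by
    rw [mul_inv_cancel_left₀ hκ0.ne']
    exact (hcub t ht htℓ).trans hD
  have hle : ∀ t, 0 < t → κ⁻¹ * t ≤ t := fun t ht =>
    mul_le_of_le_one_left ht.le (inv_le_one_of_one_le₀ hκ)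
  have hch : ApproxChain ω n N h x v κ⁻¹ ℓ (fun t => p (x + t • v) (κ⁻¹ * t)) :=
    ⟨fun t ht htℓ => (hp _ _ (by positivity) (hsub t ht htℓ)).1,
    fun t ht htℓ => aestronglyMeasurable_cube hh
      (((cube_subset_cube_self _ (hle t ht)).trans (hcub t ht htℓ)).trans hD),
    fun t ht htℓ => (hp _ _ (by positivity) (hsub t ht htℓ)).2.trans
      (ENNReal.ofReal_le_ofReal (by gcongr; exact hω.mono (by positivity) (hle t ht)))⟩
  have h1 := hleb N h x v ℓ _ hN hℓ (fun i => by
    rw [hvi, abs_div, abs_of_pos hℓ, div_le_one hℓ, abs_sub_comm]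
    linarith [hx i]) hch hxL
  have e3 : x + ℓ • v = a := by
    rw [hv, smul_inv_smul₀ hℓ.ne']
    abel
  rw [e3] at h1
  rwa [div_eq_inv_mul]

/-- Comparison takes place on the inner cube; since the sides are comparable, rescaling and
recentring to the outer cube cost only constants. -/
lemma GoodModulus.exists_nested_bound (hω : GoodModulus ω n q r Cω) (𝕜 : Type*) [RCLike 𝕜]
    (d : ℕ) {κ : ℝ} (hκ : 1 ≤ κ) : ∃ C : ℝ, 0 < C ∧
    ∀ (D : Set (Rn d)) (N : ℝ) (h : Rn d → 𝕜) (p : Rn d → ℝ → MvPolynomial (Fin d) 𝕜), 0 ≤ N →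
      LocallyIntegrableOn h D → CubeApprox ω n D 1 N h p → ∀ a ℓ b τ, 0 < ℓ → 0 < τ → τ ≤ ℓ →
      cube a ℓ ⊆ D → cube b τ ⊆ cube a ℓ → ℓ ≤ κ * τ →
      pnorm n ℓ (shift a (p a ℓ - p b τ)) ≤ C * N * ω ℓ := by
  obtain ⟨C₁, hC₁, hsub⟩ := exists_pnorm_sub_le 𝕜 d n
  obtain ⟨C₂, hC₂, hshift⟩ := exists_pnorm_shift_le 𝕜 d n
  refine ⟨C₂ * (κ ^ n * (C₁ * κ ^ d)), by positivity,
    fun D N h p hN hh hp a ℓ b τ hℓ hτ hτℓ hD hcub hℓκ => ?_⟩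
  have hωℓ := hω.pos ℓ hℓ
  obtain ⟨hd1, ha1⟩ := hp a ℓ hℓ (by rwa [one_mul])
  obtain ⟨hd2, ha2⟩ := hp b τ hτ (by rw [one_mul]; exact hcub.trans hD)
  have h1 := hsub h (p a ℓ) (p b τ) a b b ℓ τ τ κ (N * ω ℓ) hd1 hd2 hτ (by positivity)
    hℓ.le hτ.le (by positivity) hℓκ (le_mul_of_one_le_left hτ.le hκ) hcub subset_rfl
    (aestronglyMeasurable_cube hh (hcub.trans hD)) ha1
    (ha2.trans (ENNReal.ofReal_le_ofReal (by gcongr; exact hω.mono hτ.le hτℓ)))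
  have hdeg : (p a ℓ - p b τ).totalDegree ≤ n :=
    (MvPolynomial.totalDegree_sub _ _).trans (max_le hd1 hd2)
  have h2 := pnorm_mul_le (n := n) hτ.le hκ (shift b (p a ℓ - p b τ))
  have h3 := pnorm_le_of_le (n := n) hℓ.le hℓκ (shift b (p a ℓ - p b τ))
  have h4 := hshift _ hdeg a b ℓ 1 hℓ le_rfl fun i => by
    have := hcub (self_mem_cube b hτ.le) i
    rw [abs_sub_comm]
    linarith
  rw [one_pow, mul_one] at h4
  calc _ ≤ C₂ * (κ ^ n * (C₁ * κ ^ d * (N * ω ℓ))) := by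
        refine h4.trans ?_
        gcongr
        exact h3.trans (h2.trans (by gcongr))
    _ = _ := by ring

/-- Going up a chain the polynomials grow at most like the power `q`. -/
lemma GoodModulus.exists_chain_pnorm (hω : GoodModulus ω n q r Cω) (𝕜 : Type*) [RCLike 𝕜] (d : ℕ)
    {σ V : ℝ} (hσ : 0 < σ) (hσ1 : σ ≤ 1) (hV : 1 ≤ V) : ∃ C : ℝ, 0 < C ∧
    ∀ (N : ℝ) (h : Rn d → 𝕜) (x v : Rn d) (T : ℝ) (P : ℝ → MvPolynomial (Fin d) 𝕜), 0 ≤ N →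
      (∀ i, |v i| ≤ V) → ApproxChain ω n N h x v σ T P →
      ∀ (s : ℝ) (m : ℕ), 0 < s → chainRatio σ V ^ m * s ≤ T →
        pnorm n (chainRatio σ V ^ m * s) (shift x (P s - P (chainRatio σ V ^ m * s))) ≤
          C * N * ω s * (chainRatio σ V ^ m) ^ q := by
  obtain ⟨C, hC, hco⟩ := hω.exists_chain_coeff 𝕜 d hσ hσ1 hV
  set l := chainRatio σ V with hl
  have hl1 : 1 < l := one_lt_chainRatio hσ hV
  have hCω := hω.const_pos
  have hpos : ∀ k : ℕ, k ≤ n → 0 < (l ^ (q - k) - 1)⁻¹ := fun k hk => by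
    have h1 : (k : ℝ) ≤ n := by exact_mod_cast hk
    exact inv_pos.2 (sub_pos.2 (Real.one_lt_rpow hl1 (by linarith [hω.lt_q])))
  have hsum : 0 ≤ ∑ α ∈ multiIdx d n, C * (Cω * (l ^ (q - α.degree) - 1)⁻¹) :=
    Finset.sum_nonneg fun α hα => by
      have := hpos _ (mem_multiIdx.1 hα)
      positivity
  refine ⟨1 + ∑ α ∈ multiIdx d n, C * (Cω * (l ^ (q - α.degree) - 1)⁻¹), by positivity,
    fun N h x v T P hN hv hch s m hs hsT => ?_⟩
  have hωs := hω.pos s hs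
  have hlm : 0 < l ^ m * s := by positivity
  have hq : 0 < (l ^ m) ^ q := by positivity
  have key : ∀ α ∈ multiIdx d n, ‖(shift x (P s - P (l ^ m * s))).coeff α‖ *
      (l ^ m * s) ^ α.degree ≤ C * (Cω * (l ^ (q - α.degree) - 1)⁻¹) *
        (N * ω s * (l ^ m) ^ q) := by
    intro α hα
    have hα := mem_multiIdx.1 hα
    have hαn : (α.degree : ℝ) ≤ n := by exact_mod_cast hα
    have h1 := hco N h x v T P hN hv hch s m hs hsT α hα
    -- The strict inequality `n < q` is needed here, for the coefficients of degree `n`.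
    have h2 := hω.sum_le_bottom hl1 hs (k := α.degree) (by linarith [hω.lt_q]) m
    have h3 := h1.trans (mul_le_mul_of_nonneg_left h2 (by positivity))
    refine (mul_le_mul_of_nonneg_right h3 (by positivity)).trans_eq ?_
    field_simp
  refine (Finset.sum_le_sum key).trans ?_
  rw [← Finset.sum_mul]
  have : 0 ≤ N * ω s * (l ^ m) ^ q := by positivity
  nlinarith

/-! ### Hölder regularity in the interior -/

/-- The coefficients are kept separate so that each degree can be estimated by its own chain sum. -/
lemma norm_polyFun_sub_le_sum {P : MvPolynomial (Fin d) 𝕜} (hP : P.totalDegree ≤ n)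
    {a x : Rn d} {τ : ℝ} (h : ∀ i, |x i - a i| ≤ τ) :
    ‖polyFun P x - polyFun P a‖ ≤ ∑ α ∈ (multiIdx d n).filter (fun α => 1 ≤ α.degree),
      ‖(shift a P).coeff α‖ * τ ^ α.degree := by
  have h1 : polyFun P x = polyFun (shift a P) (x - a) := by rw [polyFun_shift, sub_add_cancel]
  have h2 : polyFun P a = polyFun (shift a P) 0 := by rw [polyFun_shift, zero_add]
  have hd := (totalDegree_shift_le a P).trans hP
  rw [h1, h2, polyFun_eq_sum hd, polyFun_eq_sum hd, ← Finset.sum_sub_distrib, Finset.sum_filter]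
  refine (norm_sum_le _ _).trans (Finset.sum_le_sum fun α _ => ?_)
  rw [← mul_sub, norm_mul]
  split_ifs with hα
  · have h0 : mono 𝕜 α (0 : Rn d) = 0 := by
      have : α ≠ 0 := by rintro rfl; simp at hα
      obtain ⟨i, hi⟩ := Finsupp.ne_iff.1 this
      exact Finset.prod_eq_zero (Finset.mem_univ i) (by simpa using hi)
    rw [h0, sub_zero]
    gcongr
    exact norm_mono_le (by simpa using h)
  · have : α = 0 := by
      rw [← Finsupp.degree_eq_zero_iff]
      omega
    subst this
    simp [mono]

/-- The Hölder exponent used near interior points. -/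
def holderExp (r : ℝ) : ℝ := min r (1 / 2)

lemma GoodModulus.holderExp_pos (hω : GoodModulus ω n q r Cω) : 0 < holderExp r :=
  lt_min hω.r_pos (by norm_num)

lemma exists_limit_of_cauchy_bound {a : ℕ → 𝕜} {b : ℕ → ℝ} (hb : Tendsto b atTop (𝓝 0))
    (h : ∀ i j, i ≤ j → ‖a j - a i‖ ≤ b i) : ∃ z, ∀ i, ‖a i - z‖ ≤ b i := by
  have hc : CauchySeq a := by
    refine cauchySeq_of_le_tendsto_0' b (fun i j hij => ?_) hb
    rw [dist_comm, dist_eq_norm]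
    exact h i j hij
  obtain ⟨z, hz⟩ := cauchySeq_tendsto_of_complete hc
  refine ⟨z, fun i => ?_⟩
  refine le_of_tendsto ((tendsto_const_nhds (x := a i)).sub hz).norm ?_
  filter_upwards [eventually_ge_atTop i] with j hj
  rw [norm_sub_rev]
  exact h i j hj

/-- For each `x` one uses the cube about `y` of side comparable to `|x - y|`. There `h x` is close
to the polynomial of that cube, whose difference from the polynomial at scale `T` varies little
between `x` and `y`. The constant `v` replaces `h y - polyFun (p y T) y`, since `y` need not be a
Lebesgue point. -/
lemma GoodModulus.exists_holder_bound (hω : GoodModulus ω n q r Cω) (𝕜 : Type*) [RCLike 𝕜]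
    (d : ℕ) : ∃ C : ℝ, 0 < C ∧
    ∀ (D : Set (Rn d)) (N : ℝ) (h : Rn d → 𝕜) (p : Rn d → ℝ → MvPolynomial (Fin d) 𝕜), 0 ≤ N →
      LocallyIntegrableOn h D → CubeApprox ω n D 1 N h p → ∀ y T, 0 < T → cube y T ⊆ D →
      ∃ v : 𝕜, ∀ x ∈ cube y T, LebesguePoint h x → x ≠ y →
        ‖h x - polyFun (p y T) x - v‖ ≤ C * N * ω T * (‖x - y‖ / T) ^ holderExp r := by
  obtain ⟨C₁, hC₁, hinner⟩ := hω.exists_inner_bound 𝕜 d le_rfl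
  obtain ⟨C₂, hC₂, hval⟩ := hω.exists_chain_value 𝕜 d (σ := 1) (V := 1) one_pos le_rfl le_rfl
  obtain ⟨C₃, hC₃, hco⟩ := hω.exists_chain_coeff 𝕜 d (σ := 1) (V := 1) one_pos le_rfl le_rfl
  set l := chainRatio 1 1 with hl
  set ε := holderExp r with hε
  have hε0 : 0 < ε := hω.holderExp_pos
  have hεr : ε ≤ r := min_le_left _ _
  -- Keeping the exponent strictly below `1` makes the sums of every degree at least `1` converge
  -- from the smallest scale.
  have hε1 : ε ≤ 1 / 2 := min_le_right _ _
  have hl1 : 1 < l := one_lt_chainRatio one_pos le_rfl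
  have hl2 : l ≤ 3 / 2 := by rw [hl, chainRatio]; norm_num
  have hl0 : 0 < l := one_pos.trans hl1
  have hCω := hω.const_pos
  set S : ℝ := ∑ α ∈ (multiIdx d n).filter (fun α => 1 ≤ α.degree),
    C₃ * Cω * (1 - l ^ (ε - α.degree))⁻¹ with hS
  have hS0 : 0 ≤ S := Finset.sum_nonneg fun α hα => by
    have h1 : (1 : ℝ) ≤ α.degree := by exact_mod_cast (Finset.mem_filter.1 hα).2
    have : l ^ (ε - α.degree) < 1 := Real.rpow_lt_one_of_one_lt_of_neg hl1 (by linarith)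
    have : 0 < (1 - l ^ (ε - α.degree))⁻¹ := inv_pos.2 (by linarith)
    positivity
  refine ⟨(C₁ * Cω + S + C₂ * Cω) * 3 ^ ε, by positivity,
    fun D N h p hN hh hp y T hT hD => ?_⟩
  have hωT := hω.pos T hT
  have hch : ApproxChain ω n N h y 0 1 T (fun t => p y t) := by
    have hsub : ∀ t, t ≤ T → cube y t ⊆ D := fun t ht => (cube_subset_cube_self y ht).trans hD
    refine ⟨fun t ht htT => (hp y t ht (by rw [one_mul]; exact hsub t htT)).1,
      fun t ht htT => ?_, fun t ht htT => ?_⟩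
    · rw [smul_zero, add_zero, one_mul]
      exact aestronglyMeasurable_cube hh (hsub t htT)
    · rw [smul_zero, add_zero, one_mul]
      exact (hp y t ht (by rw [one_mul]; exact hsub t htT)).2
  let tt : ℕ → ℝ := fun j => (l ^ j)⁻¹ * T
  have htt0 : ∀ j, 0 < tt j := fun j => by positivity
  have httT : ∀ j, tt j ≤ T := fun j =>
    mul_le_of_le_one_left hT.le (inv_le_one_of_one_le₀ (one_le_pow₀ hl1.le))
  have hcancel : ∀ j, l ^ j * tt j = T := fun j => by
    have : l ^ j ≠ 0 := by positivity
    simp only [tt]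
    field_simp
  have hdec : ∀ i j, i ≤ j → l ^ (j - i) * tt j = tt i := fun i j hij => by
    have e : l ^ j = l ^ (j - i) * l ^ i := by rw [← pow_add, Nat.sub_add_cancel hij]
    have h1 : l ^ i ≠ 0 := by positivity
    have h2 : l ^ (j - i) ≠ 0 := by positivity
    simp only [tt, e]
    field_simp
  -- The values at the centre form a Cauchy sequence as the scale shrinks; the limit `z` acts as the
  -- value of `h` at `y`.
  obtain ⟨z, hz⟩ := exists_limit_of_cauchy_bound (a := fun j => polyFun (p y (tt j)) y)
    (b := fun j => C₂ * N * ω (tt j)) (by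
      simpa using (hω.tendsto_zero.comp (tendsto_pow_inv_mul hl1 hT)).const_mul (C₂ * N))
    fun i j hij => by
      have := hval N h y 0 T _ hN (by simp) hch (tt j) (j - i) (htt0 j)
        (by rw [hdec i j hij]; exact httT i)
      rwa [hdec i j hij] at this
  refine ⟨z - polyFun (p y T) y, fun x hx hxL hxy => ?_⟩
  have hxy0 : 0 < ‖x - y‖ := norm_pos_iff.2 (sub_ne_zero.2 hxy)
  -- The scale is the smallest of the sequence that is at least `2 |x - y|`; the ratio `l ≤ 3 / 2`
  -- gives the constant `3`. If `2 |x - y|` exceeds `T`, the top scale is already comparable.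
  have hj : ∃ j, x ∈ cube y (tt j) ∧ tt j ≤ 3 * ‖x - y‖ := by
    rcases le_total (2 * ‖x - y‖) T with h1 | h1
    · obtain ⟨j, hj1, hj2⟩ := exists_nat_pow_near ((one_le_div (by positivity)).2 h1) hl1
      rw [le_div_iff₀ (by positivity)] at hj1
      rw [div_lt_iff₀ (by positivity)] at hj2
      have e : 2 * ‖x - y‖ ≤ tt j := by
        simp only [tt]
        rw [inv_mul_eq_div, le_div_iff₀ (by positivity)]
        linarith
      refine ⟨j, closedBall_subset_cube y _ ?_, ?_⟩
      · rw [Metric.mem_closedBall, dist_eq_norm]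
        linarith
      · simp only [tt]
        rw [inv_mul_eq_div, div_le_iff₀ (by positivity)]
        have e2 : l ^ (j + 1) * (2 * ‖x - y‖) = (l * 2) * (‖x - y‖ * l ^ j) := by ring
        have e3 : 0 < ‖x - y‖ * l ^ j := by positivity
        nlinarith
    · refine ⟨0, by simpa [tt] using hx, ?_⟩
      simp only [tt, pow_zero, inv_one, one_mul]
      linarith
  obtain ⟨j, hxj, htj⟩ := hj
  have hω1 : ω (tt j) ≤ Cω * (tt j / T) ^ ε * ω T :=
    hω.le_of_le_of_exponent_le hεr (htt0 j) (httT j)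
  have hA : ‖h x - polyFun (p y (tt j)) x‖ ≤ C₁ * N * ω (tt j) := by
    have := hinner D N h p hN hh hp y (tt j) x (htt0 j)
      ((cube_subset_cube_self y (httT j)).trans hD) hxj hxL
    rwa [div_one] at this
  have hB : ‖(polyFun (p y (tt j)) x - polyFun (p y T) x) -
      (polyFun (p y (tt j)) y - polyFun (p y T) y)‖ ≤ S * (N * ω T * (tt j / T) ^ ε) := by
    rw [← polyFun_sub, ← polyFun_sub]
    have hdeg : (p y (tt j) - p y T).totalDegree ≤ n := (MvPolynomial.totalDegree_sub _ _).trans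
      (max_le (hch.totalDegree_le _ (htt0 j) (httT j)) (hch.totalDegree_le T hT le_rfl))
    refine (norm_polyFun_sub_le_sum hdeg (τ := tt j) fun i =>
      (hxj i).trans (by linarith [htt0 j])).trans ?_
    rw [hS, Finset.sum_mul]
    refine Finset.sum_le_sum fun α hα => ?_
    obtain ⟨hα1, hα2⟩ := Finset.mem_filter.1 hα
    have hk : ε < (α.degree : ℝ) := by
      have : (1 : ℝ) ≤ α.degree := by exact_mod_cast hα2
      linarith
    have h1 := hco N h y 0 T _ hN (by simp) hch (tt j) j (htt0 j) (hcancel j).le α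
      (mem_multiIdx.1 hα1)
    rw [hcancel] at h1
    have h2 : ∑ i ∈ Finset.range j, ω (l ^ i * tt j) / (l ^ i * tt j) ^ α.degree ≤
        Cω * ω T / T ^ ε * ((1 - l ^ (ε - α.degree))⁻¹ * (tt j ^ ε / tt j ^ α.degree)) := by
      refine le_trans ?_ (mul_le_mul_of_nonneg_left (sum_rpow_div_pow_le hl1 (htt0 j) hk j)
        (by positivity))
      rw [Finset.mul_sum]
      refine Finset.sum_le_sum fun i hi => ?_
      have hpos : 0 < l ^ i * tt j := mul_pos (by positivity) (htt0 j)
      have hle : l ^ i * tt j ≤ T := by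
        rw [← hcancel j]
        have := (htt0 j).le
        gcongr
        · exact hl1.le
        · exact (Finset.mem_range.1 hi).le
      have h3 := hω.le_of_le_of_exponent_le hεr hpos hle
      rw [Real.div_rpow hpos.le hT.le] at h3
      rw [mul_div_assoc']
      gcongr
      refine h3.trans_eq ?_
      field_simp
    have h4 := mul_le_mul_of_nonneg_right
      (h1.trans (mul_le_mul_of_nonneg_left h2 (by positivity)))
      (pow_nonneg (htt0 j).le α.degree)
    refine h4.trans_eq ?_
    rw [Real.div_rpow (htt0 j).le hT.le]
    have := (htt0 j).ne'
    field_simp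
  have hCz := hz j
  have e : h x - polyFun (p y T) x - (z - polyFun (p y T) y) =
      (h x - polyFun (p y (tt j)) x) + ((polyFun (p y (tt j)) x - polyFun (p y T) x) -
      (polyFun (p y (tt j)) y - polyFun (p y T) y)) + (polyFun (p y (tt j)) y - z) := by ring
  rw [e]
  have hfin : (tt j / T) ^ ε ≤ 3 ^ ε * (‖x - y‖ / T) ^ ε := by
    rw [← Real.mul_rpow (by norm_num) (by positivity)]
    have := (htt0 j).le
    refine Real.rpow_le_rpow (by positivity) ?_ hε0.le
    rw [mul_div_assoc']
    gcongr
  calc _ ≤ C₁ * N * ω (tt j) + S * (N * ω T * (tt j / T) ^ ε) + C₂ * N * ω (tt j) :=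
        norm_add₃_le.trans (by gcongr)
    _ ≤ C₁ * N * (Cω * (tt j / T) ^ ε * ω T) + S * (N * ω T * (tt j / T) ^ ε) +
        C₂ * N * (Cω * (tt j / T) ^ ε * ω T) := by gcongr
    _ = (C₁ * Cω + S + C₂ * Cω) * (N * ω T) * (tt j / T) ^ ε := by ring
    _ ≤ (C₁ * Cω + S + C₂ * Cω) * (N * ω T) * (3 ^ ε * (‖x - y‖ / T) ^ ε) := by gcongr
    _ = _ := by ring

end Approx

/-! ### Global estimates on domains with the cone property -/

/-- A bounded open set with the uniform cone property, together with its parameters. -/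
structure ConeDomain (D : Set (Rn d)) (c ρ M : ℝ) : Prop where
  dim_pos : 0 < d
  isOpen : IsOpen D
  nonempty : D.Nonempty
  cone : UniformCone D c ρ
  ρ_le : ρ ≤ 1
  one_le : 1 ≤ M
  dist_le : ∀ x ∈ D, ∀ y ∈ D, ‖x - y‖ ≤ M

lemma IsBoundedLipschitzDomain.exists_coneDomain (hd : 0 < d) {D : Set (Rn d)}
    (hD : IsBoundedLipschitzDomain D) : ∃ c ρ M, ConeDomain D c ρ M := by
  obtain ⟨c, ρ, hρ, hcone⟩ := hD.exists_uniformCone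
  obtain ⟨δ, R, hR, h⟩ := hD
  obtain ⟨M, hM⟩ := (Metric.isBounded_iff.1 h.isBounded)
  refine ⟨c, ρ, max 1 M, hd, h.isOpen, h.isConnected.nonempty, hcone, hρ, le_max_left _ _,
    fun x hx y hy => ?_⟩
  rw [← dist_eq_norm]
  exact (hM hx hy).trans (le_max_right _ _)

/-- The points of `D` at distance at least `c ρ / 4` from the complement. -/
def core (D : Set (Rn d)) (c ρ : ℝ) : Set (Rn d) := {x | ∀ y, y ∉ D → c * ρ / 4 ≤ dist x y}

/-- The relative size of the cubes inscribed in the cones. -/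
def coneSide (d : ℕ) (c : ℝ) : ℝ := c / (2 * d)

namespace ConeDomain

variable {D : Set (Rn d)} {c ρ M : ℝ}

lemma dim_pos' (h : ConeDomain D c ρ M) : (1 : ℝ) ≤ d := by exact_mod_cast h.dim_pos

lemma coneSide_pos (h : ConeDomain D c ρ M) : 0 < coneSide d c := by
  have := h.dim_pos'
  have := h.cone.c_pos
  unfold coneSide
  positivity

lemma coneSide_le_one (h : ConeDomain D c ρ M) : coneSide d c ≤ 1 := by
  have := h.dim_pos'
  have := h.cone.c_le
  exact (div_le_one (by positivity)).2 (by linarith)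

lemma mul_coneSide (h : ConeDomain D c ρ M) : d * coneSide d c = c / 2 := by
  have := h.dim_pos'
  unfold coneSide
  field_simp

lemma core_subset (h : ConeDomain D c ρ M) : core D c ρ ⊆ D := fun x hx => by
  by_contra hxD
  have := hx x hxD
  rw [dist_self] at this
  nlinarith [mul_pos h.cone.c_pos h.cone.ρ_pos]

lemma isClosed_core : IsClosed (core D c ρ) := by
  have : core D c ρ = ⋂ y ∈ Dᶜ, {x | c * ρ / 4 ≤ dist x y} := by
    ext x
    simp [core]
  rw [this]
  exact isClosed_biInter fun y _ => isClosed_le continuous_const (by fun_prop)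

lemma isBounded (h : ConeDomain D c ρ M) : Bornology.IsBounded D :=
  Metric.isBounded_iff.2 ⟨M, fun x hx y hy => by rw [dist_eq_norm]; exact h.dist_le x hx y hy⟩

lemma isCompact_core (h : ConeDomain D c ρ M) : IsCompact (core D c ρ) :=
  Metric.isCompact_of_isClosed_isBounded isClosed_core (h.isBounded.subset h.core_subset)

lemma volume_lt_top (h : ConeDomain D c ρ M) : volume D < ∞ := h.isBounded.measure_lt_top

lemma side_le (h : ConeDomain D c ρ M) {a : Rn d} {ℓ : ℝ} (hℓ : 0 < ℓ) (hD : cube a ℓ ⊆ D) :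
    ℓ ≤ M := by
  let i : Fin d := ⟨0, h.dim_pos⟩
  let e : Rn d := EuclideanSpace.single i (ℓ / 2)
  have hn : ‖e‖ = ℓ / 2 := by
    simp only [e, PiLp.norm_single]
    exact Real.norm_of_nonneg (by positivity)
  have h1 : a + e ∈ D := hD (closedBall_subset_cube a ℓ (by
    rw [Metric.mem_closedBall, dist_eq_norm, add_sub_cancel_left, hn]))
  have h2 : a - e ∈ D := hD (closedBall_subset_cube a ℓ (by
    rw [Metric.mem_closedBall, dist_eq_norm, sub_sub_cancel_left, norm_neg, hn]))
  have h3 := h.dist_le _ h1 _ h2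
  have h4 : a + e - (a - e) = (2 : ℝ) • e := by rw [two_smul]; abel
  rw [h4, norm_smul, hn] at h3
  norm_num at h3
  linarith

lemma cube_subset (h : ConeDomain D c ρ M) {x : Rn d} {t : ℝ} (ht : 0 < t)
    (hb : Metric.ball x (c * t) ⊆ D) : cube x (coneSide d c * t) ⊆ D := by
  have h0 := h.coneSide_pos
  refine (cube_subset_ball h.dim_pos x (by positivity)).trans
    ((Metric.ball_subset_ball ?_).trans hb)
  rw [← mul_assoc, h.mul_coneSide]
  nlinarith [mul_pos h.cone.c_pos ht]

/-- By `mul_coneSide` the cube uses only half the radius of the ball, so its points keep a distance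
`c t / 2 ≥ c ρ / 4` from the complement. -/
lemma cube_subset_core (h : ConeDomain D c ρ M) {x : Rn d} {t : ℝ} (ht : ρ / 2 ≤ t)
    (hb : Metric.ball x (c * t) ⊆ D) : cube x (coneSide d c * t) ⊆ core D c ρ := by
  intro z hz y hy
  have ht0 : 0 < t := lt_of_lt_of_le (by linarith [h.cone.ρ_pos]) ht
  have h0 := h.coneSide_pos
  have h1 := cube_subset_ball h.dim_pos x (by positivity) hz
  rw [← mul_assoc, h.mul_coneSide, Metric.mem_ball] at h1
  have h2 : c * t ≤ dist y x := by
    by_contra h3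
    exact hy (hb (Metric.mem_ball.2 (not_le.1 h3)))
  have h3 := dist_triangle_left y x z
  have h4 := h.cone.c_pos
  nlinarith

end ConeDomain

/-- The hypotheses under which the global estimates are proved. -/
structure ApproxData (ω : ℝ → ℝ) (n : ℕ) (D : Set (Rn d)) (c ρ N : ℝ) (h : Rn d → 𝕜)
    (p : Rn d → ℝ → MvPolynomial (Fin d) 𝕜) : Prop where
  nonneg : 0 ≤ N
  locallyIntegrableOn : LocallyIntegrableOn h D
  approx : CubeApprox ω n D 1 N h p
  core_le : ∫⁻ x in core D c ρ, ‖h x‖ₑ ≤ ENNReal.ofReal N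

section Global

variable {ω : ℝ → ℝ} {n : ℕ} {q r Cω : ℝ} {D : Set (Rn d)} {c ρ M : ℝ}

lemma ApproxData.chain (hD : ConeDomain D c ρ M) (hω : GoodModulus ω n q r Cω) {N : ℝ}
    {h : Rn d → 𝕜} {p : Rn d → ℝ → MvPolynomial (Fin d) 𝕜} (H : ApproxData ω n D c ρ N h p)
    {x e : Rn d} (hx : ∀ t, 0 < t → t ≤ ρ → Metric.ball (x + t • e) (c * t) ⊆ D) :
    ApproxChain ω n N h x e (coneSide d c) ρ (fun t => p (x + t • e) (coneSide d c * t)) := by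
  have h0 := hD.coneSide_pos
  have hsub := fun t ht htρ => hD.cube_subset ht (hx t ht htρ)
  refine ⟨fun t ht htρ => (H.approx _ _ (by positivity) (by rw [one_mul]; exact hsub t ht htρ)).1,
    fun t ht htρ => aestronglyMeasurable_cube H.locallyIntegrableOn (hsub t ht htρ),
    fun t ht htρ => (H.approx _ _ (by positivity)
      (by rw [one_mul]; exact hsub t ht htρ)).2.trans (ENNReal.ofReal_le_ofReal ?_)⟩
  have := H.nonneg
  gcongr
  exact hω.mono (by positivity) (mul_le_of_le_one_left ht.le hD.coneSide_le_one)

/-- The anchor of all chains: on cubes of side bounded below inside the core, the `L¹` bound for `h`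
controls the polynomial outright. -/
lemma ConeDomain.exists_core_pnorm (hω : GoodModulus ω n q r Cω) (𝕜 : Type*) [RCLike 𝕜]
    (hD : ConeDomain D c ρ M) {τ₀ : ℝ} (hτ₀ : 0 < τ₀) : ∃ C : ℝ, 0 < C ∧
    ∀ (N : ℝ) (h : Rn d → 𝕜) (p : Rn d → ℝ → MvPolynomial (Fin d) 𝕜),
      ApproxData ω n D c ρ N h p → ∀ b τ, τ₀ ≤ τ → τ ≤ 1 → cube b τ ⊆ core D c ρ →
        pnorm n 1 (shift b (p b τ)) ≤ C * N := by
  obtain ⟨C₁, hC₁, hne⟩ := exists_pnorm_le_avgL1 𝕜 d n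
  have hω1 := hω.pos 1 one_pos
  refine ⟨τ₀⁻¹ ^ n * (C₁ * (ω 1 + (τ₀ ^ d)⁻¹)), by positivity,
    fun N h p H b τ hτ hτ1 hcub => ?_⟩
  have hN := H.nonneg
  have hτ0 : 0 < τ := hτ₀.trans_le hτ
  have hcD := hcub.trans hD.core_subset
  obtain ⟨hdeg, havg⟩ := H.approx b τ hτ0 (by rwa [one_mul])
  have e1 : avgL1 (cube b τ) h ≤ ENNReal.ofReal (N * (τ₀ ^ d)⁻¹) := by
    rw [avgL1, volume_cube b hτ0.le]
    refine ENNReal.div_le_of_le_mul ?_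
    rw [← ENNReal.ofReal_mul (by positivity)]
    refine ((lintegral_mono_set hcub).trans H.core_le).trans (ENNReal.ofReal_le_ofReal ?_)
    rw [mul_assoc]
    refine le_mul_of_one_le_right hN ?_
    rw [inv_mul_eq_div, one_le_div (by positivity)]
    gcongr
  have e2 : avgL1 (cube b τ) (polyFun (p b τ)) ≤ ENNReal.ofReal (N * (ω 1 + (τ₀ ^ d)⁻¹)) := by
    have e3 : avgL1 (cube b τ) (fun y => h y - polyFun (p b τ) y) =
        avgL1 (cube b τ) (fun y => polyFun (p b τ) y - h y) := by
      simp_rw [avgL1, ← enorm_neg (h _ - polyFun (p b τ) _), neg_sub]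
    rw [mul_add, ENNReal.ofReal_add (by positivity) (by positivity)]
    refine le_trans ?_ (add_le_add (havg.trans (ENNReal.ofReal_le_ofReal ?_)) e1)
    · rw [e3]
      refine le_trans (le_of_eq ?_) (avgL1_add_le ?_)
      · congr 1
        funext y
        ring
      · exact (continuous_polyFun _).aestronglyMeasurable.sub
          (aestronglyMeasurable_cube H.locallyIntegrableOn hcD)
    · gcongr
      exact hω.mono hτ0.le hτ1
  have e4 := (hne _ hdeg b τ hτ0).trans (mul_le_mul_right e2 _)
  rw [← ENNReal.ofReal_mul hC₁.le, ENNReal.ofReal_le_ofReal_iff (by positivity)] at e4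
  have e5 := pnorm_mul_le (n := n) hτ0.le (one_le_inv₀ hτ0 |>.2 hτ1) (shift b (p b τ))
  rw [inv_mul_cancel₀ hτ0.ne'] at e5
  calc _ ≤ τ⁻¹ ^ n * (C₁ * (N * (ω 1 + (τ₀ ^ d)⁻¹))) := e5.trans (by gcongr)
    _ ≤ τ₀⁻¹ ^ n * (C₁ * (N * (ω 1 + (τ₀ ^ d)⁻¹))) := by gcongr
    _ = _ := by ring

/-- Functions of the Zygmund class are bounded on `D`. -/
lemma ConeDomain.exists_sup_bound (hω : GoodModulus ω n q r Cω) (𝕜 : Type*) [RCLike 𝕜]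
    (hD : ConeDomain D c ρ M) : ∃ C : ℝ, 0 < C ∧
    ∀ (N : ℝ) (h : Rn d → 𝕜) (p : Rn d → ℝ → MvPolynomial (Fin d) 𝕜),
      ApproxData ω n D c ρ N h p → ∀ x ∈ D, LebesguePoint h x → ‖h x‖ ≤ C * N := by
  have hσ := hD.coneSide_pos
  have hρ := hD.cone.ρ_pos
  obtain ⟨C₁, hC₁, hleb⟩ := hω.exists_chain_lebesgue 𝕜 d hσ hD.coneSide_le_one le_rfl
  obtain ⟨C₂, hC₂, hcore⟩ := hD.exists_core_pnorm hω 𝕜 (τ₀ := coneSide d c * ρ) (by positivity)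
  have hωρ := hω.pos ρ hρ
  refine ⟨C₁ * ω ρ + C₂, by positivity, fun N h p H x hx hxL => ?_⟩
  obtain ⟨e, he, hcone⟩ := hD.cone.exists_direction x hx
  have hball := hcone x hx (by simpa using hρ.le)
  -- The chain climbs from `x` along the cone up to scale `ρ`, where its cube lies in the core.
  have hch := H.chain hD hω hball
  have h1 := hleb N h x e ρ _ H.nonneg hρ (fun i => (abs_apply_le_norm e i).trans he) hch hxL
  have hcub := hD.cube_subset_core (x := x + ρ • e) (t := ρ) (by linarith) (hball ρ hρ le_rfl)
  have hdeg := hch.totalDegree_le ρ hρ le_rfl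
  have h2 := hcore N h p H _ _ le_rfl (mul_le_one₀ hD.coneSide_le_one hρ.le hD.ρ_le) hcub
  have h3 : ‖polyFun (p (x + ρ • e) (coneSide d c * ρ)) x‖ ≤ C₂ * N := by
    refine (norm_polyFun_le hdeg (a := x + ρ • e) (τ := 1) fun i => ?_).trans h2
    have e1 : x i - (x + ρ • e) i = -(ρ * e i) := by simp
    rw [e1, abs_neg, abs_mul, abs_of_pos hρ]
    exact mul_le_one₀ hD.ρ_le (abs_nonneg _) ((abs_apply_le_norm e i).trans he)
  calc ‖h x‖ ≤ ‖h x - polyFun (p (x + ρ • e) (coneSide d c * ρ)) x‖ +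
        ‖polyFun (p (x + ρ • e) (coneSide d c * ρ)) x‖ := by
          simpa using norm_add_le (h x - polyFun (p (x + ρ • e) (coneSide d c * ρ)) x)
            (polyFun (p (x + ρ • e) (coneSide d c * ρ)) x)
    _ ≤ C₁ * N * ω ρ + C₂ * N := add_le_add h1 h3
    _ = _ := by ring

/-- The ratio between the side of a cube and the bottom scale of the chain starting in it. -/
def startRatio (ρ M : ℝ) : ℝ := min (1 / 4) (ρ / M)

lemma ConeDomain.startRatio_pos (hD : ConeDomain D c ρ M) : 0 < startRatio ρ M :=
  lt_min (by norm_num) (div_pos hD.cone.ρ_pos (one_pos.trans_le hD.one_le))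

lemma ConeDomain.startRatio_mul_le (hD : ConeDomain D c ρ M) {a : Rn d} {ℓ : ℝ} (hℓ : 0 < ℓ)
    (ha : cube a ℓ ⊆ D) : startRatio ρ M * ℓ ≤ ρ := by
  have hM := one_pos.trans_le hD.one_le
  calc startRatio ρ M * ℓ ≤ ρ / M * M := by
        have := hD.cone.ρ_pos
        gcongr
        · exact min_le_right _ _
        · exact hD.side_le hℓ ha
    _ = ρ := by field_simp

/-- Comparison of the polynomial of a cube with the bottom of the chain starting in it. -/
lemma ConeDomain.exists_start_bound (hω : GoodModulus ω n q r Cω) (𝕜 : Type*) [RCLike 𝕜]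
    (hD : ConeDomain D c ρ M) : ∃ C : ℝ, 0 < C ∧
    ∀ (N : ℝ) (h : Rn d → 𝕜) (p : Rn d → ℝ → MvPolynomial (Fin d) 𝕜),
      ApproxData ω n D c ρ N h p → ∀ a ℓ e, 0 < ℓ → cube a ℓ ⊆ D → ‖e‖ ≤ 1 →
        pnorm n ℓ (shift a (p a ℓ - p (a + (startRatio ρ M * ℓ) • e)
          (coneSide d c * (startRatio ρ M * ℓ)))) ≤ C * N * ω ℓ := by
  have hσ := hD.coneSide_pos
  have hσ1 := hD.coneSide_le_one
  have hη := hD.startRatio_pos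
  have hη4 : startRatio ρ M ≤ 1 / 4 := min_le_left _ _
  obtain ⟨C, hC, hnest⟩ := hω.exists_nested_bound 𝕜 d
    (κ := (coneSide d c * startRatio ρ M)⁻¹) (one_le_inv₀ (by positivity) |>.2
      (mul_le_one₀ hσ1 hη.le (by linarith)))
  refine ⟨C, hC, fun N h p H a ℓ e hℓ ha he => ?_⟩
  have hs : 0 < startRatio ρ M * ℓ := by positivity
  -- The factor `1 / 4` leaves room both for the displacement along `e` and for the side of the
  -- bottom cube, which therefore lies in the given cube.
  have hs4 : startRatio ρ M * ℓ ≤ ℓ / 4 := by nlinarith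
  have hσs : coneSide d c * (startRatio ρ M * ℓ) ≤ ℓ / 4 :=
    (mul_le_of_le_one_left hs.le hσ1).trans hs4
  refine hnest D N h p H.nonneg H.locallyIntegrableOn H.approx a ℓ _ _ hℓ (by positivity)
    (by linarith) ha (cube_subset_cube fun i => ?_) (le_of_eq ?_)
  · have e1 : (a + (startRatio ρ M * ℓ) • e) i - a i = startRatio ρ M * ℓ * e i := by simp
    rw [e1, abs_mul, abs_of_pos hs]
    have := mul_le_of_le_one_right hs.le ((abs_apply_le_norm e i).trans he)
    linarith
  · field_simp

/-- Scales of the chain starting from a cube in `D`, up to the scale `ρ`. -/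
lemma ConeDomain.exists_top_scale (hD : ConeDomain D c ρ M) {a : Rn d} {ℓ : ℝ} (hℓ : 0 < ℓ)
    (ha : cube a ℓ ⊆ D) : ∃ m : ℕ,
      ρ / 2 ≤ chainRatio (coneSide d c) 1 ^ m * (startRatio ρ M * ℓ) ∧
      chainRatio (coneSide d c) 1 ^ m * (startRatio ρ M * ℓ) ≤ ρ := by
  have hs : 0 < startRatio ρ M * ℓ := mul_pos hD.startRatio_pos hℓ
  have hl1 := one_lt_chainRatio hD.coneSide_pos (le_refl (1 : ℝ))
  have hl2 := chainRatio_le_two hD.coneSide_le_one (le_refl (1 : ℝ))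
  obtain ⟨m, h1, h2⟩ := exists_nat_pow_near
    ((one_le_div hs).2 (hD.startRatio_mul_le hℓ ha)) hl1
  rw [le_div_iff₀ hs] at h1
  rw [div_lt_iff₀ hs, pow_succ] at h2
  refine ⟨m, ?_, h1⟩
  have : 0 < chainRatio (coneSide d c) 1 ^ m * (startRatio ρ M * ℓ) := by positivity
  nlinarith

/-- Bounds for the Taylor coefficients of the approximating polynomials. -/
lemma ConeDomain.exists_coeff_bound (hω : GoodModulus ω n q r Cω) (𝕜 : Type*) [RCLike 𝕜]
    (hD : ConeDomain D c ρ M) : ∃ C : ℝ, 0 < C ∧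
    ∀ (N : ℝ) (h : Rn d → 𝕜) (p : Rn d → ℝ → MvPolynomial (Fin d) 𝕜),
      ApproxData ω n D c ρ N h p → ∀ a ℓ, 0 < ℓ → cube a ℓ ⊆ D → ∀ α : Fin d →₀ ℕ,
        (α.degree < n → ‖(shift a (p a ℓ)).coeff α‖ ≤ C * N) ∧
        (α.degree = n → ‖(shift a (p a ℓ)).coeff α‖ ≤ C * N * logFactor ω n ℓ) := by
  have hσ := hD.coneSide_pos
  have hσ1 := hD.coneSide_le_one
  have hρ := hD.cone.ρ_pos
  have hM1 := hD.one_le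
  have hM := one_pos.trans_le hM1
  have hη := hD.startRatio_pos
  have hη4 : startRatio ρ M ≤ 1 / 4 := min_le_left _ _
  have hCω := hω.const_pos
  have hω1 := hω.pos 1 one_pos
  have hωM := hω.pos M hM
  obtain ⟨C₁, hC₁, hstart⟩ := hD.exists_start_bound hω 𝕜
  obtain ⟨C₂, hC₂, hco⟩ := hω.exists_chain_coeff 𝕜 d hσ hσ1 le_rfl
  obtain ⟨C₃, hC₃, hcore⟩ := hD.exists_core_pnorm hω 𝕜 (τ₀ := coneSide d c * (ρ / 2))
    (by positivity)
  obtain ⟨C₄, hC₄, hshift⟩ := exists_pnorm_shift_le 𝕜 d n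
  obtain ⟨B, hB, hlog⟩ := hω.exists_logFactor_mul_le hM1 hη (by linarith)
  set l := chainRatio (coneSide d c) 1 with hl
  have hl1 : 1 < l := one_lt_chainRatio hσ le_rfl
  have hl0 : 0 < l - 1 := sub_pos.2 hl1
  set A : ℕ → ℝ := fun k => C₁ * (Cω * (M ^ r)⁻¹ * ω M * M ^ (r - k)) +
    C₂ * (Cω * (l ^ (r - k) - 1)⁻¹ * (ω 1 / (ρ / 2) ^ k)) with hA
  have hA0 : ∀ k < n, 0 ≤ A k := fun k hk => by
    have h1 : (k : ℝ) + 1 ≤ n := by exact_mod_cast hk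
    have h2 : 0 < (l ^ (r - k) - 1)⁻¹ := inv_pos.2 (sub_pos.2 (Real.one_lt_rpow hl1
      (by linarith [hω.lt_r])))
    positivity
  set A' : ℝ := C₁ * (2 ^ (n + 1) + ω M * 2 ^ n) + C₂ * (l ^ (n + 1) * (l - 1)⁻¹ * B) with hA'
  have hA'0 : 0 ≤ A' := by positivity
  have hsum : 0 ≤ ∑ k ∈ Finset.range n, A k :=
    Finset.sum_nonneg fun k hk => hA0 k (Finset.mem_range.1 hk)
  refine ⟨C₄ * C₃ + (∑ k ∈ Finset.range n, A k) + A', by positivity,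
    fun N h p H a ℓ hℓ ha α => ?_⟩
  have hN := H.nonneg
  have haD := ha (self_mem_cube a hℓ.le)
  have hJ := one_le_logFactor ω n ℓ
  have hωℓ := hω.pos ℓ hℓ
  have hℓM := hD.side_le hℓ ha
  obtain ⟨e, he, hcone⟩ := hD.cone.exists_direction a haD
  have hball := hcone a haD (by simpa using hρ.le)
  have hch := H.chain hD hω hball
  obtain ⟨m, hm1, hm2⟩ := hD.exists_top_scale hℓ ha
  set s := startRatio ρ M * ℓ with hs_def
  have hs : 0 < s := by positivity
  set T := l ^ m * s with hT_def
  have hT : 0 < T := by positivity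
  have hei : ∀ i, |e i| ≤ 1 := fun i => (abs_apply_le_norm e i).trans he
  have hst := hstart N h p H a ℓ e hℓ ha he
  have hcub := hD.cube_subset_core hm1 (hball T hT hm2)
  have htop := hcore N h p H _ _ (by gcongr)
    (mul_le_one₀ hσ1 hT.le (hm2.trans hD.ρ_le)) hcub
  have htop' : pnorm n 1 (shift a (p (a + T • e) (coneSide d c * T))) ≤ C₄ * C₃ * N := by
    have := hshift _ (hch.totalDegree_le T hT hm2) a (a + T • e) 1 1 one_pos le_rfl fun i => by
      have e1 : a i - (a + T • e) i = -(T * e i) := by simp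
      rw [e1, abs_neg, abs_mul, abs_of_pos hT, one_mul]
      exact mul_le_one₀ (hm2.trans hD.ρ_le) (abs_nonneg _) (hei i)
    rw [one_pow, mul_one] at this
    exact this.trans (by rw [mul_assoc]; gcongr)
  -- From the cube to the bottom of the chain, then up the chain, then the polynomial at the top,
  -- which lives in the core.
  have hdecomp : p a ℓ = (p a ℓ - p (a + s • e) (coneSide d c * s)) +
      ((p (a + s • e) (coneSide d c * s) - p (a + T • e) (coneSide d c * T)) +
        p (a + T • e) (coneSide d c * T)) := by ring
  have hmain : α.degree ≤ n → ‖(shift a (p a ℓ)).coeff α‖ ≤ C₁ * N * ω ℓ / ℓ ^ α.degree +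
      (C₂ * N * (∑ j ∈ Finset.range m, ω (l ^ j * s) / (l ^ j * s) ^ α.degree) +
        C₄ * C₃ * N) := by
    intro hα
    rw [hdecomp, shift_add, shift_add, MvPolynomial.coeff_add, MvPolynomial.coeff_add]
    refine (norm_add_le _ _).trans (add_le_add ?_ ((norm_add_le _ _).trans (add_le_add ?_ ?_)))
    · exact (norm_coeff_le_pnorm hℓ _ hα).trans (by gcongr)
    · exact hco N h a e ρ _ hN hei hch s m hs hm2 α hα
    · have := norm_coeff_le_pnorm (n := n) one_pos
        (shift a (p (a + T • e) (coneSide d c * T))) hα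
      rw [one_pow, div_one] at this
      exact this.trans htop'
  constructor
  -- Here the degree is at most `n - 1 < r`: the top scale, between `ρ / 2` and `ρ`, dominates and
  -- gives a uniform bound.
  · intro hα
    have hα1 : (α.degree : ℝ) + 1 ≤ n := by exact_mod_cast hα
    have hrk : (α.degree : ℝ) < r := by linarith [hω.lt_r]
    refine (hmain hα.le).trans ?_
    have e1 : ω ℓ / ℓ ^ α.degree ≤ Cω * (M ^ r)⁻¹ * ω M * M ^ (r - α.degree) := by
      have e2 := hω.le_of_le ℓ M hℓ hℓM
      rw [Real.div_rpow hℓ.le hM.le] at e2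
      calc ω ℓ / ℓ ^ α.degree ≤ Cω * (ℓ ^ r / M ^ r) * ω M / ℓ ^ α.degree := by gcongr
        _ = Cω * (M ^ r)⁻¹ * ω M * ℓ ^ (r - α.degree) := by
          rw [Real.rpow_sub hℓ, Real.rpow_natCast]
          field_simp
        _ ≤ _ := by gcongr
    have e3 : ∑ j ∈ Finset.range m, ω (l ^ j * s) / (l ^ j * s) ^ α.degree ≤
        Cω * (l ^ (r - α.degree) - 1)⁻¹ * (ω 1 / (ρ / 2) ^ α.degree) := by
      refine (hω.sum_le_top hl1 hs hrk m).trans ?_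
      have h2 : 0 < (l ^ (r - α.degree) - 1)⁻¹ := inv_pos.2 (sub_pos.2 (Real.one_lt_rpow hl1
        (by linarith)))
      have h3 := hω.mono hT.le (hm2.trans hD.ρ_le)
      gcongr
    have e4 : A α.degree ≤ ∑ k ∈ Finset.range n, A k :=
      Finset.single_le_sum (fun k hk => hA0 k (Finset.mem_range.1 hk)) (Finset.mem_range.2 hα)
    calc _ ≤ C₁ * N * (Cω * (M ^ r)⁻¹ * ω M * M ^ (r - α.degree)) + (C₂ * N *
          (Cω * (l ^ (r - α.degree) - 1)⁻¹ * (ω 1 / (ρ / 2) ^ α.degree)) + C₄ * C₃ * N) := by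
          rw [mul_div_assoc]
          gcongr
      _ = (C₄ * C₃ + A α.degree) * N := by simp only [hA]; ring
      _ ≤ _ := mul_le_mul_of_nonneg_right (by linarith) hN
  -- In degree `n` the chain sum is controlled by the logarithmic factor at the bottom scale, which
  -- is comparable to the factor at `ℓ`.
  · intro hα
    refine (hmain hα.le).trans ?_
    rw [hα]
    have e1 := hω.div_pow_le_logFactor hM1 hℓ hℓM
    have e2 := hω.sum_le_logFactor hl1 hs (hm2.trans hD.ρ_le)
    have e3 := hlog ℓ hℓ hℓM
    calc _ ≤ C₁ * N * ((2 ^ (n + 1) + ω M * 2 ^ n) * logFactor ω n ℓ) +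
          (C₂ * N * (l ^ (n + 1) * (l - 1)⁻¹ * (B * logFactor ω n ℓ)) +
            C₄ * C₃ * N * logFactor ω n ℓ) := by
          have e4 : C₄ * C₃ * N ≤ C₄ * C₃ * N * logFactor ω n ℓ :=
            le_mul_of_one_le_right (by positivity) hJ
          have e5 : C₂ * N * (∑ j ∈ Finset.range m, ω (l ^ j * s) / (l ^ j * s) ^ n) ≤
              C₂ * N * (l ^ (n + 1) * (l - 1)⁻¹ * (B * logFactor ω n ℓ)) := by
            gcongr
            exact e2.trans (by gcongr)
          rw [mul_div_assoc]
          exact add_le_add (by gcongr) (add_le_add e5 e4)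
      _ = (C₄ * C₃ + A') * N * logFactor ω n ℓ := by rw [hA']; ring
      _ ≤ _ := by
          refine mul_le_mul_of_nonneg_right (mul_le_mul_of_nonneg_right ?_ hN) (by linarith)
          linarith

end Global

/-! ### Growth of the approximation error over the whole domain -/

section Growth

variable {ω : ℝ → ℝ} {n : ℕ} {q r Cω : ℝ} {D : Set (Rn d)} {c ρ M : ℝ}

lemma pow_le_one_add_rpow {u : ℝ} (hu : 0 ≤ u) (hq : (n : ℝ) ≤ q) : u ^ n ≤ (1 + u) ^ q := by
  calc u ^ n ≤ (1 + u) ^ n := by gcongr; linarith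
    _ = (1 + u) ^ (n : ℝ) := (Real.rpow_natCast _ _).symm
    _ ≤ _ := Real.rpow_le_rpow_of_exponent_le (by linarith) hq

lemma rpow_mul_le_one_add_rpow {u k y : ℝ} (hu : 0 ≤ u) (hk : 0 ≤ k) (hy : 0 ≤ y) (hq : 0 ≤ q)
    (h : y ≤ k * u) : y ^ q ≤ k ^ q * (1 + u) ^ q := by
  rw [← Real.mul_rpow hk (by linarith)]
  exact Real.rpow_le_rpow hy (h.trans (by gcongr; linarith)) hq

/-- The error of approximation grows at most like the power `q` away from the cube:
nearby points. -/
lemma ConeDomain.exists_growth_bound_near (hω : GoodModulus ω n q r Cω) (𝕜 : Type*) [RCLike 𝕜]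
    (hD : ConeDomain D c ρ M) : ∃ C : ℝ, 0 < C ∧
    ∀ (N : ℝ) (h : Rn d → 𝕜) (p : Rn d → ℝ → MvPolynomial (Fin d) 𝕜),
      ApproxData ω n D c ρ N h p → ∀ a ℓ, 0 < ℓ → cube a ℓ ⊆ D → ∀ x ∈ D, LebesguePoint h x →
        ℓ / 2 ≤ ‖x - a‖ → ‖x - a‖ ≤ coneSide d c * ρ / 8 → ∃ e : Rn d, ‖e‖ ≤ 1 ∧
        ‖h x - polyFun (p (a + (startRatio ρ M * ℓ) • e)
          (coneSide d c * (startRatio ρ M * ℓ))) x‖ ≤ C * N * ω ℓ * (1 + ‖x - a‖ / ℓ) ^ q := by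
  have hσ := hD.coneSide_pos
  have hσ1 := hD.coneSide_le_one
  have hρ := hD.cone.ρ_pos
  have hη := hD.startRatio_pos
  have hη4 : startRatio ρ M ≤ 1 / 4 := min_le_left _ _
  have hCω := hω.const_pos
  have hq := hω.q_pos
  obtain ⟨C₂, hC₂, hleb⟩ := hω.exists_chain_lebesgue 𝕜 d hσ hσ1 le_rfl
  obtain ⟨C₃, hC₃, hsub⟩ := exists_pnorm_sub_le 𝕜 d n
  obtain ⟨C₄, hC₄, hpn⟩ := hω.exists_chain_pnorm 𝕜 d hσ hσ1 le_rfl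
  set σ := coneSide d c with hσ_def
  set η := startRatio ρ M with hη_def
  set l := chainRatio σ 1 with hl
  have hl1 : 1 < l := one_lt_chainRatio hσ le_rfl
  have hl2 : l ≤ 2 := chainRatio_le_two hσ1 le_rfl
  refine ⟨(C₂ + (2 / σ) ^ n * (C₃ * 2 ^ d)) * (Cω * (8 / σ) ^ q) + C₄ * (8 / (σ * η)) ^ q,
    by positivity, fun N h p H a ℓ hℓ ha x hx hxL hfar hnear => ?_⟩
  have hN := H.nonneg
  have haD := ha (self_mem_cube a hℓ.le)
  have hωℓ := hω.pos ℓ hℓ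
  obtain ⟨e, he, hcone⟩ := hD.cone.exists_direction x hx
  refine ⟨e, he, ?_⟩
  have hσρ : σ * ρ / 8 ≤ ρ := by nlinarith
  have hballx := hcone x hx (by simpa using hρ.le)
  -- As `x` and `a` are within `ρ` of each other, the direction chosen at `x` also serves `a`, and
  -- the two chains run parallel.
  have hballa := hcone a haD (by rw [norm_sub_rev]; exact hnear.trans hσρ)
  have hchx := H.chain hD hω hballx
  have hcha := H.chain hD hω hballa
  have hei : ∀ i, |e i| ≤ 1 := fun i => (abs_apply_le_norm e i).trans he
  set w := ‖x - a‖ with hw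
  have hw0 : 0 < w := by linarith
  set s := η * ℓ with hs_def
  have hs : 0 < s := by positivity
  have hs4 : s ≤ ℓ / 4 := by rw [hs_def]; nlinarith
  have hw4 : 4 * w ≤ 4 * w / σ := by rw [le_div_iff₀ hσ]; nlinarith
  -- The scale `T` is chosen between `4w / σ` and `8w / σ`: large enough for the parallel cubes at
  -- `x + T e` and `a + T e` to overlap, and still comparable to `w`.
  obtain ⟨k, hk1, hk2⟩ := exists_nat_pow_near
    ((one_le_div hs).2 (show s ≤ 4 * w / σ by linarith)) hl1
  rw [le_div_iff₀ hs] at hk1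
  rw [div_lt_iff₀ hs] at hk2
  set T := l ^ (k + 1) * s with hT_def
  have hT : 0 < T := by positivity
  have hT1 : 4 * w / σ ≤ T := hk2.le
  have hT2 : T ≤ 8 * w / σ := by
    have e1 : T = l * (l ^ k * s) := by rw [hT_def]; ring
    have e2 : 0 < l ^ k * s := by positivity
    have e3 : 8 * w / σ = 2 * (4 * w / σ) := by ring
    rw [e1, e3]
    nlinarith
  have hTρ : T ≤ ρ := hT2.trans (by rw [div_le_iff₀ hσ]; linarith)
  have hwT : w ≤ σ * T / 4 := by
    rw [div_le_iff₀ hσ] at hT1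
    linarith
  have hTℓ : ℓ ≤ T := by linarith
  have hωT := hω.pos T hT
  have hxi : ∀ i, |x i - a i| ≤ w := fun i => abs_apply_le_norm (x - a) i
  have hA := hleb N h x e T _ hN hT hei ⟨fun t ht h' => hchx.totalDegree_le t ht (h'.trans hTρ),
    fun t ht h' => hchx.aestronglyMeasurable t ht (h'.trans hTρ),
    fun t ht h' => hchx.avg_le t ht (h'.trans hTρ)⟩ hxL
  have hcub1 : cube (x + T • e) (σ * T / 2) ⊆ cube (x + T • e) (σ * T) :=
    cube_subset_cube_self _ (by nlinarith [mul_pos hσ hT])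
  have hcub2 : cube (x + T • e) (σ * T / 2) ⊆ cube (a + T • e) (σ * T) := by
    refine cube_subset_cube fun i => ?_
    have e1 : (x + T • e) i - (a + T • e) i = x i - a i := by simp
    rw [e1]
    linarith [hxi i]
  have hB := hsub h (p (x + T • e) (σ * T)) (p (a + T • e) (σ * T)) (x + T • e) (a + T • e)
    (x + T • e) (σ * T) (σ * T) (σ * T / 2) 2 (N * ω T) (hchx.totalDegree_le T hT hTρ)
    (hcha.totalDegree_le T hT hTρ) (by positivity) (by positivity) (by positivity) (by positivity)
    (by positivity) (by linarith) (by linarith) hcub1 hcub2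
    ((hchx.aestronglyMeasurable T hT hTρ).mono_measure (Measure.restrict_mono hcub1 le_rfl))
    (hchx.avg_le T hT hTρ) (hcha.avg_le T hT hTρ)
  have hB' : ‖polyFun (p (x + T • e) (σ * T)) x - polyFun (p (a + T • e) (σ * T)) x‖ ≤
      (2 / σ) ^ n * (C₃ * 2 ^ d * (N * ω T)) := by
    have hdeg : (p (x + T • e) (σ * T) - p (a + T • e) (σ * T)).totalDegree ≤ n :=
      (MvPolynomial.totalDegree_sub _ _).trans
        (max_le (hchx.totalDegree_le T hT hTρ) (hcha.totalDegree_le T hT hTρ))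
    rw [← polyFun_sub]
    refine (norm_polyFun_le hdeg (a := x + T • e) (τ := 2 / σ * (σ * T / 2)) fun i => ?_).trans
      ((pnorm_mul_le (by positivity) (by rw [le_div_iff₀ hσ]; linarith) _).trans (by gcongr))
    have e1 : x i - (x + T • e) i = -(T * e i) := by simp
    have e2 : 2 / σ * (σ * T / 2) = T := by field_simp
    rw [e1, abs_neg, abs_mul, abs_of_pos hT, e2]
    exact mul_le_of_le_one_right hT.le (hei i)
  have hCc : ‖polyFun (p (a + T • e) (σ * T)) x - polyFun (p (a + s • e) (σ * s)) x‖ ≤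
      C₄ * N * ω s * (l ^ (k + 1)) ^ q := by
    have hsρ : s ≤ ρ := by linarith
    have hdeg : (p (a + s • e) (σ * s) - p (a + T • e) (σ * T)).totalDegree ≤ n :=
      (MvPolynomial.totalDegree_sub _ _).trans
        (max_le (hcha.totalDegree_le s hs hsρ) (hcha.totalDegree_le T hT hTρ))
    rw [norm_sub_rev, ← polyFun_sub]
    refine (norm_polyFun_le hdeg (a := a) (τ := T) fun i => ?_).trans
      (hpn N h a e ρ _ hN hei hcha s (k + 1) hs hTρ)
    linarith [hxi i]
  have hq1 : ω T ≤ Cω * ((8 / σ) ^ q * (1 + w / ℓ) ^ q) * ω ℓ := by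
    refine (hω.le_of_ge ℓ T hℓ hTℓ).trans ?_
    gcongr
    refine rpow_mul_le_one_add_rpow (by positivity) (by positivity) (by positivity) hq.le ?_
    rw [div_le_iff₀ hℓ]
    refine hT2.trans_eq ?_
    field_simp
  have hq2 : (l ^ (k + 1)) ^ q ≤ (8 / (σ * η)) ^ q * (1 + w / ℓ) ^ q := by
    refine rpow_mul_le_one_add_rpow (by positivity) (by positivity) (by positivity) hq.le ?_
    have e1 : l ^ (k + 1) = T / s := by rw [hT_def]; field_simp
    rw [e1, div_le_iff₀ hs]
    refine hT2.trans_eq ?_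
    rw [hs_def]
    field_simp
  have hq3 : ω s ≤ ω ℓ := hω.mono hs.le (by linarith)
  -- Up the chain from `x`, across between the two chains at scale `T`, and down the chain over `a`.
  have e : h x - polyFun (p (a + s • e) (σ * s)) x =
      (h x - polyFun (p (x + T • e) (σ * T)) x) +
      (polyFun (p (x + T • e) (σ * T)) x - polyFun (p (a + T • e) (σ * T)) x) +
      (polyFun (p (a + T • e) (σ * T)) x - polyFun (p (a + s • e) (σ * s)) x) := by ring
  rw [e]
  calc _ ≤ C₂ * N * ω T + (2 / σ) ^ n * (C₃ * 2 ^ d * (N * ω T)) +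
        C₄ * N * ω s * (l ^ (k + 1)) ^ q :=
        norm_add₃_le.trans (add_le_add (add_le_add hA hB') hCc)
    _ ≤ C₂ * N * (Cω * ((8 / σ) ^ q * (1 + w / ℓ) ^ q) * ω ℓ) +
        (2 / σ) ^ n * (C₃ * 2 ^ d * (N * (Cω * ((8 / σ) ^ q * (1 + w / ℓ) ^ q) * ω ℓ))) +
        C₄ * N * ω ℓ * ((8 / (σ * η)) ^ q * (1 + w / ℓ) ^ q) := by gcongr
    _ = _ := by ring

/-- The error of approximation grows at most like the power `q` away from the cube:
remote points. -/
lemma ConeDomain.exists_growth_bound_far (hω : GoodModulus ω n q r Cω) (𝕜 : Type*) [RCLike 𝕜]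
    (hD : ConeDomain D c ρ M) : ∃ C : ℝ, 0 < C ∧
    ∀ (N : ℝ) (h : Rn d → 𝕜) (p : Rn d → ℝ → MvPolynomial (Fin d) 𝕜),
      ApproxData ω n D c ρ N h p → ∀ a ℓ, 0 < ℓ → cube a ℓ ⊆ D → ∀ x ∈ D, LebesguePoint h x →
        coneSide d c * ρ / 8 ≤ ‖x - a‖ → ∃ e : Rn d, ‖e‖ ≤ 1 ∧
        ‖h x - polyFun (p (a + (startRatio ρ M * ℓ) • e)
          (coneSide d c * (startRatio ρ M * ℓ))) x‖ ≤ C * N * ω ℓ * (1 + ‖x - a‖ / ℓ) ^ q := by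
  have hσ := hD.coneSide_pos
  have hσ1 := hD.coneSide_le_one
  have hρ := hD.cone.ρ_pos
  have hM1 := hD.one_le
  have hM := one_pos.trans_le hM1
  have hη := hD.startRatio_pos
  have hη4 : startRatio ρ M ≤ 1 / 4 := min_le_left _ _
  have hCω := hω.const_pos
  have hq := hω.q_pos
  obtain ⟨C₂, hC₂, hsup⟩ := hD.exists_sup_bound hω 𝕜
  obtain ⟨C₃, hC₃, hcore⟩ := hD.exists_core_pnorm hω 𝕜 (τ₀ := coneSide d c * (ρ / 2))
    (by positivity)
  obtain ⟨C₄, hC₄, hpn⟩ := hω.exists_chain_pnorm 𝕜 d hσ hσ1 le_rfl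
  set σ := coneSide d c with hσ_def
  set η := startRatio ρ M with hη_def
  set l := chainRatio σ 1 with hl
  have hl1 : 1 < l := one_lt_chainRatio hσ le_rfl
  set ρ₁ := σ * ρ / 8 with hρ₁
  have hρ₁0 : 0 < ρ₁ := by positivity
  have hωρ := hω.pos ρ₁ hρ₁0
  -- The top scale is at least `ρ / 2`, so its `κ`-multiple covers the diameter bound `M`.
  set κ := 2 * M / ρ with hκ
  have hκ1 : 1 ≤ κ := by rw [hκ, le_div_iff₀ hρ]; linarith [hD.ρ_le]
  refine ⟨(C₂ + (M + 1) ^ n * C₃) * (Cω / ω ρ₁) + κ ^ n * (C₄ * (ρ / (η * ρ₁)) ^ q),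
    by positivity, fun N h p H a ℓ hℓ ha x hx hxL hfar => ?_⟩
  have hN := H.nonneg
  have haD := ha (self_mem_cube a hℓ.le)
  have hωℓ := hω.pos ℓ hℓ
  obtain ⟨e, he, hcone⟩ := hD.cone.exists_direction a haD
  refine ⟨e, he, ?_⟩
  have hballa := hcone a haD (by simpa using hρ.le)
  have hcha := H.chain hD hω hballa
  have hei : ∀ i, |e i| ≤ 1 := fun i => (abs_apply_le_norm e i).trans he
  set w := ‖x - a‖ with hw
  have hw0 : 0 < w := by linarith
  have hwM : w ≤ M := hD.dist_le x hx a haD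
  obtain ⟨m, hm1, hm2⟩ := hD.exists_top_scale hℓ ha
  set s := η * ℓ with hs_def
  have hs : 0 < s := by positivity
  set T := l ^ m * s with hT_def
  have hT : 0 < T := by positivity
  have hxi : ∀ i, |x i - a i| ≤ w := fun i => abs_apply_le_norm (x - a) i
  have hA := hsup N h p H x hx hxL
  have hcub := hD.cube_subset_core hm1 (hballa T hT hm2)
  have htop := hcore N h p H _ _ (by gcongr) (mul_le_one₀ hσ1 hT.le (hm2.trans hD.ρ_le)) hcub
  have hB : ‖polyFun (p (a + T • e) (σ * T)) x‖ ≤ (M + 1) ^ n * (C₃ * N) := by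
    refine (norm_polyFun_le (hcha.totalDegree_le T hT hm2) (a := a + T • e) (τ := (M + 1) * 1)
      fun i => ?_).trans ((pnorm_mul_le zero_le_one (by linarith) _).trans (by gcongr))
    have e1 : x i - (a + T • e) i = (x i - a i) - T * e i := by simp; ring
    have e2 : |T * e i| ≤ 1 := by
      rw [abs_mul, abs_of_pos hT]
      exact mul_le_one₀ (hm2.trans hD.ρ_le) (abs_nonneg _) (hei i)
    rw [e1, mul_one]
    exact (abs_sub _ _).trans (add_le_add ((hxi i).trans hwM) e2)
  have hCc : ‖polyFun (p (a + T • e) (σ * T)) x - polyFun (p (a + s • e) (σ * s)) x‖ ≤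
      κ ^ n * (C₄ * N * ω s * (l ^ m) ^ q) := by
    have hsρ : s ≤ ρ := hD.startRatio_mul_le hℓ ha
    have hdeg : (p (a + s • e) (σ * s) - p (a + T • e) (σ * T)).totalDegree ≤ n :=
      (MvPolynomial.totalDegree_sub _ _).trans
        (max_le (hcha.totalDegree_le s hs hsρ) (hcha.totalDegree_le T hT hm2))
    rw [norm_sub_rev, ← polyFun_sub]
    refine (norm_polyFun_le hdeg (a := a) (τ := κ * T) fun i => ?_).trans
      ((pnorm_mul_le hT.le hκ1 _).trans (mul_le_mul_of_nonneg_left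
        (hpn N h a e ρ _ hN hei hcha s m hs hm2) (by positivity)))
    refine ((hxi i).trans hwM).trans ?_
    have : κ * (ρ / 2) = M := by rw [hκ]; field_simp
    rw [← this]
    gcongr
  have hq0 : (1 : ℝ) ≤ (1 + w / ℓ) ^ q :=
    Real.one_le_rpow (le_add_of_nonneg_right (by positivity)) hq.le
  have hq1 : ω ρ₁ ≤ Cω * (1 + w / ℓ) ^ q * ω ℓ := by
    rcases le_total ℓ ρ₁ with h1 | h1
    · refine (hω.le_of_ge ℓ ρ₁ hℓ h1).trans ?_
      gcongr
      have : ρ₁ / ℓ ≤ w / ℓ := by gcongr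
      linarith
    · refine (hω.mono hρ₁0.le h1).trans (le_mul_of_one_le_left hωℓ.le ?_)
      exact one_le_mul_of_one_le_of_one_le hω.one_le_const hq0
  -- At a distance bounded below, `ω(ℓ) (1 + w / ℓ)^q` is bounded below as well, so the crude sup
  -- bounds of size `N` are already acceptable.
  have hq1' : 1 ≤ Cω / ω ρ₁ * (ω ℓ * (1 + w / ℓ) ^ q) := by
    rw [div_mul_eq_mul_div, one_le_div hωρ]
    linarith
  have hq2 : (l ^ m) ^ q ≤ (ρ / (η * ρ₁)) ^ q * (1 + w / ℓ) ^ q := by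
    refine rpow_mul_le_one_add_rpow (by positivity) (by positivity) (by positivity) hq.le ?_
    have e1 : l ^ m = T / s := by rw [hT_def]; field_simp
    rw [e1, div_le_iff₀ hs]
    have e2 : ρ / (η * ρ₁) * (w / ℓ) * s = ρ * (w / ρ₁) := by rw [hs_def]; field_simp
    rw [e2]
    exact hm2.trans (le_mul_of_one_le_right hρ.le ((one_le_div hρ₁0).2 hfar))
  have hq3 : ω s ≤ ω ℓ := hω.mono hs.le (by rw [hs_def]; nlinarith)
  have e : h x - polyFun (p (a + s • e) (σ * s)) x =
      h x - polyFun (p (a + T • e) (σ * T)) x +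
      (polyFun (p (a + T • e) (σ * T)) x - polyFun (p (a + s • e) (σ * s)) x) := by ring
  rw [e]
  have hNle : N ≤ N * (Cω / ω ρ₁ * (ω ℓ * (1 + w / ℓ) ^ q)) := le_mul_of_one_le_right hN hq1'
  calc _ ≤ (C₂ * N + (M + 1) ^ n * (C₃ * N)) + κ ^ n * (C₄ * N * ω s * (l ^ m) ^ q) :=
        (norm_add_le _ _).trans (add_le_add ((norm_sub_le _ _).trans (add_le_add hA hB)) hCc)
    _ = (C₂ + (M + 1) ^ n * C₃) * N + κ ^ n * (C₄ * N * ω s * (l ^ m) ^ q) := by ring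
    _ ≤ (C₂ + (M + 1) ^ n * C₃) * (N * (Cω / ω ρ₁ * (ω ℓ * (1 + w / ℓ) ^ q))) +
        κ ^ n * (C₄ * N * ω ℓ * ((ρ / (η * ρ₁)) ^ q * (1 + w / ℓ) ^ q)) := by
        refine add_le_add (mul_le_mul_of_nonneg_left hNle (by positivity)) ?_
        gcongr
    _ = _ := by ring

/-- The error of approximation grows at most like the power `q` away from the cube. -/
lemma ConeDomain.exists_growth_bound (hω : GoodModulus ω n q r Cω) (𝕜 : Type*) [RCLike 𝕜]
    (hD : ConeDomain D c ρ M) : ∃ C : ℝ, 0 < C ∧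
    ∀ (N : ℝ) (h : Rn d → 𝕜) (p : Rn d → ℝ → MvPolynomial (Fin d) 𝕜),
      ApproxData ω n D c ρ N h p → ∀ a ℓ, 0 < ℓ → cube a ℓ ⊆ D → ∀ x ∈ D, LebesguePoint h x →
        ‖h x - polyFun (p a ℓ) x‖ ≤ C * N * ω ℓ * (1 + ‖x - a‖ / ℓ) ^ q := by
  obtain ⟨C₁, hC₁, hinner⟩ := hω.exists_inner_bound 𝕜 d le_rfl
  obtain ⟨C₂, hC₂, hstart⟩ := hD.exists_start_bound hω 𝕜
  obtain ⟨C₃, hC₃, hnear⟩ := hD.exists_growth_bound_near hω 𝕜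
  obtain ⟨C₄, hC₄, hfar⟩ := hD.exists_growth_bound_far hω 𝕜
  have hq := hω.q_pos
  refine ⟨C₁ + (C₃ + C₄ + C₂ * 2 ^ n), by positivity, fun N h p H a ℓ hℓ ha x hx hxL => ?_⟩
  have hN := H.nonneg
  have hωℓ := hω.pos ℓ hℓ
  set u := ‖x - a‖ / ℓ with hu
  have hu0 : 0 ≤ u := by positivity
  have hq0 : (1 : ℝ) ≤ (1 + u) ^ q :=
    Real.one_le_rpow (le_add_of_nonneg_right hu0) hq.le
  have hG : 0 ≤ N * ω ℓ * (1 + u) ^ q := by positivity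
  by_cases hxQ : x ∈ cube a ℓ
  · have h1 := hinner D N h p hN H.locallyIntegrableOn H.approx a ℓ x hℓ ha hxQ hxL
    rw [div_one] at h1
    calc _ ≤ C₁ * (N * ω ℓ * 1) := h1.trans_eq (by ring)
      _ ≤ C₁ * (N * ω ℓ * (1 + u) ^ q) := by gcongr
      _ ≤ (C₁ + (C₃ + C₄ + C₂ * 2 ^ n)) * (N * ω ℓ * (1 + u) ^ q) := by
        gcongr
        exact le_add_of_nonneg_right (by positivity)
      _ = _ := by ring
  · have hdist : ℓ / 2 ≤ ‖x - a‖ := by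
      by_contra hlt
      refine hxQ (closedBall_subset_cube a ℓ ?_)
      rw [Metric.mem_closedBall, dist_eq_norm]
      exact (not_le.1 hlt).le
    have hmain : ∃ e : Rn d, ‖e‖ ≤ 1 ∧ ‖h x - polyFun (p (a + (startRatio ρ M * ℓ) • e)
        (coneSide d c * (startRatio ρ M * ℓ))) x‖ ≤ (C₃ + C₄) * (N * ω ℓ * (1 + u) ^ q) := by
      rcases le_total (‖x - a‖) (coneSide d c * ρ / 8) with h1 | h1
      · obtain ⟨e, he, h2⟩ := hnear N h p H a ℓ hℓ ha x hx hxL hdist h1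
        refine ⟨e, he, h2.trans ?_⟩
        nlinarith
      · obtain ⟨e, he, h2⟩ := hfar N h p H a ℓ hℓ ha x hx hxL h1
        refine ⟨e, he, h2.trans ?_⟩
        nlinarith
    obtain ⟨e, he, h2⟩ := hmain
    have h3 := hstart N h p H a ℓ e hℓ ha he
    set P' := p (a + (startRatio ρ M * ℓ) • e) (coneSide d c * (startRatio ρ M * ℓ)) with hP'
    have hdeg : (p a ℓ - P').totalDegree ≤ n := by
      have hσ := hD.coneSide_pos
      have hσ1 := hD.coneSide_le_one
      have hη := hD.startRatio_pos
      have hη4 : startRatio ρ M ≤ 1 / 4 := min_le_left _ _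
      have hs : 0 < startRatio ρ M * ℓ := by positivity
      refine (MvPolynomial.totalDegree_sub _ _).trans (max_le
        (H.approx a ℓ hℓ (by rwa [one_mul])).1 (H.approx _ _ (by positivity) ?_).1)
      rw [one_mul]
      refine Subset.trans (cube_subset_cube fun i => ?_) ha
      have e1 : (a + (startRatio ρ M * ℓ) • e) i - a i = startRatio ρ M * ℓ * e i := by simp
      rw [e1, abs_mul, abs_of_pos hs]
      have := mul_le_of_le_one_right hs.le ((abs_apply_le_norm e i).trans he)
      have := mul_le_of_le_one_left hs.le hσ1
      nlinarith
    -- Replacing the bottom of the chain by the polynomial of the cube costs growth `u ^ n` with `u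
    -- = |x - a| / ℓ`, within the allowed power `q`.
    have h4 : ‖polyFun P' x - polyFun (p a ℓ) x‖ ≤ C₂ * 2 ^ n * (N * ω ℓ * (1 + u) ^ q) := by
      rw [norm_sub_rev, ← polyFun_sub]
      have hu2 : 1 ≤ 2 * u := by
        rw [hu, mul_div_assoc', le_div_iff₀ hℓ]
        linarith
      refine (norm_polyFun_le hdeg (a := a) (τ := 2 * u * ℓ) fun i => ?_).trans
        ((pnorm_mul_le hℓ.le hu2 _).trans ?_)
      · refine (abs_apply_le_norm (x - a) i).trans ?_
        have : 2 * u * ℓ = 2 * ‖x - a‖ := by rw [hu]; field_simp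
        rw [this]
        linarith [norm_nonneg (x - a)]
      · calc (2 * u) ^ n * pnorm n ℓ (shift a (p a ℓ - P')) ≤ (2 * u) ^ n * (C₂ * N * ω ℓ) := by
              gcongr
          _ = C₂ * 2 ^ n * (N * ω ℓ * u ^ n) := by rw [mul_pow]; ring
          _ ≤ _ := by
              gcongr
              exact pow_le_one_add_rpow hu0 hω.lt_q.le
    have e1 : h x - polyFun (p a ℓ) x = (h x - polyFun P' x) +
        (polyFun P' x - polyFun (p a ℓ) x) := by ring
    rw [e1]
    calc _ ≤ (C₃ + C₄) * (N * ω ℓ * (1 + u) ^ q) + C₂ * 2 ^ n * (N * ω ℓ * (1 + u) ^ q) :=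
          (norm_add_le _ _).trans (add_le_add h2 h4)
      _ ≤ (C₁ + (C₃ + C₄ + C₂ * 2 ^ n)) * (N * ω ℓ * (1 + u) ^ q) := by nlinarith
      _ = _ := by ring

end Growth

/-! ### Radial integrals -/

section Radial

lemma nontrivial_of_dim_pos (hd : 0 < d) : Nontrivial (Rn d) := by
  have : Nonempty (Fin d) := ⟨⟨0, hd⟩⟩
  infer_instance

lemma pow_pred_mul_rpow (hd : 0 < d) {t : ℝ} (ht : 0 < t) (p : ℝ) :
    t ^ (d - 1) * t ^ (p - d) = t ^ (p - 1) := by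
  rw [← Real.rpow_natCast, ← Real.rpow_add ht, Nat.cast_sub hd]
  congr 1
  push_cast
  ring

/-- The radial constant: the surface measure of the unit sphere. -/
def sphereConst (d : ℕ) : ℝ := d * (volume : Measure (Rn d)).real (Metric.ball 0 1)

lemma sphereConst_nonneg : 0 ≤ sphereConst d := by unfold sphereConst; positivity

/-- Polar coordinates; the exponent is written `p - d` so that the Jacobian leaves `t ^ (p - 1)`. -/
lemma setIntegral_norm_sub_eq (hd : 0 < d) (y : Rn d) {J : Set ℝ} (hJ : MeasurableSet J)
    (hJ0 : J ⊆ Ioi 0) (p : ℝ) :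
    ∫ x in {x : Rn d | ‖y - x‖ ∈ J}, ‖y - x‖ ^ (p - d) =
      sphereConst d * ∫ t in J, t ^ (p - 1) := by
  have := nontrivial_of_dim_pos hd
  have hm : MeasurableSet {x : Rn d | ‖y - x‖ ∈ J} :=
    (by fun_prop : Measurable fun x : Rn d => ‖y - x‖) hJ
  rw [← integral_indicator hm]
  have h1 : (fun x : Rn d => ({x : Rn d | ‖y - x‖ ∈ J}).indicator (fun x => ‖y - x‖ ^ (p - d)) x)
      = fun x => (fun z : Rn d => J.indicator (fun t => t ^ (p - d)) ‖z‖) (y - x) := by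
    ext x
    simp [indicator]
  rw [h1, integral_sub_left_eq_self (fun z : Rn d => J.indicator (fun t => t ^ (p - d)) ‖z‖),
    integral_fun_norm_addHaar]
  have h2 : ∫ t in Ioi (0 : ℝ), t ^ (Module.finrank ℝ (Rn d) - 1) •
      J.indicator (fun t => t ^ (p - d)) t = ∫ t in J, t ^ (p - 1) := by
    rw [← integral_indicator hJ, ← integral_indicator measurableSet_Ioi]
    congr 1
    ext t
    by_cases ht : t ∈ J
    · have : t ∈ Ioi (0 : ℝ) := hJ0 ht
      rw [indicator_of_mem this, indicator_of_mem ht, indicator_of_mem ht, smul_eq_mul,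
        finrank_euclideanSpace_fin, pow_pred_mul_rpow hd this]
    · by_cases ht0 : t ∈ Ioi (0 : ℝ)
      · simp [ht, ht0]
      · simp only [indicator_of_notMem ht, indicator_of_notMem ht0]
  rw [h2]
  simp [sphereConst, mul_assoc]

lemma integrableOn_norm_sub (hd : 0 < d) (y : Rn d) {J : Set ℝ} (hJ : MeasurableSet J)
    {p : ℝ} (hp : IntegrableOn (fun t : ℝ => t ^ (p - 1)) J) :
    IntegrableOn (fun x : Rn d => ‖y - x‖ ^ (p - d)) {x : Rn d | ‖y - x‖ ∈ J} := by
  have := nontrivial_of_dim_pos hd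
  have hm : MeasurableSet {x : Rn d | ‖y - x‖ ∈ J} :=
    (by fun_prop : Measurable fun x : Rn d => ‖y - x‖) hJ
  rw [← integrable_indicator_iff hm]
  have h1 : ({x : Rn d | ‖y - x‖ ∈ J}).indicator (fun x => ‖y - x‖ ^ (p - d))
      = fun x => (fun z : Rn d => J.indicator (fun t => t ^ (p - d)) ‖z‖) (y - x) := by
    ext x
    simp [indicator]
  rw [h1]
  refine Integrable.comp_sub_left (f := fun z : Rn d => J.indicator (fun t => t ^ (p - d)) ‖z‖)
    ?_ y
  rw [integrable_fun_norm_addHaar (μ := (volume : Measure (Rn d)))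
    (f := J.indicator fun t => t ^ (p - d))]
  refine ((integrable_indicator_iff hJ).2 hp).integrableOn.congr_fun (s := Ioi 0) ?_
    measurableSet_Ioi
  intro t ht
  by_cases htJ : t ∈ J
  · simp only [indicator_of_mem htJ, smul_eq_mul, finrank_euclideanSpace_fin]
    rw [pow_pred_mul_rpow hd ht]
  · simp [htJ]

lemma setOf_norm_mem_Ioo_ae_eq_ball (hd : 0 < d) (y : Rn d) (b : ℝ) :
    {x : Rn d | ‖y - x‖ ∈ Ioo 0 b} =ᵐ[volume] Metric.ball y b := by
  have := nontrivial_of_dim_pos hd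
  have : {x : Rn d | ‖y - x‖ ∈ Ioo 0 b} = Metric.ball y b \ {y} := by
    ext x
    simp [dist_eq_norm, norm_sub_rev, sub_eq_zero, and_comm, eq_comm]
  rw [this]
  exact sdiff_null_ae_eq_self (measure_singleton y)

lemma integrableOn_ball_rpow (hd : 0 < d) (y : Rn d) {p b : ℝ} (hp : 0 < p) :
    IntegrableOn (fun x : Rn d => ‖y - x‖ ^ (p - d)) (Metric.ball y b) := by
  rcases le_or_gt b 0 with hb | hb
  · simp [Metric.ball_eq_empty.2 hb]
  rw [← integrableOn_congr_set_ae (setOf_norm_mem_Ioo_ae_eq_ball hd y b)]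
  refine integrableOn_norm_sub hd y measurableSet_Ioo ?_
  have := intervalIntegral.intervalIntegrable_rpow' (a := 0) (b := b) (r := p - 1) (by linarith)
  rw [intervalIntegrable_iff_integrableOn_Ioo_of_le hb.le] at this
  exact this

lemma integral_ball_rpow (hd : 0 < d) (y : Rn d) {p b : ℝ} (hp : 0 < p) (hb : 0 < b) :
    ∫ x in Metric.ball y b, ‖y - x‖ ^ (p - d) = sphereConst d / p * b ^ p := by
  rw [← setIntegral_congr_set (setOf_norm_mem_Ioo_ae_eq_ball hd y b),
    setIntegral_norm_sub_eq hd y measurableSet_Ioo Ioo_subset_Ioi_self,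
    ← integral_Ioc_eq_integral_Ioo, ← intervalIntegral.integral_of_le hb.le,
    integral_rpow (Or.inl (by linarith)), Real.zero_rpow (by linarith)]
  rw [sub_add_cancel, sub_zero]
  ring

lemma integrableOn_compl_ball_rpow (hd : 0 < d) (y : Rn d) {β b : ℝ} (hβ : 0 < β) (hb : 0 < b) :
    IntegrableOn (fun x : Rn d => ‖y - x‖ ^ (-β - d)) {x : Rn d | b < ‖y - x‖} :=
  integrableOn_norm_sub hd y measurableSet_Ioi
    (integrableOn_Ioi_rpow_of_lt (by linarith) hb)

lemma integral_compl_ball_rpow (hd : 0 < d) (y : Rn d) {β b : ℝ} (hβ : 0 < β) (hb : 0 < b) :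
    ∫ x in {x : Rn d | b < ‖y - x‖}, ‖y - x‖ ^ (-β - d) = sphereConst d / β * b ^ (-β) := by
  refine (setIntegral_norm_sub_eq hd y measurableSet_Ioi (Ioi_subset_Ioi hb.le) _).trans ?_
  rw [integral_Ioi_rpow_of_lt (by linarith) hb, sub_add_cancel]
  field_simp

end Radial

/-! ### The kernel -/

section Kernel

variable {Ω : Rn d → 𝕜} {k : ℕ}

/-- Division by zero gives the value zero, so size bounds and homogeneity of the kernel hold at the
origin too. -/
lemma czKernel_zero (hd : 0 < d) (Ω : Rn d → 𝕜) : czKernel Ω 0 = 0 := by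
  simp [czKernel, hd.ne']

lemma IsCZSymbol.czKernel_smul (hΩ : IsCZSymbol k Ω) (hd : 0 < d) {t : ℝ} (ht : 0 < t) (x : Rn d) :
    czKernel Ω (t • x) = (t ^ d)⁻¹ • czKernel Ω x := by
  rcases eq_or_ne x 0 with rfl | hx
  · simp [czKernel_zero hd]
  · rw [czKernel, czKernel, hΩ.homogeneous t x ht hx, norm_smul, Real.norm_of_nonneg ht.le, mul_pow,
      RCLike.real_smul_eq_coe_mul]
    push_cast
    rw [div_eq_mul_inv, mul_inv, div_eq_mul_inv]
    ring

lemma IsCZSymbol.contDiffOn_czKernel (hΩ : IsCZSymbol k Ω) : ContDiffOn ℝ k (czKernel Ω) {0}ᶜ := by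
  intro x hx
  have hx' : x ≠ 0 := hx
  have h1 : ContDiffAt ℝ k (fun x : Rn d => ((‖x‖ ^ d : ℝ) : 𝕜)⁻¹) x := by
    refine ContDiffAt.inv ?_ (by simpa using fun h => absurd h hx')
    exact (RCLike.ofRealCLM (K := 𝕜)).contDiff.contDiffAt.comp x ((contDiffAt_norm ℝ hx').pow d)
  have h2 := (hΩ.contDiffOn x hx).mul h1.contDiffWithinAt
  exact h2.congr_of_eventuallyEq (Eventually.of_forall fun z => div_eq_mul_inv _ _)
    (div_eq_mul_inv _ _)

lemma IsCZSymbol.contDiffAt_czKernel (hΩ : IsCZSymbol k Ω) {x : Rn d} (hx : x ≠ 0) :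
    ContDiffAt ℝ k (czKernel Ω) x :=
  hΩ.contDiffOn_czKernel.contDiffAt (isOpen_compl_singleton.mem_nhds hx)

lemma IsCZSymbol.measurable_czKernel (hΩ : IsCZSymbol k Ω) : Measurable (czKernel Ω) :=
  measurable_of_continuousOn_compl_singleton 0 hΩ.contDiffOn_czKernel.continuousOn

end Kernel

/-! ### Decay, cancellation and Taylor expansion of the kernel -/

section KernelBounds

variable {Ω : Rn d → 𝕜} {k n : ℕ}

/-- Differentiate the homogeneity relation `K(t x) = t^{-d} K(x)`, viewing the dilation as a linear
equivalence. -/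
lemma IsCZSymbol.iteratedFDeriv_smul (hΩ : IsCZSymbol k Ω) (hd : 0 < d) {j : ℕ} (hj : j ≤ k) {t : ℝ}
    (ht : 0 < t) {x : Rn d} (hx : x ≠ 0) :
    t ^ j • iteratedFDeriv ℝ j (czKernel Ω) (t • x) =
      (t ^ d)⁻¹ • iteratedFDeriv ℝ j (czKernel Ω) x := by
  have h1 := (ContinuousLinearEquiv.smulLeft (R₁ := ℝ) (M₁ := Rn d)
    (Units.mk0 t ht.ne')).iteratedFDerivWithin_comp_right (czKernel Ω) uniqueDiffOn_univ
    (mem_univ (ContinuousLinearEquiv.smulLeft (R₁ := ℝ) (M₁ := Rn d) (Units.mk0 t ht.ne') x)) j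
  simp only [preimage_univ, iteratedFDerivWithin_univ] at h1
  have h2 : czKernel Ω ∘ (ContinuousLinearEquiv.smulLeft (R₁ := ℝ) (M₁ := Rn d)
      (Units.mk0 t ht.ne')) = (t ^ d)⁻¹ • czKernel Ω := by
    ext y
    exact hΩ.czKernel_smul hd ht y
  rw [h2, iteratedFDeriv_const_smul_apply
    ((hΩ.contDiffAt_czKernel hx).of_le (by exact_mod_cast hj))] at h1
  rw [h1]
  ext m
  simp only [smul_apply,
    ContinuousMultilinearMap.compContinuousLinearMap_apply]
  have : ∀ i, (((ContinuousLinearEquiv.smulLeft (R₁ := ℝ) (M₁ := Rn d) (Units.mk0 t ht.ne') :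
      Rn d ≃L[ℝ] Rn d) : Rn d →L[ℝ] Rn d) (m i)) = (fun _ => t) i • m i := fun i => rfl
  simp only [this]
  rw [ContinuousMultilinearMap.map_smul_univ]
  simp

/-- The derivative is bounded on the compact unit sphere, and homogeneity carries the bound to every
nonzero point. -/
lemma IsCZSymbol.exists_iteratedFDeriv_bound (hΩ : IsCZSymbol k Ω) (hd : 0 < d) {j : ℕ}
    (hj : j ≤ k) : ∃ C : ℝ, 0 < C ∧ ∀ x : Rn d, x ≠ 0 →
      ‖iteratedFDeriv ℝ j (czKernel Ω) x‖ ≤ C * (‖x‖ ^ (d + j))⁻¹ := by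
  have hcont : ContinuousOn (fun x => ‖iteratedFDeriv ℝ j (czKernel Ω) x‖)
      (Metric.sphere (0 : Rn d) 1) := fun x hx =>
    ((hΩ.contDiffAt_czKernel (ne_zero_of_mem_unit_sphere ⟨x, hx⟩)).continuousAt_iteratedFDeriv
      (by exact_mod_cast hj)).norm.continuousWithinAt
  obtain ⟨C, hC⟩ := (isCompact_sphere (0 : Rn d) 1).exists_bound_of_continuousOn hcont
  refine ⟨max C 1, by positivity, fun x hx => ?_⟩
  have hx0 : 0 < ‖x‖ := norm_pos_iff.2 hx
  have hθ : ‖‖x‖⁻¹ • x‖ = 1 := by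
    rw [norm_smul, norm_inv, norm_norm, inv_mul_cancel₀ hx0.ne']
  have h := hΩ.iteratedFDeriv_smul hd hj hx0 (x := ‖x‖⁻¹ • x) (by
    rw [← norm_pos_iff, hθ]; exact one_pos)
  rw [smul_smul, mul_inv_cancel₀ hx0.ne', one_smul] at h
  have h' := congrArg norm h
  rw [norm_smul, norm_smul, norm_pow, norm_inv, norm_pow, norm_norm] at h'
  have hb := hC (‖x‖⁻¹ • x) (by simpa using hθ)
  rw [norm_norm] at hb
  rw [← div_eq_mul_inv, le_div_iff₀ (by positivity), pow_add]
  calc _ = ‖x‖ ^ d * (‖x‖ ^ j * ‖iteratedFDeriv ℝ j (czKernel Ω) x‖) := by ring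
    _ = ‖iteratedFDeriv ℝ j (czKernel Ω) (‖x‖⁻¹ • x)‖ := by
        rw [h', ← mul_assoc, mul_inv_cancel₀ (by positivity), one_mul]
    _ ≤ _ := hb.trans (le_max_left _ _)

lemma IsCZSymbol.exists_bound (hΩ : IsCZSymbol k Ω) (hd : 0 < d) : ∃ C : ℝ, 0 < C ∧
    ∀ x : Rn d, ‖czKernel Ω x‖ ≤ C * (‖x‖ ^ d)⁻¹ := by
  obtain ⟨C, hC, h⟩ := hΩ.exists_iteratedFDeriv_bound hd (Nat.zero_le k)
  refine ⟨C, hC, fun x => ?_⟩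
  rcases eq_or_ne x 0 with rfl | hx
  · rw [czKernel_zero hd, norm_zero]; positivity
  · simpa using h x hx

/-- In polar coordinates the integrand is a product of `Ω` on the sphere and a radial function. The
integral of such a product factors without any integrability assumption, which is why `J` may be
arbitrary. -/
lemma IsCZSymbol.integral_annulus_zero (hΩ : IsCZSymbol k Ω) (hd : 0 < d) (J : Set ℝ)
    (hJ : MeasurableSet J) : ∫ x in {x : Rn d | ‖x‖ ∈ J}, czKernel Ω x = 0 := by
  have := nontrivial_of_dim_pos hd
  have hm : MeasurableSet {x : Rn d | ‖x‖ ∈ J} := measurable_norm hJ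
  set F : Rn d → 𝕜 := ({x : Rn d | ‖x‖ ∈ J}).indicator (czKernel Ω) with hF
  rw [← integral_indicator hm]
  calc ∫ x, F x = ∫ x : ({(0 : Rn d)}ᶜ : Set (Rn d)), F x.1 ∂((volume : Measure (Rn d)).comap (↑)) := by
        rw [integral_subtype_comap (measurableSet_singleton _).compl, restrict_compl_singleton]
    _ = ∫ x : Metric.sphere (0 : Rn d) 1 × Ioi (0 : ℝ), Ω x.1 *
          (J.indicator (fun r : ℝ => ((r ^ d : ℝ) : 𝕜)⁻¹) x.2.1)
          ∂((volume : Measure (Rn d)).toSphere.prod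
            (Measure.volumeIoiPow (Module.finrank ℝ (Rn d) - 1))) := by
        rw [← (volume : Measure (Rn d)).measurePreserving_homeomorphUnitSphereProd.integral_comp
          (Homeomorph.measurableEmbedding _)]
        congr 1
        ext x
        have hx0 : 0 < ‖(x : Rn d)‖ := norm_pos_iff.2 x.2
        rw [homeomorphUnitSphereProd_apply_fst_coe, homeomorphUnitSphereProd_apply_snd_coe,
          hΩ.homogeneous _ _ (inv_pos.2 hx0) x.2]
        by_cases h : ‖(x : Rn d)‖ ∈ J
        · rw [hF, indicator_of_mem h, indicator_of_mem (show (x : Rn d) ∈ {x : Rn d | ‖x‖ ∈ J} from h),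
            czKernel, div_eq_mul_inv]
        · rw [hF, indicator_of_notMem h,
            indicator_of_notMem (show (x : Rn d) ∉ {x : Rn d | ‖x‖ ∈ J} from h), mul_zero]
    _ = 0 := by
        rw [integral_prod_mul (fun θ : Metric.sphere (0 : Rn d) 1 => Ω θ)
          (fun r : Ioi (0 : ℝ) => J.indicator (fun r : ℝ => ((r ^ d : ℝ) : 𝕜)⁻¹) r.1),
          hΩ.integral_sphere, zero_mul]

lemma IsCZSymbol.integral_annulus_sub_zero (hΩ : IsCZSymbol k Ω) (hd : 0 < d) (y : Rn d)
    (J : Set ℝ) (hJ : MeasurableSet J) :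
    ∫ x in {x : Rn d | ‖y - x‖ ∈ J}, czKernel Ω (y - x) = 0 := by
  have hm : MeasurableSet {x : Rn d | ‖y - x‖ ∈ J} :=
    (by fun_prop : Measurable fun x : Rn d => ‖y - x‖) hJ
  rw [← hΩ.integral_annulus_zero hd J hJ, ← integral_indicator hm,
    ← integral_indicator (s := {x : Rn d | ‖x‖ ∈ J}) (measurable_norm hJ),
    ← integral_sub_left_eq_self (({x : Rn d | ‖x‖ ∈ J}).indicator (czKernel Ω)) volume y]
  rfl

/-! ### Taylor expansion of the kernel -/

/-- The coefficient of the Taylor polynomial of `F` at `z` along the basis vectors `e_{φ i}`. -/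
def taylorCoeff (F : Rn d → 𝕜) (z : Rn d) (j : ℕ) (φ : Fin j → Fin d) : 𝕜 :=
  ((j.factorial : ℝ)⁻¹) • iteratedFDeriv ℝ j F z fun i => EuclideanSpace.single (φ i) 1

lemma continuousMultilinearMap_diag {j : ℕ} (A : ContinuousMultilinearMap ℝ (fun _ : Fin j => Rn d) 𝕜)
    (v : Rn d) : A (fun _ => v) = ∑ φ : Fin j → Fin d,
      (∏ i, v (φ i)) • A (fun i => EuclideanSpace.single (φ i) 1) := by
  have hv : v = ∑ i, v i • EuclideanSpace.single i (1 : ℝ) := by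
    simpa using ((EuclideanSpace.basisFun (Fin d) ℝ).sum_repr v).symm
  conv_lhs => rw [hv]
  rw [ContinuousMultilinearMap.map_sum]
  refine Finset.sum_congr rfl fun φ _ => ?_
  exact A.map_smul_univ _ _

/-- The polynomial function `v ↦ ∑ c_{j, φ} v_{φ 0} ⋯ v_{φ (j - 1)}`. -/
def formSum (n : ℕ) (c : ∀ j : ℕ, (Fin j → Fin d) → 𝕜) (v : Rn d) : 𝕜 :=
  ∑ j ∈ Finset.range (n + 1), ∑ φ : Fin j → Fin d, c j φ * ∏ i, ((v (φ i) : ℝ) : 𝕜)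

lemma exists_polyFun_eq_formSum (n : ℕ) (c : ∀ j : ℕ, (Fin j → Fin d) → 𝕜) (a : Rn d) :
    ∃ S : MvPolynomial (Fin d) 𝕜, S.totalDegree ≤ n ∧ ∀ y, polyFun S y = formSum n c (y - a) := by
  have hXC : ∀ i, (MvPolynomial.X i - MvPolynomial.C ((a i : ℝ) : 𝕜) :
      MvPolynomial (Fin d) 𝕜).totalDegree ≤ 1 := fun i =>
    (MvPolynomial.totalDegree_sub _ _).trans (by simp)
  refine ⟨∑ j ∈ Finset.range (n + 1), ∑ φ : Fin j → Fin d, MvPolynomial.C (c j φ) *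
      ∏ i, (MvPolynomial.X (φ i) - MvPolynomial.C ((a (φ i) : ℝ) : 𝕜)), ?_, fun y => ?_⟩
  · refine MvPolynomial.totalDegree_finsetSum_le fun j hj => ?_
    refine MvPolynomial.totalDegree_finsetSum_le fun φ _ => ?_
    have hjn : j ≤ n := Nat.lt_succ_iff.1 (Finset.mem_range.1 hj)
    refine (MvPolynomial.totalDegree_mul _ _).trans ?_
    rw [MvPolynomial.totalDegree_C, zero_add]
    refine (MvPolynomial.totalDegree_finsetProd _ _).trans ?_
    refine (Finset.sum_le_card_nsmul _ _ 1 fun i _ => hXC _).trans ?_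
    simpa using hjn
  · simp [polyFun, formSum]

/-- Integral form of the remainder, with the factor `1 / n!` discarded. -/
lemma norm_sub_taylor_le {F : Rn d → 𝕜} {z v : Rn d} {B : ℝ}
    (hF : ∀ t ∈ Icc (0 : ℝ) 1, ContDiffAt ℝ (n + 1) F (z + t • v))
    (hB : ∀ t ∈ Icc (0 : ℝ) 1, ‖iteratedFDeriv ℝ (n + 1) F (z + t • v)‖ ≤ B) :
    ‖F (z + v) - formSum n (taylorCoeff F z) v‖ ≤ B * ‖v‖ ^ (n + 1) := by
  have hB0 : 0 ≤ B := (norm_nonneg _).trans (hB 0 (by simp))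
  have htay := map_add_eq_sum_add_integral_iteratedFDeriv (n := n) (f := F) (x := z) (y := v) hF
  have hval : ∑ j ∈ Finset.range (n + 1), (j.factorial : ℝ)⁻¹ •
      iteratedFDeriv ℝ j F z (fun _ => v) = formSum n (taylorCoeff F z) v := by
    refine Finset.sum_congr rfl fun j _ => ?_
    rw [continuousMultilinearMap_diag, Finset.smul_sum]
    refine Finset.sum_congr rfl fun φ _ => ?_
    rw [taylorCoeff, RCLike.real_smul_eq_coe_mul, RCLike.real_smul_eq_coe_mul,
      RCLike.real_smul_eq_coe_mul]
    push_cast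
    ring
  rw [hval] at htay
  rw [htay, add_sub_cancel_left, norm_smul]
  have hintg : ‖∫ t in (0 : ℝ)..1, (1 - t) ^ n • iteratedFDeriv ℝ (n + 1) F (z + t • v) (fun _ => v)‖ ≤
      (B * ‖v‖ ^ (n + 1)) * |(1 : ℝ) - 0| := by
    refine intervalIntegral.norm_integral_le_of_norm_le_const fun t ht => ?_
    rw [uIoc_of_le zero_le_one] at ht
    rw [norm_smul, norm_pow]
    have h1 : ‖1 - t‖ ^ n ≤ 1 := by
      refine pow_le_one₀ (norm_nonneg _) ?_
      rw [Real.norm_of_nonneg (by linarith [ht.2])]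
      linarith [ht.1]
    have h2 := (iteratedFDeriv ℝ (n + 1) F (z + t • v)).le_opNorm fun _ => v
    rw [Finset.prod_const, Finset.card_univ, Fintype.card_fin] at h2
    calc _ ≤ 1 * (B * ‖v‖ ^ (n + 1)) := by
          gcongr
          exact h2.trans (by gcongr; exact hB t ⟨ht.1.le, ht.2⟩)
      _ = _ := one_mul _
  rw [sub_zero, abs_one, mul_one] at hintg
  have hf : ‖((n.factorial : ℝ)⁻¹)‖ ≤ 1 := by
    rw [norm_inv, Real.norm_natCast]
    exact inv_le_one_of_one_le₀ (by exact_mod_cast n.factorial_pos)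
  calc _ ≤ 1 * _ := mul_le_mul hf hintg (norm_nonneg _) zero_le_one
    _ = _ := one_mul _

/-- If `2 ‖v‖ ≤ ‖z‖`, the segment from `z` to `z + v` stays at distance at least `‖z‖ / 2` from the
singularity. -/
lemma IsCZSymbol.exists_taylor_bound (hΩ : IsCZSymbol (n + 1) Ω) (hd : 0 < d) :
    ∃ C : ℝ, 0 < C ∧ ∀ z v : Rn d, z ≠ 0 → 2 * ‖v‖ ≤ ‖z‖ →
      ‖czKernel Ω (z + v) - formSum n (taylorCoeff (czKernel Ω) z) v‖ ≤
        C * ‖v‖ ^ (n + 1) * (‖z‖ ^ (d + n + 1))⁻¹ := by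
  obtain ⟨C, hC, hder⟩ := hΩ.exists_iteratedFDeriv_bound hd le_rfl
  refine ⟨C * 2 ^ (d + (n + 1)), by positivity, fun z v hz hv => ?_⟩
  have hz0 : 0 < ‖z‖ := norm_pos_iff.2 hz
  have hlow : ∀ t ∈ Icc (0 : ℝ) 1, ‖z‖ / 2 ≤ ‖z + t • v‖ := fun t ht => by
    have h1 : ‖t • v‖ ≤ ‖v‖ := by
      rw [norm_smul, Real.norm_of_nonneg ht.1]
      exact mul_le_of_le_one_left (norm_nonneg _) ht.2
    have h2 := norm_sub_le (z + t • v) (t • v)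
    rw [add_sub_cancel_right] at h2
    linarith
  have hne : ∀ t ∈ Icc (0 : ℝ) 1, z + t • v ≠ 0 := fun t ht =>
    norm_pos_iff.1 (lt_of_lt_of_le (by positivity) (hlow t ht))
  refine (norm_sub_taylor_le (B := C * 2 ^ (d + (n + 1)) * (‖z‖ ^ (d + n + 1))⁻¹)
    (fun t ht => by exact_mod_cast hΩ.contDiffAt_czKernel (hne t ht)) fun t ht => ?_).trans_eq
    (by ring)
  refine (hder _ (hne t ht)).trans ?_
  rw [mul_assoc]
  gcongr
  have : (‖z + t • v‖ ^ (d + (n + 1)))⁻¹ ≤ ((‖z‖ / 2) ^ (d + (n + 1)))⁻¹ := by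
    gcongr
    exact hlow t ht
  refine this.trans_eq ?_
  rw [div_pow, inv_div, div_eq_mul_inv, add_assoc]

/-- Needed for the measurability of the Taylor coefficients as functions of the integration
variable. -/
lemma IsCZSymbol.continuousOn_taylorCoeff (hΩ : IsCZSymbol (n + 1) Ω) {j : ℕ} (hj : j ≤ n)
    (φ : Fin j → Fin d) : ContinuousOn (fun z => taylorCoeff (czKernel Ω) z j φ) {0}ᶜ := by
  intro z hz
  have h := (hΩ.contDiffAt_czKernel hz).continuousAt_iteratedFDeriv
    (k := j) (by exact_mod_cast (by omega : j ≤ n + 1))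
  refine ContinuousAt.continuousWithinAt ?_
  unfold taylorCoeff
  exact ((ContinuousMultilinearMap.apply ℝ (fun _ : Fin j => Rn d) 𝕜 fun i =>
    EuclideanSpace.single (φ i) 1).continuous.continuousAt.comp h).const_smul _

end KernelBounds

/-! ### Potentials of distant functions -/

section FarField

variable {Ω : Rn d → 𝕜} {k n : ℕ}

lemma IsCZSymbol.integrableOn_mul_kernel (hΩ : IsCZSymbol k Ω) (hd : 0 < d) {E : Set (Rn d)}
    (hE : MeasurableSet E) {G : Rn d → 𝕜} (hG : IntegrableOn G E) {y : Rn d} {R : ℝ} (hR : 0 < R)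
    (h : ∀ x ∈ E, R ≤ ‖y - x‖) : IntegrableOn (fun x => G x * czKernel Ω (y - x)) E := by
  obtain ⟨C, hC, hK⟩ := hΩ.exists_bound hd
  refine Integrable.mul_bdd (c := C * (R ^ d)⁻¹) hG
    (hΩ.measurable_czKernel.comp (measurable_const.sub measurable_id)).aestronglyMeasurable ?_
  filter_upwards [ae_restrict_mem hE] with x hx
  refine (hK _).trans ?_
  gcongr
  exact h x hx

/-- Far from the centre, the potential of `G` is a polynomial up to a small error. -/
lemma IsCZSymbol.exists_far_field (hΩ : IsCZSymbol (n + 1) Ω) (hd : 0 < d) : ∃ C : ℝ, 0 < C ∧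
    ∀ (x₀ : Rn d) (R : ℝ) (E : Set (Rn d)) (G : Rn d → 𝕜), 0 < R → MeasurableSet E →
      IntegrableOn G E → (∀ x ∈ E, 2 * R ≤ ‖x₀ - x‖) →
      ∃ S : MvPolynomial (Fin d) 𝕜, S.totalDegree ≤ n ∧ ∀ y, ‖y - x₀‖ ≤ R →
        ‖(∫ x in E, G x * czKernel Ω (y - x)) - polyFun S y‖ ≤
          C * R ^ (n + 1) * ∫ x in E, ‖G x‖ * (‖x₀ - x‖ ^ (d + n + 1))⁻¹ := by
  obtain ⟨C, hC, htay⟩ := hΩ.exists_taylor_bound hd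
  refine ⟨C, hC, fun x₀ R E G hR hE hG hfar => ?_⟩
  have hcoef : ∀ j ∈ Finset.range (n + 1), ∀ φ : Fin j → Fin d,
      IntegrableOn (fun x => G x * taylorCoeff (czKernel Ω) (x₀ - x) j φ) E := by
    intro j hj φ
    have hjn : j ≤ n := Nat.lt_succ_iff.1 (Finset.mem_range.1 hj)
    obtain ⟨B, hB, hder⟩ := hΩ.exists_iteratedFDeriv_bound hd (hjn.trans n.le_succ)
    refine Integrable.mul_bdd (c := B * ((2 * R) ^ (d + j))⁻¹) hG
      ((measurable_of_continuousOn_compl_singleton 0 (hΩ.continuousOn_taylorCoeff hjn φ)).comp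
        (measurable_const.sub measurable_id)).aestronglyMeasurable ?_
    filter_upwards [ae_restrict_mem hE] with x hx
    have hx2 := hfar x hx
    have hne : x₀ - x ≠ 0 := norm_pos_iff.1 (by linarith)
    have h1 : ‖((j.factorial : ℝ)⁻¹)‖ ≤ 1 := by
      rw [norm_inv, Real.norm_natCast]
      exact inv_le_one_of_one_le₀ (by exact_mod_cast j.factorial_pos)
    have h2 := (iteratedFDeriv ℝ j (czKernel Ω) (x₀ - x)).le_opNorm
      fun i => EuclideanSpace.single (φ i) (1 : ℝ)
    simp only [PiLp.norm_single, norm_one, Finset.prod_const_one, mul_one] at h2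
    rw [taylorCoeff, norm_smul]
    calc _ ≤ 1 * ‖iteratedFDeriv ℝ j (czKernel Ω) (x₀ - x)‖ := by gcongr
      _ ≤ B * (‖x₀ - x‖ ^ (d + j))⁻¹ := by rw [one_mul]; exact hder _ hne
      _ ≤ _ := by gcongr
  -- The coefficients of `S` are the integrals of `G` against the Taylor coefficients of the kernel
  -- at `x₀ - x`, so one polynomial serves every `y`.
  obtain ⟨S, hSdeg, hSval⟩ := exists_polyFun_eq_formSum n
    (fun j φ => ∫ x in E, G x * taylorCoeff (czKernel Ω) (x₀ - x) j φ) x₀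
  refine ⟨S, hSdeg, fun y hy => ?_⟩
  have hS : polyFun S y = ∫ x in E, G x * formSum n (taylorCoeff (czKernel Ω) (x₀ - x)) (y - x₀) := by
    simp only [hSval, formSum, Finset.mul_sum]
    rw [integral_finsetSum _ fun j hj => integrable_finsetSum _ fun φ _ => by
      simpa only [mul_assoc] using
        (hcoef j hj φ).mul_const (∏ i, (((y - x₀) (φ i) : ℝ) : 𝕜))]
    refine Finset.sum_congr rfl fun j hj => ?_
    rw [integral_finsetSum _ fun φ _ => by
      simpa only [mul_assoc] using
        (hcoef j hj φ).mul_const (∏ i, (((y - x₀) (φ i) : ℝ) : 𝕜))]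
    refine Finset.sum_congr rfl fun φ _ => ?_
    rw [← integral_mul_const]
    simp [mul_assoc]
  have hT : IntegrableOn (fun x => G x * formSum n (taylorCoeff (czKernel Ω) (x₀ - x)) (y - x₀)) E := by
    simp only [formSum, Finset.mul_sum]
    exact integrable_finsetSum _ fun j hj => integrable_finsetSum _ fun φ _ => by
      simpa only [mul_assoc] using
        (hcoef j hj φ).mul_const (∏ i, (((y - x₀) (φ i) : ℝ) : 𝕜))
  have hK : IntegrableOn (fun x => G x * czKernel Ω (y - x)) E :=
    hΩ.integrableOn_mul_kernel hd hE hG hR fun x hx => by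
      have h1 := hfar x hx
      have h2 := norm_sub_le_norm_sub_add_norm_sub x₀ y x
      rw [norm_sub_rev x₀ y] at h2
      linarith
  rw [hS, ← integral_sub hK hT, ← integral_const_mul]
  refine norm_integral_le_of_norm_le ?_ ?_
  · refine Integrable.const_mul ?_ _
    refine Integrable.mul_bdd (c := ((2 * R) ^ (d + n + 1))⁻¹) hG.norm
      (by fun_prop : Measurable fun x : Rn d => (‖x₀ - x‖ ^ (d + n + 1))⁻¹).aestronglyMeasurable ?_
    filter_upwards [ae_restrict_mem hE] with x hx
    rw [Real.norm_of_nonneg (by positivity)]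
    have := hfar x hx
    gcongr
  · filter_upwards [ae_restrict_mem hE] with x hx
    have hx2 := hfar x hx
    have h := htay (x₀ - x) (y - x₀) (norm_pos_iff.1 (by linarith)) (by linarith)
    rw [show x₀ - x + (y - x₀) = y - x by abel] at h
    rw [← mul_sub, norm_mul]
    calc _ ≤ ‖G x‖ * (C * R ^ (n + 1) * (‖x₀ - x‖ ^ (d + n + 1))⁻¹) := by
          gcongr
          exact h.trans (by gcongr)
      _ = _ := by ring

end FarField

/-! ### Principal values -/

section PrincipalValue

variable {Ω : Rn d → 𝕜} {k n : ℕ} {D : Set (Rn d)} {f g : Rn d → 𝕜} {y : Rn d} {v w : 𝕜}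

/-- The principal value at `y` of the operator applied to `f`, extended by zero, equals `v`. -/
def HasPV (Ω : Rn d → 𝕜) (D : Set (Rn d)) (f : Rn d → 𝕜) (y : Rn d) (v : 𝕜) : Prop :=
  Tendsto (czTruncated Ω (D.indicator f) y) (𝓝[>] 0) (𝓝 v)

lemma HasPV.restrictedCZ_eq (h : HasPV Ω D f y v) (hy : y ∈ D) : restrictedCZ Ω D f y = v := by
  rw [restrictedCZ, indicator_of_mem hy]
  exact h.limUnder_eq

lemma czTruncated_indicator (hD : MeasurableSet D) (f : Rn d → 𝕜) (y : Rn d) (ε : ℝ) :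
    czTruncated Ω (D.indicator f) y ε =
      ∫ x in {x | ε < ‖y - x‖} ∩ D, f x * czKernel Ω (y - x) := by
  rw [czTruncated, ← setIntegral_indicator hD]
  congr 1
  ext x
  by_cases hx : x ∈ D <;> simp [hx]

lemma measurableSet_norm_sub_gt (y : Rn d) (ε : ℝ) : MeasurableSet {x : Rn d | ε < ‖y - x‖} :=
  measurableSet_lt measurable_const (by fun_prop)

lemma IsCZSymbol.integrableOn_truncated (hΩ : IsCZSymbol k Ω) (hd : 0 < d) (hD : MeasurableSet D)
    (hf : IntegrableOn f D) (y : Rn d) {ε : ℝ} (hε : 0 < ε) :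
    IntegrableOn (fun x => f x * czKernel Ω (y - x)) ({x | ε < ‖y - x‖} ∩ D) :=
  hΩ.integrableOn_mul_kernel hd ((measurableSet_norm_sub_gt y ε).inter hD)
    (hf.mono_set inter_subset_right) hε fun _ hx => hx.1.le

lemma HasPV.add (hΩ : IsCZSymbol k Ω) (hd : 0 < d) (hD : MeasurableSet D) (hf : IntegrableOn f D)
    (hg : IntegrableOn g D) (h₁ : HasPV Ω D f y v) (h₂ : HasPV Ω D g y w) :
    HasPV Ω D (fun x => f x + g x) y (v + w) := by
  refine (Tendsto.add h₁ h₂).congr' ?_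
  filter_upwards [self_mem_nhdsWithin] with ε hε
  rw [czTruncated_indicator hD, czTruncated_indicator hD, czTruncated_indicator hD,
    ← integral_add (hΩ.integrableOn_truncated hd hD hf y hε)
      (hΩ.integrableOn_truncated hd hD hg y hε)]
  simp only [add_mul]

lemma HasPV.const_mul (hD : MeasurableSet D) (h : HasPV Ω D f y v) (c : 𝕜) :
    HasPV Ω D (fun x => c * f x) y (c * v) := by
  refine (Tendsto.const_mul c h).congr fun ε => ?_
  rw [czTruncated_indicator hD, czTruncated_indicator hD, ← integral_const_mul]
  simp only [mul_assoc]

lemma HasPV.congr (h : HasPV Ω D f y v) (hfg : ∀ x ∈ D, f x = g x) : HasPV Ω D g y v := by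
  have : D.indicator f = D.indicator g := indicator_congr hfg
  rw [HasPV, ← this]
  exact h

lemma restrictedCZ_indicator (Ω : Rn d → 𝕜) (D : Set (Rn d)) (f : Rn d → 𝕜) :
    restrictedCZ Ω D (D.indicator f) = restrictedCZ Ω D f := by
  rw [restrictedCZ, indicator_indicator, inter_self, restrictedCZ]

/-- Only an inequality: at `t = 0` the left side vanishes, while the right side equals `1` when `p =
d`. -/
lemma rpow_mul_inv_pow_le (t p : ℝ) (ht : 0 ≤ t) (hp : 0 < p) :
    t ^ p * (t ^ d)⁻¹ ≤ t ^ (p - d) := by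
  rcases ht.eq_or_lt with rfl | ht
  · rw [Real.zero_rpow hp.ne', zero_mul]
    exact Real.rpow_nonneg le_rfl _
  · rw [Real.rpow_sub ht, Real.rpow_natCast, div_eq_mul_inv]

lemma IsCZSymbol.exists_near_bound (hΩ : IsCZSymbol k Ω) (hd : 0 < d) {p : ℝ} (hp : 0 < p) :
    ∃ C : ℝ, 0 < C ∧ ∀ (y : Rn d) (s A : ℝ) (g : Rn d → 𝕜), 0 < s → 0 ≤ A →
      AEStronglyMeasurable g (volume.restrict (Metric.ball y s)) →
      (∀ᵐ x, x ∈ Metric.ball y s → ‖g x‖ ≤ A * ‖y - x‖ ^ p) →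
      IntegrableOn (fun x => g x * czKernel Ω (y - x)) (Metric.ball y s) ∧
      ‖∫ x in Metric.ball y s, g x * czKernel Ω (y - x)‖ ≤ C * A * s ^ p := by
  obtain ⟨C, hC, hK⟩ := hΩ.exists_bound hd
  have hsph := sphereConst_nonneg (d := d)
  refine ⟨C * (sphereConst d / p) + 1, by positivity, fun y s A g hs hA hgm hg => ?_⟩
  have hintg := (integrableOn_ball_rpow hd y (b := s) hp).const_mul (A * C)
  have hle : ∀ᵐ x ∂volume.restrict (Metric.ball y s),
      ‖g x * czKernel Ω (y - x)‖ ≤ A * C * ‖y - x‖ ^ (p - d) := by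
    filter_upwards [ae_restrict_mem measurableSet_ball, ae_restrict_of_ae hg] with x hx hgx
    rw [norm_mul]
    calc _ ≤ (A * ‖y - x‖ ^ p) * (C * (‖y - x‖ ^ d)⁻¹) := by
          gcongr
          · exact hgx hx
          · exact hK _
      _ = A * C * (‖y - x‖ ^ p * (‖y - x‖ ^ d)⁻¹) := by ring
      _ ≤ _ := by
          gcongr
          exact rpow_mul_inv_pow_le _ _ (norm_nonneg _) hp
  refine ⟨hintg.mono' (hgm.mul (hΩ.measurable_czKernel.comp
    (measurable_const.sub measurable_id)).aestronglyMeasurable) hle, ?_⟩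
  refine (norm_integral_le_of_norm_le hintg hle).trans ?_
  rw [integral_const_mul, integral_ball_rpow hd y hp hs]
  have : 0 ≤ A * s ^ p := by positivity
  nlinarith

/-- The kernel has zero integral over the annuli `ε < |y - x| < s`, so `v` may be subtracted near
`y`. What remains is absolutely integrable and dominated convergence applies. The constant `v` need
not be the value of `f` at `y`. -/
lemma IsCZSymbol.hasPV (hΩ : IsCZSymbol k Ω) (hd : 0 < d) (hD : MeasurableSet D)
    (hf : IntegrableOn f D) {s p A : ℝ} (hs : 0 < s) (hB : Metric.ball y s ⊆ D) (hp : 0 < p)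
    (hA : 0 ≤ A) (hfv : ∀ᵐ x, x ∈ Metric.ball y s → ‖f x - v‖ ≤ A * ‖y - x‖ ^ p) :
    HasPV Ω D f y ((∫ x in Metric.ball y s, (f x - v) * czKernel Ω (y - x)) +
      ∫ x in D \ Metric.ball y s, f x * czKernel Ω (y - x)) := by
  obtain ⟨C, -, hnear⟩ := hΩ.exists_near_bound hd hp
  have hfB : IntegrableOn f (Metric.ball y s) := hf.mono_set hB
  have hcB : IntegrableOn (fun _ : Rn d => v) (Metric.ball y s) :=
    integrableOn_const (by finiteness)
  have hgB : IntegrableOn (fun x => f x - v) (Metric.ball y s) := hfB.sub hcB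
  obtain ⟨hintg, -⟩ := hnear y s A (fun x => f x - v) hs hA hgB.aestronglyMeasurable hfv
  have hlim : Tendsto (fun ε : ℝ => ∫ x in Metric.ball y s,
      ({x | ε < ‖y - x‖}).indicator (fun x => (f x - v) * czKernel Ω (y - x)) x) (𝓝[>] 0)
      (𝓝 (∫ x in Metric.ball y s, (f x - v) * czKernel Ω (y - x))) := by
    refine tendsto_integral_filter_of_dominated_convergence
      (fun x => ‖(f x - v) * czKernel Ω (y - x)‖) ?_ ?_ hintg.norm ?_
    · exact Eventually.of_forall fun ε =>
        hintg.aestronglyMeasurable.indicator (measurableSet_norm_sub_gt y ε)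
    · exact Eventually.of_forall fun ε => Eventually.of_forall fun x => norm_indicator_le_norm_self _ _
    · refine Eventually.of_forall fun x => ?_
      rcases eq_or_ne x y with rfl | hxy
      · simp [czKernel_zero hd, indicator]
      · refine tendsto_const_nhds.congr' ?_
        have hpos : 0 < ‖y - x‖ := norm_pos_iff.2 (sub_ne_zero.2 hxy.symm)
        filter_upwards [mem_nhdsWithin_of_mem_nhds (Iio_mem_nhds hpos)] with ε hε
        rw [indicator_of_mem (show x ∈ {x | ε < ‖y - x‖} from hε)]
  refine (hlim.add_const (∫ x in D \ Metric.ball y s, f x * czKernel Ω (y - x))).congr' ?_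
  filter_upwards [self_mem_nhdsWithin, mem_nhdsWithin_of_mem_nhds (Iio_mem_nhds hs)] with ε hε hεs
  have hε0 : (0 : ℝ) < ε := hε
  have hε1 : ε < s := hεs
  have hm := measurableSet_norm_sub_gt y ε
  have hset : {x | ε < ‖y - x‖} ∩ D = (Metric.ball y s ∩ {x | ε < ‖y - x‖}) ∪ (D \ Metric.ball y s) := by
    ext x
    by_cases hx : x ∈ Metric.ball y s
    · simp [hx, hB hx]
    · have : ε < ‖y - x‖ := by
        rw [Metric.mem_ball, not_lt, dist_comm, dist_eq_norm] at hx
        linarith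
      simp [hx, this]
  have hI := hΩ.integrableOn_truncated hd hD hf y hε0
  rw [czTruncated_indicator hD, hset, setIntegral_union
    (disjoint_sdiff_right.mono_left inter_subset_left) (MeasurableSet.diff hD measurableSet_ball)
    (hI.mono_set (by rw [hset]; exact subset_union_left))
    (hI.mono_set (by rw [hset]; exact subset_union_right)), setIntegral_indicator hm]
  congr 1
  have hann : Metric.ball y s ∩ {x | ε < ‖y - x‖} = {x | ‖y - x‖ ∈ Ioo ε s} := by
    ext x
    simp [dist_eq_norm, norm_sub_rev x y, and_comm]
  have hkz := hΩ.integral_annulus_sub_zero hd y (Ioo ε s) measurableSet_Ioo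
  rw [← hann] at hkz
  have h0 : ∫ x in Metric.ball y s ∩ {x | ε < ‖y - x‖}, v * czKernel Ω (y - x) = 0 := by
    rw [integral_const_mul, hkz, mul_zero]
  have hmB : MeasurableSet (Metric.ball y s ∩ {x | ε < ‖y - x‖}) := measurableSet_ball.inter hm
  have i1 := hΩ.integrableOn_mul_kernel hd hmB (hgB.mono_set inter_subset_left) hε0 (y := y)
    fun x hx => le_of_lt hx.2
  have i2 := hΩ.integrableOn_mul_kernel hd hmB (hcB.mono_set inter_subset_left) hε0 (y := y)
    fun x hx => le_of_lt hx.2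
  rw [← add_zero (∫ x in Metric.ball y s ∩ {x | ε < ‖y - x‖}, (f x - v) * czKernel Ω (y - x)), ← h0,
    ← integral_add i1 i2]
  congr 1
  ext x
  ring

/-- The image is a pointwise limit of truncations at `ε = 1 / (j + 1)`, each measurable as a
parametric integral of a jointly measurable function. -/
lemma IsCZSymbol.aestronglyMeasurable_restrictedCZ (hΩ : IsCZSymbol k Ω) (hD : MeasurableSet D)
    (hf : IntegrableOn f D) (h : ∀ y ∈ D, ∃ v, HasPV Ω D f y v) :
    AEStronglyMeasurable (restrictedCZ Ω D f) := by
  have hF : AEStronglyMeasurable (D.indicator f) := (hf.integrable_indicator hD).aestronglyMeasurable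
  have hu : Tendsto (fun j : ℕ => 1 / ((j : ℝ) + 1)) atTop (𝓝[>] 0) :=
    tendsto_nhdsWithin_iff.2 ⟨tendsto_one_div_add_atTop_nhds_zero_nat,
      Eventually.of_forall fun j => by rw [mem_Ioi]; positivity⟩
  refine aestronglyMeasurable_of_tendsto_ae atTop
    (f := fun (j : ℕ) => D.indicator fun y => czTruncated Ω (D.indicator f) y (1 / ((j : ℝ) + 1))) ?_ ?_
  · intro j
    refine AEStronglyMeasurable.indicator ?_ hD
    have hset : MeasurableSet {z : Rn d × Rn d | 1 / ((j : ℝ) + 1) < ‖z.1 - z.2‖} :=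
      measurableSet_lt measurable_const (by fun_prop)
    have hker : Measurable fun z : Rn d × Rn d => czKernel Ω (z.1 - z.2) :=
      hΩ.measurable_czKernel.comp (by fun_prop)
    have hjoint : AEStronglyMeasurable
        ({z : Rn d × Rn d | 1 / ((j : ℝ) + 1) < ‖z.1 - z.2‖}.indicator
          fun z => D.indicator f z.2 * czKernel Ω (z.1 - z.2))
        ((volume : Measure (Rn d)).prod volume) :=
      (hF.comp_snd.mul hker.aestronglyMeasurable).indicator hset
    refine hjoint.integral_prod_right'.congr (Eventually.of_forall fun y => ?_)
    simp only [czTruncated]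
    rw [← integral_indicator (measurableSet_norm_sub_gt y _)]
    rfl
  · refine Eventually.of_forall fun y => ?_
    by_cases hy : y ∈ D
    · obtain ⟨v, hv⟩ := h y hy
      simp only [indicator_of_mem hy]
      rw [hv.restrictedCZ_eq hy]
      exact hv.comp hu
    · simp [hy, restrictedCZ]

end PrincipalValue

/-! ### Principal values for functions of the Zygmund class -/

section ZygmundPV

variable {ω : ℝ → ℝ} {n k : ℕ} {q r Cω : ℝ} {D : Set (Rn d)} {c ρ M : ℝ} {Ω : Rn d → 𝕜}

lemma ConeDomain.integrableOn_continuous (hD : ConeDomain D c ρ M) {f : Rn d → 𝕜}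
    (hf : Continuous f) : IntegrableOn f D :=
  (hf.locallyIntegrable.integrableOn_isCompact hD.isBounded.isCompact_closure).mono_set
    subset_closure

lemma ConeDomain.exists_integral_bound (hω : GoodModulus ω n q r Cω) (𝕜 : Type*) [RCLike 𝕜]
    (hD : ConeDomain D c ρ M) : ∃ C : ℝ, 0 < C ∧
    ∀ (N : ℝ) (h : Rn d → 𝕜) (p : Rn d → ℝ → MvPolynomial (Fin d) 𝕜),
      ApproxData ω n D c ρ N h p → IntegrableOn h D ∧ ∫ x in D, ‖h x‖ ≤ C * N ∧
        ∫⁻ x in D, ‖h x‖ₑ ≤ ENNReal.ofReal (C * N) := by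
  obtain ⟨C, hC, hsup⟩ := hD.exists_sup_bound hω 𝕜
  refine ⟨C * volume.real D + 1, by positivity, fun N h p H => ?_⟩
  have hN := H.nonneg
  have hle : ∀ᵐ x ∂volume.restrict D, ‖h x‖ ≤ C * N := by
    filter_upwards [ae_restrict_mem hD.isOpen.measurableSet,
      ae_restrict_of_ae (ae_lebesguePoint hD.dim_pos hD.isOpen H.locallyIntegrableOn)] with x hx hL
    exact hsup N h p H x hx (hL hx)
  have hintg : IntegrableOn h D := ⟨H.locallyIntegrableOn.aestronglyMeasurable,
    .restrict_of_bounded (C := C * N) hD.volume_lt_top hle⟩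
  have hbd : ∫ x in D, ‖h x‖ ≤ (C * volume.real D + 1) * N := by
    have h1 := norm_setIntegral_le_of_norm_le_const_ae (f := fun x => ‖h x‖) (C := C * N)
      hD.volume_lt_top (by simpa using hle)
    have h2 : ∫ x in D, ‖h x‖ ≤ C * N * volume.real D := (Real.le_norm_self _).trans h1
    nlinarith
  refine ⟨hintg, hbd, ?_⟩
  rw [← ofReal_integral_norm_eq_lintegral_enorm hintg]
  exact ENNReal.ofReal_le_ofReal hbd

/-- Write `h - P = (h - p y T) - (P - p y T)`. The first difference satisfies the Hölder bound; the
second is a polynomial varying at most linearly in `|x - y| / T ≤ 1`, hence also at most like its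
Hölder power. -/
lemma ConeDomain.exists_local_holder (hω : GoodModulus ω n q r Cω) (𝕜 : Type*) [RCLike 𝕜]
    (hD : ConeDomain D c ρ M) : ∃ C : ℝ, 0 < C ∧
    ∀ (N : ℝ) (h : Rn d → 𝕜) (p : Rn d → ℝ → MvPolynomial (Fin d) 𝕜),
      ApproxData ω n D c ρ N h p → ∀ (y : Rn d) (T : ℝ) (P : MvPolynomial (Fin d) 𝕜) (B : ℝ),
      0 < T → cube y T ⊆ D → P.totalDegree ≤ n → pnorm n T (shift y (P - p y T)) ≤ B →
      ∃ v : 𝕜, ∀ᵐ x, x ∈ Metric.ball y (T / 2) → ‖h x - polyFun P x - v‖ ≤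
        (C * N * ω T + B) * (T ^ holderExp r)⁻¹ * ‖y - x‖ ^ holderExp r := by
  have := nontrivial_of_dim_pos hD.dim_pos
  obtain ⟨C, hC, hhol⟩ := hω.exists_holder_bound 𝕜 d
  refine ⟨C, hC, fun N h p H y T P B hT hcub hP hB => ?_⟩
  obtain ⟨v, hv⟩ := hhol D N h p H.nonneg H.locallyIntegrableOn H.approx y T hT hcub
  have hdeg : (P - p y T).totalDegree ≤ n := (MvPolynomial.totalDegree_sub _ _).trans
    (max_le hP (H.approx y T hT (by rwa [one_mul])).1)
  refine ⟨v - polyFun (P - p y T) y, ?_⟩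
  filter_upwards [ae_lebesguePoint hD.dim_pos hD.isOpen H.locallyIntegrableOn,
    compl_mem_ae_iff.2 (measure_singleton y)] with x hL hxy hx
  have hxT : x ∈ cube y T := closedBall_subset_cube y T (Metric.ball_subset_closedBall hx)
  have h1 := hv x hxT (hL (hcub hxT)) hxy
  rw [Metric.mem_ball, dist_eq_norm] at hx
  set u := ‖x - y‖ / T with hu
  have hu0 : 0 ≤ u := by positivity
  have hu1 : u ≤ 1 := by rw [hu, div_le_one hT]; linarith
  have h2 := norm_polyFun_sub_le hdeg hT.le hu0 hu1 (a := y) (x := x) fun i => by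
    rw [hu, div_mul_cancel₀ _ hT.ne']
    exact abs_apply_le_norm (x - y) i
  have hε1 : holderExp r ≤ 1 := (min_le_right _ _).trans (by norm_num)
  have hε0 := hω.holderExp_pos
  have h3 : u ≤ u ^ holderExp r := by
    rcases hu0.eq_or_lt with h | h
    · rw [← h, Real.zero_rpow hε0.ne']
    · calc u = u ^ (1 : ℝ) := (Real.rpow_one u).symm
        _ ≤ _ := Real.rpow_le_rpow_of_exponent_ge h hu1 hε1
  have hB0 : 0 ≤ pnorm n T (shift y (P - p y T)) := pnorm_nonneg hT.le _
  have e1 : h x - polyFun P x - (v - polyFun (P - p y T) y) =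
      (h x - polyFun (p y T) x - v) - (polyFun (P - p y T) x - polyFun (P - p y T) y) := by
    simp only [polyFun_sub]
    ring
  have e2 : (T ^ holderExp r)⁻¹ * ‖y - x‖ ^ holderExp r = u ^ holderExp r := by
    rw [hu, Real.div_rpow (norm_nonneg _) hT.le, norm_sub_rev, div_eq_inv_mul]
  rw [e1, mul_assoc, e2]
  calc _ ≤ C * N * ω T * u ^ holderExp r + u * pnorm n T (shift y (P - p y T)) :=
        (norm_sub_le _ _).trans (add_le_add h1 h2)
    _ ≤ C * N * ω T * u ^ holderExp r + u ^ holderExp r * B := by gcongr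
    _ = _ := by ring

/-- The principal value of `h - P` at `y`, split into a small local part and the rest. -/
lemma ConeDomain.exists_local_pv (hω : GoodModulus ω n q r Cω) (hD : ConeDomain D c ρ M)
    (hΩ : IsCZSymbol k Ω) : ∃ C : ℝ, 0 < C ∧
    ∀ (N : ℝ) (h : Rn d → 𝕜) (p : Rn d → ℝ → MvPolynomial (Fin d) 𝕜),
      ApproxData ω n D c ρ N h p → ∀ (y : Rn d) (T : ℝ) (P : MvPolynomial (Fin d) 𝕜) (B : ℝ),
      0 < T → cube y T ⊆ D → P.totalDegree ≤ n → pnorm n T (shift y (P - p y T)) ≤ B →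
      ∃ u : 𝕜, ‖u‖ ≤ C * (N * ω T + B) ∧ HasPV Ω D (fun x => h x - polyFun P x) y
        (u + ∫ x in D \ Metric.ball y (T / 2), (h x - polyFun P x) * czKernel Ω (y - x)) := by
  obtain ⟨C₁, hC₁, hhol⟩ := hD.exists_local_holder hω 𝕜
  obtain ⟨C₂, hC₂, hnear⟩ := hΩ.exists_near_bound hD.dim_pos hω.holderExp_pos
  obtain ⟨C₃, hC₃, hintg⟩ := hD.exists_integral_bound hω 𝕜
  have hε := hω.holderExp_pos
  refine ⟨C₂ * (C₁ + 1), by positivity, fun N h p H y T P B hT hcub hP hB => ?_⟩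
  have hN := H.nonneg
  have hωT := hω.pos T hT
  have hB0 : 0 ≤ B := (pnorm_nonneg hT.le _).trans hB
  obtain ⟨v, hv⟩ := hhol N h p H y T P B hT hcub hP hB
  have hball : Metric.ball y (T / 2) ⊆ D :=
    (Metric.ball_subset_closedBall.trans (closedBall_subset_cube y T)).trans hcub
  have hI : IntegrableOn (fun x => h x - polyFun P x) D :=
    (hintg N h p H).1.sub (hD.integrableOn_continuous (continuous_polyFun P))
  have hA : 0 ≤ (C₁ * N * ω T + B) * (T ^ holderExp r)⁻¹ := by positivity
  refine ⟨_, ?_, hΩ.hasPV hD.dim_pos hD.isOpen.measurableSet hI (by positivity : 0 < T / 2) hball hε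
    hA hv⟩
  refine ((hnear y (T / 2) _ (fun x => h x - polyFun P x - v) (by positivity) hA ?_ hv).2).trans ?_
  · exact ((hI.mono_set hball).aestronglyMeasurable.sub aestronglyMeasurable_const)
  · have h1 : (T / 2) ^ holderExp r ≤ T ^ holderExp r :=
      Real.rpow_le_rpow (by positivity) (by linarith) hε.le
    calc _ ≤ C₂ * ((C₁ * N * ω T + B) * (T ^ holderExp r)⁻¹) * T ^ holderExp r := by gcongr
      _ = C₂ * (C₁ * (N * ω T) + B) := by field_simp
      _ ≤ C₂ * ((C₁ + 1) * (N * ω T) + (C₁ + 1) * B) := by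
          gcongr
          · linarith
          · nlinarith
      _ = _ := by ring

lemma shift_zero_sub_pnorm (y : Rn d) (T : ℝ) (P : MvPolynomial (Fin d) 𝕜) :
    pnorm n T (shift y (0 - P)) = pnorm n T (shift y P) := by
  have : shift y (0 - P) = -shift y P := by simp [shift]
  rw [this]
  simp [pnorm]

lemma ConeDomain.exists_hasPV (hω : GoodModulus ω n q r Cω) (hD : ConeDomain D c ρ M)
    (hΩ : IsCZSymbol k Ω) {N : ℝ} {h : Rn d → 𝕜} {p : Rn d → ℝ → MvPolynomial (Fin d) 𝕜}
    (H : ApproxData ω n D c ρ N h p) {y : Rn d} (hy : y ∈ D) : ∃ v, HasPV Ω D h y v := by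
  obtain ⟨C, -, hpv⟩ := hD.exists_local_pv hω hΩ
  obtain ⟨ε, hε, hball⟩ := Metric.isOpen_iff.1 hD.isOpen y hy
  have hd := hD.dim_pos'
  have hT : 0 < ε / d := by positivity
  have hcub : cube y (ε / d) ⊆ D := by
    refine (cube_subset_ball hD.dim_pos y hT).trans ?_
    rwa [mul_div_cancel₀ _ (by positivity)]
  obtain ⟨u, -, hu⟩ := hpv N h p H y (ε / d) 0 _ hT hcub (by simp) le_rfl
  exact ⟨_, hu.congr fun x _ => by simp⟩

/-- Bound for the operator on the core of the domain. -/
lemma ConeDomain.exists_core_bound (hω : GoodModulus ω n q r Cω) (hD : ConeDomain D c ρ M)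
    (hΩ : IsCZSymbol k Ω) : ∃ C : ℝ, 0 < C ∧
    ∀ (N : ℝ) (h : Rn d → 𝕜) (p : Rn d → ℝ → MvPolynomial (Fin d) 𝕜),
      ApproxData ω n D c ρ N h p → ∀ y ∈ core D c ρ, ‖restrictedCZ Ω D h y‖ ≤ C * N := by
  obtain ⟨C₁, hC₁, hpv⟩ := hD.exists_local_pv hω hΩ
  obtain ⟨C₂, hC₂, hco⟩ := hD.exists_coeff_bound hω 𝕜
  obtain ⟨C₃, hC₃, hintg⟩ := hD.exists_integral_bound hω 𝕜
  obtain ⟨CK, hCK, hK⟩ := hΩ.exists_bound hD.dim_pos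
  have hd := hD.dim_pos'
  have hc := hD.cone.c_pos
  have hρ := hD.cone.ρ_pos
  -- With this side the cube lies in the ball of radius `c ρ / 4`, inside `D` for every centre in
  -- the core.
  set T : ℝ := c * ρ / (4 * d) with hT_def
  have hT : 0 < T := by positivity
  have hωT := hω.pos T hT
  have hJ := one_le_logFactor ω n T
  set B₀ : ℝ := ∑ α ∈ multiIdx d n, C₂ * logFactor ω n T * T ^ α.degree with hB₀
  have hB₀0 : 0 ≤ B₀ := Finset.sum_nonneg fun α _ => by positivity
  refine ⟨C₁ * (ω T + B₀) + CK * ((T / 2) ^ d)⁻¹ * C₃, by positivity, fun N h p H y hy => ?_⟩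
  have hN := H.nonneg
  have hcub : cube y T ⊆ D := by
    refine (cube_subset_ball hD.dim_pos y hT).trans fun x hx => ?_
    by_contra hxD
    have h1 := hy x hxD
    rw [Metric.mem_ball, dist_comm, show d * T = c * ρ / 4 by rw [hT_def]; field_simp] at hx
    linarith
  obtain ⟨hI, hI1, -⟩ := hintg N h p H
  have hB : pnorm n T (shift y (0 - p y T)) ≤ B₀ * N := by
    rw [shift_zero_sub_pnorm, pnorm, hB₀, Finset.sum_mul]
    refine Finset.sum_le_sum fun α hα => ?_
    have hco' := hco N h p H y T hT hcub α
    rw [mul_right_comm]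
    gcongr
    rcases (mem_multiIdx.1 hα).lt_or_eq with hlt | heq
    · refine (hco'.1 hlt).trans ?_
      rw [mul_right_comm]
      exact le_mul_of_one_le_right (by positivity) hJ
    · exact (hco'.2 heq).trans_eq (by ring)
  obtain ⟨u, hu, hPV⟩ := hpv N h p H y T 0 _ hT hcub (by simp) hB
  have hyD : y ∈ D := hcub (self_mem_cube y hT.le)
  rw [(hPV.congr (g := h) fun x _ => by simp).restrictedCZ_eq hyD]
  have hrest : ‖∫ x in D \ Metric.ball y (T / 2), (h x - polyFun 0 x) * czKernel Ω (y - x)‖ ≤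
      CK * ((T / 2) ^ d)⁻¹ * (C₃ * N) := by
    calc _ ≤ ∫ x in D \ Metric.ball y (T / 2), CK * ((T / 2) ^ d)⁻¹ * ‖h x‖ := by
          refine norm_integral_le_of_norm_le
            ((hI.mono_set sdiff_subset).norm.const_mul _) ?_
          filter_upwards [ae_restrict_mem
            (MeasurableSet.diff hD.isOpen.measurableSet measurableSet_ball)] with x hx
          have h1 : T / 2 ≤ ‖y - x‖ := by
            rw [← dist_eq_norm, dist_comm]
            exact not_lt.1 hx.2
          rw [norm_mul, mul_comm]
          simp only [polyFun_zero, sub_zero]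
          gcongr
          exact (hK _).trans (by gcongr)
      _ = CK * ((T / 2) ^ d)⁻¹ * ∫ x in D \ Metric.ball y (T / 2), ‖h x‖ := integral_const_mul _ _
      _ ≤ CK * ((T / 2) ^ d)⁻¹ * ∫ x in D, ‖h x‖ := by
          refine mul_le_mul_of_nonneg_left ?_ (by positivity)
          exact setIntegral_mono_set hI.norm (Eventually.of_forall fun x => norm_nonneg _)
            sdiff_subset.eventuallyLE
      _ ≤ _ := by gcongr
  calc _ ≤ C₁ * (N * ω T + B₀ * N) + CK * ((T / 2) ^ d)⁻¹ * (C₃ * N) :=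
        (norm_add_le _ _).trans (add_le_add hu hrest)
    _ = _ := by ring

/-! ### From the norm to approximation data -/

/-- The strict inequality lets a competitor below `N` be selected from each infimum, which need not
be attained. -/
lemma exists_approxData (hω : GoodModulus ω n q r Cω) {N : ℝ} {f : Rn d → 𝕜}
    (hf : LocallyIntegrableOn f D) (hN : zygmundSeminorm ω n D f < ENNReal.ofReal N)
    (hcore : ∫⁻ x in core D c ρ, ‖f x‖ₑ ≤ ENNReal.ofReal N) :
    ∃ p, ApproxData ω n D c ρ N f p := by
  have hN0 : 0 < N := ENNReal.ofReal_pos.1 (zero_le.trans_lt hN)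
  have key : ∀ a ℓ, ∃ P : MvPolynomial (Fin d) 𝕜, 0 < ℓ → cube a (1 * ℓ) ⊆ D → P.totalDegree ≤ n ∧
      avgL1 (cube a ℓ) (fun y => f y - polyFun P y) ≤ ENNReal.ofReal (N * ω ℓ) := by
    intro a ℓ
    by_cases h : 0 < ℓ ∧ cube a ℓ ⊆ D
    · have h1 : ⨅ (P : MvPolynomial (Fin d) 𝕜) (_ : P.totalDegree ≤ n),
          avgL1 (cube a ℓ) (fun x => f x - polyFun P x) / ENNReal.ofReal (ω ℓ) <
          ENNReal.ofReal N := by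
        refine lt_of_le_of_lt ?_ hN
        exact le_iSup₂_of_le a ℓ (le_iSup₂_of_le h.1 h.2 le_rfl)
      obtain ⟨P, hP⟩ := iInf_lt_iff.1 h1
      obtain ⟨hdeg, hP⟩ := iInf_lt_iff.1 hP
      refine ⟨P, fun _ _ => ⟨hdeg, ?_⟩⟩
      rw [ENNReal.ofReal_mul hN0.le]
      exact (ENNReal.div_le_iff (by simpa using hω.pos ℓ h.1) ENNReal.ofReal_ne_top).1 hP.le
    · exact ⟨0, fun h1 h2 => absurd ⟨h1, by rwa [one_mul] at h2⟩ h⟩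
  choose p hp using key
  exact ⟨p, hN0.le, hf, hp, hcore⟩

/-- The core is compact in `D`, so local integrability alone makes the `L¹` norm there finite.
Integrability over all of `D` can then be deduced instead of assumed. -/
lemma MemZygmund.exists_approxData (hω : GoodModulus ω n q r Cω) (hD : ConeDomain D c ρ M)
    {f : Rn d → 𝕜} (hf : MemZygmund ω n D f) : ∃ N p, ApproxData ω n D c ρ N f p := by
  have h1 : ∫⁻ x in core D c ρ, ‖f x‖ₑ < ∞ :=
    (hf.1.integrableOn_compact_subset hD.core_subset hD.isCompact_core).2
  set s := zygmundSeminorm ω n D f + ∫⁻ x in core D c ρ, ‖f x‖ₑ with hs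
  have hs_top : s ≠ ∞ := (ENNReal.add_lt_top.2 ⟨hf.2, h1⟩).ne
  have hlt : s < ENNReal.ofReal (s.toReal + 1) := by
    rw [ENNReal.ofReal_add ENNReal.toReal_nonneg zero_le_one, ENNReal.ofReal_toReal hs_top]
    exact ENNReal.lt_add_right hs_top (by simp)
  exact ⟨_, ZygmundTP.exists_approxData hω hf.1 (le_self_add.trans_lt hlt)
    (le_add_self.trans hlt.le)⟩

lemma zygmundSeminorm_le {N : ℝ≥0∞} {f : Rn d → 𝕜}
    (h : ∀ a ℓ, 0 < ℓ → cube a ℓ ⊆ D → ∃ P : MvPolynomial (Fin d) 𝕜, P.totalDegree ≤ n ∧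
      avgL1 (cube a ℓ) (fun x => f x - polyFun P x) ≤ N * ENNReal.ofReal (ω ℓ)) :
    zygmundSeminorm ω n D f ≤ N := by
  refine iSup₂_le fun a ℓ => iSup₂_le fun hℓ hcub => ?_
  obtain ⟨P, hP, hle⟩ := h a ℓ hℓ hcub
  exact iInf₂_le_of_le P hP (ENNReal.div_le_of_le_mul hle)

lemma memZygmund_polyFun (hD : ConeDomain D c ρ M) {P : MvPolynomial (Fin d) 𝕜}
    (hP : P.totalDegree ≤ n) : MemZygmund ω n D (polyFun P) := by
  refine ⟨(hD.integrableOn_continuous (continuous_polyFun P)).locallyIntegrableOn, ?_⟩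
  refine lt_of_le_of_lt (zygmundSeminorm_le (N := 0) fun a ℓ _ _ => ⟨P, hP, ?_⟩) ENNReal.zero_lt_top
  simp [avgL1]

theorem ConeDomain.restrictedCZWellDefined (hω : GoodModulus ω n q r Cω) (hD : ConeDomain D c ρ M)
    (hΩ : IsCZSymbol k Ω) : RestrictedCZWellDefined ω n Ω D := by
  obtain ⟨C, -, hintg⟩ := hD.exists_integral_bound hω 𝕜
  intro f hf
  obtain ⟨N, p, H⟩ := hf.exists_approxData hω hD
  exact ⟨(hintg N f p H).1, fun y hy => hD.exists_hasPV hω hΩ H hy⟩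

end ZygmundPV

/-! ### The operator applied to the error of approximation -/

section ErrorTerm

variable {ω : ℝ → ℝ} {n : ℕ} {q r Cω : ℝ} {D : Set (Rn d)} {c ρ M : ℝ} {Ω : Rn d → 𝕜}

lemma one_add_rpow_mul_inv_pow_le {t L q : ℝ} (hL : 0 < L) (ht : L ≤ t) (hq : 0 < q) :
    (1 + t / L) ^ q * (t ^ (d + n + 1))⁻¹ ≤ 2 ^ q * (L ^ q)⁻¹ * t ^ (-(n + 1 - q) - d) := by
  have ht0 : 0 < t := hL.trans_le ht
  have h1 : 1 + t / L ≤ 2 * t / L := by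
    rw [le_div_iff₀ hL, add_mul, div_mul_cancel₀ _ hL.ne']
    linarith
  have e1 : (t ^ (d + n + 1))⁻¹ = t ^ (-((d + n + 1 : ℕ) : ℝ)) := by
    rw [Real.rpow_neg ht0.le, Real.rpow_natCast]
  calc _ ≤ (2 * t / L) ^ q * (t ^ (d + n + 1))⁻¹ := by gcongr
    _ = 2 ^ q * (L ^ q)⁻¹ * (t ^ q * t ^ (-((d + n + 1 : ℕ) : ℝ))) := by
        rw [e1, Real.div_rpow (by positivity) hL.le, Real.mul_rpow zero_le_two ht0.le]
        ring
    _ = _ := by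
        rw [← Real.rpow_add ht0]
        congr 2
        push_cast
        ring

/-- The weighted integral of a function of growth `q < n + 1` away from a cube. -/
lemma exists_far_integral_bound (hd : 0 < d) (hq0 : 0 < q) (hq : q < n + 1) : ∃ C : ℝ, 0 < C ∧
    ∀ (x₀ : Rn d) (L A : ℝ) (E : Set (Rn d)) (G : Rn d → 𝕜), 0 < L → 0 ≤ A → MeasurableSet E →
      (∀ x ∈ E, 2 * (d * L) ≤ ‖x₀ - x‖) →
      (∀ᵐ x, x ∈ E → ‖G x‖ ≤ A * (1 + ‖x₀ - x‖ / L) ^ q) →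
      (d * L) ^ (n + 1) * ∫ x in E, ‖G x‖ * (‖x₀ - x‖ ^ (d + n + 1))⁻¹ ≤ C * A := by
  have hsph := sphereConst_nonneg (d := d)
  have hd1 : (1 : ℝ) ≤ d := by exact_mod_cast hd
  set β : ℝ := n + 1 - q with hβ_def
  have hβ : 0 < β := by rw [hβ_def]; linarith
  refine ⟨d ^ (n + 1) * (2 ^ q * (sphereConst d / β)) + 1, by positivity,
    fun x₀ L A E G hL hA hE hfar hG => ?_⟩
  have hdL : 0 < d * L := by positivity
  have hsub : E ⊆ {x : Rn d | d * L < ‖x₀ - x‖} := fun x hx => by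
    have := hfar x hx
    show d * L < ‖x₀ - x‖
    linarith
  have hI : IntegrableOn (fun x => A * (2 ^ q * (L ^ q)⁻¹) * ‖x₀ - x‖ ^ (-β - d))
      {x : Rn d | d * L < ‖x₀ - x‖} := (integrableOn_compl_ball_rpow hd x₀ hβ hdL).const_mul _
  have h1 : ∫ x in E, ‖G x‖ * (‖x₀ - x‖ ^ (d + n + 1))⁻¹ ≤
      A * (2 ^ q * (L ^ q)⁻¹) * (sphereConst d / β * L ^ (-β)) := by
    calc _ ≤ ∫ x in E, A * (2 ^ q * (L ^ q)⁻¹) * ‖x₀ - x‖ ^ (-β - d) := by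
          refine integral_mono_of_nonneg (Eventually.of_forall fun x => by positivity)
            (hI.mono_set hsub) ?_
          filter_upwards [ae_restrict_mem hE, ae_restrict_of_ae hG] with x hx hGx
          have h2 : L ≤ ‖x₀ - x‖ := by
            have := hfar x hx
            nlinarith
          calc _ ≤ A * (1 + ‖x₀ - x‖ / L) ^ q * (‖x₀ - x‖ ^ (d + n + 1))⁻¹ := by
                gcongr
                exact hGx hx
            _ = A * ((1 + ‖x₀ - x‖ / L) ^ q * (‖x₀ - x‖ ^ (d + n + 1))⁻¹) := by ring
            _ ≤ A * (2 ^ q * (L ^ q)⁻¹ * ‖x₀ - x‖ ^ (-β - d)) :=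
                mul_le_mul_of_nonneg_left (one_add_rpow_mul_inv_pow_le hL h2 hq0) hA
            _ = _ := by ring
      _ ≤ ∫ x in {x : Rn d | d * L < ‖x₀ - x‖}, A * (2 ^ q * (L ^ q)⁻¹) * ‖x₀ - x‖ ^ (-β - d) :=
          setIntegral_mono_set hI (Eventually.of_forall fun x => by positivity) hsub.eventuallyLE
      _ = A * (2 ^ q * (L ^ q)⁻¹) * (sphereConst d / β * (d * L) ^ (-β)) := by
          rw [integral_const_mul, integral_compl_ball_rpow hd x₀ hβ hdL]
      _ ≤ _ := by
          have hle : (d * L) ^ (-β) ≤ L ^ (-β) :=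
            Real.rpow_le_rpow_of_nonpos hL (le_mul_of_one_le_left hL.le hd1) (by linarith)
          gcongr
  have e1 : L ^ (n + 1) * (L ^ q)⁻¹ * L ^ (-β) = 1 := by
    rw [← Real.rpow_natCast, ← Real.rpow_neg hL.le, ← Real.rpow_add hL, ← Real.rpow_add hL, hβ_def]
    push_cast
    rw [show (n : ℝ) + 1 + -q + -(n + 1 - q) = 0 by ring, Real.rpow_zero]
  calc _ ≤ (d * L) ^ (n + 1) * (A * (2 ^ q * (L ^ q)⁻¹) * (sphereConst d / β * L ^ (-β))) := by
        gcongr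
    _ = d ^ (n + 1) * (2 ^ q * (sphereConst d / β)) * A *
          (L ^ (n + 1) * (L ^ q)⁻¹ * L ^ (-β)) := by
        rw [mul_pow]
        ring
    _ ≤ _ := by
        rw [e1, mul_one]
        gcongr
        linarith

/-- On the half of a cube, the operator applied to the error of approximation is close to a
polynomial. -/
lemma ConeDomain.exists_error_approx (hω : GoodModulus ω n q r Cω) (hD : ConeDomain D c ρ M)
    (hΩ : IsCZSymbol (n + 1) Ω) : ∃ C : ℝ, 0 < C ∧
    ∀ (N : ℝ) (h : Rn d → 𝕜) (p : Rn d → ℝ → MvPolynomial (Fin d) 𝕜),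
      ApproxData ω n D c ρ N h p → ∀ (x₀ : Rn d) (L : ℝ), 0 < L → cube x₀ L ⊆ D →
      ∃ S : MvPolynomial (Fin d) 𝕜, S.totalDegree ≤ n ∧ ∀ y ∈ cube x₀ (L / 2), ∃ u : 𝕜,
        HasPV Ω D (fun x => h x - polyFun (p x₀ L) x) y u ∧ ‖u - polyFun S y‖ ≤ C * N * ω L := by
  have := nontrivial_of_dim_pos hD.dim_pos
  have hd := hD.dim_pos'
  have hq := hω.q_pos
  have hDm := hD.isOpen.measurableSet
  obtain ⟨C₁, hC₁, hgrow⟩ := hD.exists_growth_bound hω 𝕜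
  obtain ⟨C₂, hC₂, hfarf⟩ := hΩ.exists_far_field hD.dim_pos
  obtain ⟨C₃, hC₃, hpv⟩ := hD.exists_local_pv hω hΩ
  obtain ⟨C₄, hC₄, hnest⟩ := hω.exists_nested_bound 𝕜 d (κ := 2) one_le_two
  obtain ⟨C₅, hC₅, hshift⟩ := exists_pnorm_shift_le 𝕜 d n
  obtain ⟨C₆, hC₆, hintg⟩ := hD.exists_integral_bound hω 𝕜
  obtain ⟨C₇, hC₇, hfari⟩ := exists_far_integral_bound (𝕜 := 𝕜) (n := n) hD.dim_pos hq hω.q_lt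
  obtain ⟨CK, hCK, hK⟩ := hΩ.exists_bound hD.dim_pos
  set V : ℝ := (volume : Measure (Rn d)).real (Metric.ball 0 1) with hV
  refine ⟨C₃ * (1 + C₅ * C₄) + C₁ * (1 + 2 * d) ^ q * CK * ((8 * d) ^ d * V) + C₂ * (C₇ * C₁),
    by positivity, fun N h p H x₀ L hL hcub => ?_⟩
  have hN := H.nonneg
  have hωL := hω.pos L hL
  have hP := (H.approx x₀ L hL (by rwa [one_mul])).1
  set P := p x₀ L with hP_def
  have hgI : IntegrableOn (fun x => h x - polyFun P x) D :=
    (hintg N h p H).1.sub (hD.integrableOn_continuous (continuous_polyFun P))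
  have hg : ∀ᵐ x, x ∈ D → ‖h x - polyFun P x‖ ≤ C₁ * N * ω L * (1 + ‖x₀ - x‖ / L) ^ q := by
    filter_upwards [ae_lebesguePoint hD.dim_pos hD.isOpen H.locallyIntegrableOn] with x hLx hx
    rw [norm_sub_rev x₀]
    exact hgrow N h p H x₀ L hL hcub x hx (hLx hx)
  -- The far region depends on the cube alone, so its potential is approximated by a single
  -- polynomial `S` for all `y`.
  set E : Set (Rn d) := D \ Metric.ball x₀ (2 * (d * L)) with hE
  have hEm : MeasurableSet E := MeasurableSet.diff hDm measurableSet_ball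
  have hdL : 0 < d * L := by positivity
  have hEfar : ∀ x ∈ E, 2 * (d * L) ≤ ‖x₀ - x‖ := fun x hx => by
    rw [← dist_eq_norm, dist_comm]
    exact not_lt.1 hx.2
  obtain ⟨S, hS, hSy⟩ := hfarf x₀ (d * L) E (fun x => h x - polyFun P x) hdL hEm
    (hgI.mono_set sdiff_subset) hEfar
  refine ⟨S, hS, fun y hy => ?_⟩
  have hyx : ‖y - x₀‖ ≤ d * (L / 4) := by
    have := cube_subset_closedBall x₀ (by positivity) hy
    rw [Metric.mem_closedBall, dist_eq_norm] at this
    exact this.trans_eq (by ring)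
  have hycub : cube y (L / 2) ⊆ cube x₀ L := cube_subset_cube fun i => (hy i).trans_eq (by ring)
  -- the local part
  have hB : pnorm n (L / 2) (shift y (P - p y (L / 2))) ≤ C₅ * C₄ * (N * ω L) := by
    have hdeg : (P - p y (L / 2)).totalDegree ≤ n := (MvPolynomial.totalDegree_sub _ _).trans
      (max_le hP (H.approx y (L / 2) (by positivity) (by
        rw [one_mul]; exact hycub.trans hcub)).1)
    have h1 := hnest D N h p H.nonneg H.locallyIntegrableOn H.approx x₀ L y (L / 2) hL (by positivity)
      (by linarith) hcub hycub (by linarith)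
    have h2 := hshift (P - p y (L / 2)) hdeg y x₀ L 1 hL le_rfl fun i =>
      (hy i).trans (by linarith)
    calc _ ≤ pnorm n L (shift y (P - p y (L / 2))) :=
          pnorm_le_of_le (by positivity) (by linarith) _
      _ ≤ C₅ * 1 ^ n * pnorm n L (shift x₀ (P - p y (L / 2))) := h2
      _ ≤ C₅ * 1 ^ n * (C₄ * N * ω L) := by gcongr
      _ = _ := by rw [one_pow]; ring
  obtain ⟨u, hu, hPV⟩ := hpv N h p H y (L / 2) P _ (by positivity) (hycub.trans hcub) hP hB
  refine ⟨_, hPV, ?_⟩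
  rw [show L / 2 / 2 = L / 4 by ring]
  -- the intermediate part
  set A : Set (Rn d) := (D ∩ Metric.ball x₀ (2 * (d * L))) \ Metric.ball y (L / 4) with hA
  have hAm : MeasurableSet A := MeasurableSet.diff (hDm.inter measurableSet_ball) measurableSet_ball
  have hballsub : Metric.ball y (L / 4) ⊆ Metric.ball x₀ (2 * (d * L)) := by
    refine Metric.ball_subset_ball' ?_
    rw [dist_eq_norm]
    nlinarith
  have hunion : D \ Metric.ball y (L / 4) = A ∪ E := by
    ext x
    by_cases h1 : x ∈ Metric.ball x₀ (2 * (d * L))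
    · simp only [hA, hE, Set.mem_sdiff, mem_union, mem_inter_iff, h1]
      tauto
    · have h2 : x ∉ Metric.ball y (L / 4) := fun h2 => h1 (hballsub h2)
      simp only [hA, hE, Set.mem_sdiff, mem_union, mem_inter_iff, h1, h2]
      tauto
  have hdisj : Disjoint A E := by
    rw [Set.disjoint_left]
    exact fun x hx hx' => hx'.2 hx.1.2
  have hrest : IntegrableOn (fun x => (h x - polyFun P x) * czKernel Ω (y - x))
      (D \ Metric.ball y (L / 4)) :=
    hΩ.integrableOn_mul_kernel hD.dim_pos (MeasurableSet.diff hDm measurableSet_ball)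
      (hgI.mono_set sdiff_subset) (R := L / 4) (by positivity) fun x hx => by
        rw [← dist_eq_norm, dist_comm]
        exact not_lt.1 hx.2
  rw [hunion] at hrest ⊢
  rw [setIntegral_union hdisj hEm (hrest.mono_set subset_union_left)
    (hrest.mono_set subset_union_right)]
  have hAint : ‖∫ x in A, (h x - polyFun P x) * czKernel Ω (y - x)‖ ≤
      C₁ * (1 + 2 * d) ^ q * CK * ((8 * d) ^ d * V) * (N * ω L) := by
    have hvol : volume.real A ≤ (2 * (d * L)) ^ d * V := by
      have h1 : volume.real A ≤ volume.real (Metric.ball x₀ (2 * (d * L))) :=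
        measureReal_mono (fun x hx => hx.1.2) (by finiteness)
      refine h1.trans_eq ?_
      rw [measureReal_def, Measure.addHaar_ball _ _ (by positivity), ENNReal.toReal_mul,
        ENNReal.toReal_ofReal (by positivity), finrank_euclideanSpace_fin, hV, measureReal_def]
    have h2 := norm_setIntegral_le_of_norm_le_const_ae (μ := volume) (s := A)
      (f := fun x => (h x - polyFun P x) * czKernel Ω (y - x))
      (C := C₁ * N * ω L * (1 + 2 * d) ^ q * (CK * ((L / 4) ^ d)⁻¹))
      ((measure_mono fun x hx => hx.1.1).trans_lt hD.volume_lt_top) (by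
        filter_upwards [ae_restrict_mem hAm, ae_restrict_of_ae hg] with x hx hgx
        have hx1 : ‖x₀ - x‖ / L ≤ 2 * d := by
          rw [div_le_iff₀ hL, ← dist_eq_norm, dist_comm, mul_assoc]
          exact (Metric.mem_ball.1 hx.1.2).le
        have hx2 : L / 4 ≤ ‖y - x‖ := by
          rw [← dist_eq_norm, dist_comm]
          exact not_lt.1 hx.2
        rw [norm_mul]
        gcongr
        · exact (hgx hx.1.1).trans (by gcongr)
        · exact (hK _).trans (by gcongr))
    calc _ ≤ _ := h2
      _ ≤ C₁ * N * ω L * (1 + 2 * d) ^ q * (CK * ((L / 4) ^ d)⁻¹) * ((2 * (d * L)) ^ d * V) := by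
          gcongr
      _ = C₁ * N * ω L * (1 + 2 * d) ^ q * CK * V * (((L / 4) ^ d)⁻¹ * (2 * (d * L)) ^ d) := by ring
      _ = _ := by
          rw [← inv_pow, ← mul_pow, show (L / 4)⁻¹ * (2 * (d * L)) = 8 * d by field_simp; norm_num]
          ring
  have hEint : ‖(∫ x in E, (h x - polyFun P x) * czKernel Ω (y - x)) - polyFun S y‖ ≤
      C₂ * (C₇ * C₁) * (N * ω L) := by
    have h1 := hSy y (hyx.trans (by nlinarith))
    have h2 := hfari x₀ L (C₁ * N * ω L) E (fun x => h x - polyFun P x) hL (by positivity) hEm hEfar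
      (by filter_upwards [hg] with x hgx hx using hgx hx.1)
    calc _ ≤ _ := h1
      _ = C₂ * ((d * L) ^ (n + 1) *
            ∫ x in E, ‖h x - polyFun P x‖ * (‖x₀ - x‖ ^ (d + n + 1))⁻¹) := by ring
      _ ≤ C₂ * (C₇ * (C₁ * N * ω L)) := by gcongr
      _ = _ := by ring
  have hωle : ω (L / 2) ≤ ω L := hω.mono (by positivity) (by linarith)
  calc _ = ‖u + (∫ x in A, (h x - polyFun P x) * czKernel Ω (y - x)) +
        ((∫ x in E, (h x - polyFun P x) * czKernel Ω (y - x)) - polyFun S y)‖ := by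
        congr 1
        ring
    _ ≤ C₃ * (N * ω L + C₅ * C₄ * (N * ω L)) +
        C₁ * (1 + 2 * d) ^ q * CK * ((8 * d) ^ d * V) * (N * ω L) +
        C₂ * (C₇ * C₁) * (N * ω L) := by
        refine (norm_add₃_le).trans (add_le_add_three (hu.trans ?_) hAint hEint)
        gcongr
    _ = _ := by ring

end ErrorTerm

/-! ### Sufficiency -/

section Sufficiency

variable {ω : ℝ → ℝ} {n : ℕ} {q r Cω : ℝ} {D : Set (Rn d)} {c ρ M : ℝ} {Ω : Rn d → 𝕜}

lemma HasPV.sum {k : ℕ} (hΩ : IsCZSymbol k Ω) (hd : 0 < d) (hD : MeasurableSet D) {ι : Type*}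
    (s : Finset ι) {f : ι → Rn d → 𝕜} {v : ι → 𝕜} {y : Rn d} (hf : ∀ i ∈ s, IntegrableOn (f i) D)
    (h : ∀ i ∈ s, HasPV Ω D (f i) y (v i)) :
    HasPV Ω D (fun x => ∑ i ∈ s, f i x) y (∑ i ∈ s, v i) := by
  refine (tendsto_finsetSum s h).congr' ?_
  filter_upwards [self_mem_nhdsWithin] with ε hε
  simp only [czTruncated_indicator hD, Finset.sum_mul]
  exact (integral_finsetSum _ fun i hi => hΩ.integrableOn_truncated hd hD (hf i hi) y hε).symm

lemma ConeDomain.hasPV_polyFun (hω : GoodModulus ω n q r Cω) (hD : ConeDomain D c ρ M) {k : ℕ}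
    (hΩ : IsCZSymbol k Ω) {P : MvPolynomial (Fin d) 𝕜} (hP : P.totalDegree ≤ n) {y : Rn d}
    (hy : y ∈ D) : HasPV Ω D (polyFun P) y (restrictedCZ Ω D (polyFun P) y) := by
  obtain ⟨v, hv⟩ := (hD.restrictedCZWellDefined hω hΩ (polyFun P) (memZygmund_polyFun hD hP)).2 y hy
  rw [HasPV.restrictedCZ_eq hv hy]
  exact hv

lemma ConeDomain.aestronglyMeasurable_restrictedCZ_polyFun (hω : GoodModulus ω n q r Cω)
    (hD : ConeDomain D c ρ M) {k : ℕ} (hΩ : IsCZSymbol k Ω) {P : MvPolynomial (Fin d) 𝕜}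
    (hP : P.totalDegree ≤ n) : AEStronglyMeasurable (restrictedCZ Ω D (polyFun P)) :=
  hΩ.aestronglyMeasurable_restrictedCZ hD.isOpen.measurableSet
    (hD.integrableOn_continuous (continuous_polyFun P))
    fun _ hy => ⟨_, hD.hasPV_polyFun hω hΩ hP hy⟩

/-- Uniform approximation of the images of polynomials. -/
lemma ConeDomain.exists_polyFun_approx (hω : GoodModulus ω n q r Cω) (hD : ConeDomain D c ρ M)
    {k : ℕ} (hΩ : IsCZSymbol k Ω) (h1 : ∀ P : MvPolynomial (Fin d) 𝕜, P.totalDegree ≤ n →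
      MemZygmund ω n D (restrictedCZ Ω D (polyFun P))) : ∃ C : ℝ, 0 < C ∧
    ∀ P : MvPolynomial (Fin d) 𝕜, P.totalDegree ≤ n → ∀ (a : Rn d) (ℓ : ℝ), 0 < ℓ → cube a ℓ ⊆ D →
      ∃ S : MvPolynomial (Fin d) 𝕜, S.totalDegree ≤ n ∧
        avgL1 (cube a ℓ) (fun x => restrictedCZ Ω D (polyFun P) x - polyFun S x) ≤
          ENNReal.ofReal (C * pnorm n 1 P * ω ℓ) := by
  have hdeg : ∀ α ∈ multiIdx d n, (MvPolynomial.monomial α (1 : 𝕜)).totalDegree ≤ n := by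
    intro α hα
    rw [MvPolynomial.totalDegree_monomial _ one_ne_zero, Finsupp.sum_fintype _ _ (by simp),
      ← Finsupp.degree_eq_sum]
    exact mem_multiIdx.1 hα
  -- By linearity finitely many monomials suffice, and the finitely many constants of condition (i)
  -- add up to a uniform one.
  have hex : ∀ α, ∃ N p, α ∈ multiIdx d n → ApproxData ω n D c ρ N
      (restrictedCZ Ω D (polyFun (MvPolynomial.monomial α (1 : 𝕜)))) p := by
    intro α
    by_cases hα : α ∈ multiIdx d n
    · obtain ⟨N, p, H⟩ := (h1 _ (hdeg α hα)).exists_approxData hω hD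
      exact ⟨N, p, fun _ => H⟩
    · exact ⟨0, fun _ _ => 0, fun h => absurd h hα⟩
  choose N p H using hex
  have hN : ∀ α ∈ multiIdx d n, 0 ≤ N α := fun α hα => (H α hα).nonneg
  refine ⟨1 + ∑ α ∈ multiIdx d n, N α, by
    have := Finset.sum_nonneg hN
    linarith, fun P hP a ℓ hℓ hcub => ?_⟩
  have hωℓ := hω.pos ℓ hℓ
  have hcub' : cube a (1 * ℓ) ⊆ D := by rwa [one_mul]
  have hpn := pnorm_nonneg (n := n) zero_le_one P
  refine ⟨∑ α ∈ multiIdx d n, MvPolynomial.C (P.coeff α) * p α a ℓ, ?_, ?_⟩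
  · refine MvPolynomial.totalDegree_finsetSum_le fun α hα => ?_
    refine (MvPolynomial.totalDegree_mul _ _).trans ?_
    rw [MvPolynomial.totalDegree_C, zero_add]
    exact ((H α hα).approx a ℓ hℓ hcub').1
  · have hT : ∀ x ∈ cube a ℓ, restrictedCZ Ω D (polyFun P) x -
        polyFun (∑ α ∈ multiIdx d n, MvPolynomial.C (P.coeff α) * p α a ℓ) x =
        ∑ α ∈ multiIdx d n, P.coeff α *
          (restrictedCZ Ω D (polyFun (MvPolynomial.monomial α 1)) x - polyFun (p α a ℓ) x) := by
      intro x hx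
      have hxD := hcub hx
      have hpv := HasPV.sum (f := fun α x => P.coeff α * polyFun (MvPolynomial.monomial α 1) x)
        hΩ hD.dim_pos hD.isOpen.measurableSet (multiIdx d n)
        (fun α _ => (hD.integrableOn_continuous (continuous_polyFun _)).const_mul _)
        fun α hα => (hD.hasPV_polyFun hω hΩ (hdeg α hα) hxD).const_mul hD.isOpen.measurableSet
          (P.coeff α)
      rw [(hpv.congr (g := polyFun P) fun z _ => by
        rw [polyFun_eq_sum hP]
        simp [polyFun_monomial]).restrictedCZ_eq hxD, polyFun_sum, ← Finset.sum_sub_distrib]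
      simp only [polyFun_C_mul, mul_sub]
    rw [avgL1_congr (measurableSet_cube a ℓ) hT]
    refine (avgL1_sum_le _ fun α hα => ?_).trans ?_
    · exact (((hD.aestronglyMeasurable_restrictedCZ_polyFun hω hΩ (hdeg α hα)).restrict).sub
        (continuous_polyFun _).aestronglyMeasurable).const_mul _
    · calc _ ≤ ∑ α ∈ multiIdx d n, ENNReal.ofReal (pnorm n 1 P * (N α * ω ℓ)) := by
            refine Finset.sum_le_sum fun α hα => ?_
            have hc : ‖P.coeff α‖ ≤ pnorm n 1 P := by
              simpa using norm_coeff_mul_le_pnorm zero_le_one P (mem_multiIdx.1 hα)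
            rw [avgL1_const_mul, ENNReal.ofReal_mul hpn, ← ofReal_norm]
            exact mul_le_mul' (ENNReal.ofReal_le_ofReal hc) ((H α hα).approx a ℓ hℓ hcub').2
        _ = ENNReal.ofReal (∑ α ∈ multiIdx d n, pnorm n 1 P * (N α * ω ℓ)) :=
            (ENNReal.ofReal_sum_of_nonneg fun α hα => by
              have := hN α hα
              positivity).symm
        _ ≤ _ := by
            refine ENNReal.ofReal_le_ofReal ?_
            rw [← Finset.mul_sum, ← Finset.sum_mul]
            have : 0 ≤ pnorm n 1 P * ω ℓ := by positivity
            linarith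

lemma shift_zero (P : MvPolynomial (Fin d) 𝕜) : shift 0 P = P :=
  polyFun_injective isOpen_univ univ_nonempty fun x _ => by simp [polyFun_shift]

/-- Splitting a polynomial into its homogeneous part of degree `n` about `a` and a remainder with
controlled coefficients. -/
lemma exists_split (𝕜 : Type*) [RCLike 𝕜] (d n : ℕ) {κ M : ℝ} (hκ : 1 ≤ κ) (hM : 1 ≤ M) :
    ∃ C : ℝ, 0 < C ∧
    ∀ (a : Rn d) (P : MvPolynomial (Fin d) 𝕜) (A B : ℝ), ‖a‖ ≤ κ → P.totalDegree ≤ n → 0 ≤ A →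
      0 ≤ B → (∀ α : Fin d →₀ ℕ, α.degree < n → ‖(shift a P).coeff α‖ ≤ A) →
      (∀ α : Fin d →₀ ℕ, α.degree = n → ‖(shift a P).coeff α‖ ≤ B) →
      ∃ H L : MvPolynomial (Fin d) 𝕜, H.IsHomogeneous n ∧ L.totalDegree ≤ n ∧
        (∀ x, polyFun P x = polyFun H (x - a) + polyFun L x) ∧ pnorm n 1 L ≤ C * A ∧
        ∀ x, ‖x - a‖ ≤ M → ‖polyFun H (x - a)‖ ≤ C * B := by
  obtain ⟨C₁, hC₁, hshift⟩ := exists_pnorm_shift_le 𝕜 d n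
  obtain ⟨m, hm⟩ : ∃ m : ℝ, m = ((multiIdx d n).card : ℝ) := ⟨_, rfl⟩
  have hm0 : 0 ≤ m := by rw [hm]; positivity
  refine ⟨C₁ * κ ^ n * m + m * M ^ n + 1, by positivity, fun a P A B ha hP hA hB h1 h2 => ?_⟩
  set Q := shift a P with hQ
  have hQdeg : Q.totalDegree ≤ n := (totalDegree_shift_le a P).trans hP
  -- The degree-`n` part about `a` carries the large coefficients. The rest is translated back to
  -- the origin, which costs only a constant since `a` ranges over a bounded set.
  set H := MvPolynomial.homogeneousComponent n Q with hH
  have hHh : H.IsHomogeneous n := MvPolynomial.homogeneousComponent_isHomogeneous n Q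
  have hHc : ∀ α : Fin d →₀ ℕ, H.coeff α = if α.degree = n then Q.coeff α else 0 :=
    fun α => MvPolynomial.coeff_homogeneousComponent n Q α
  have hdegL : (Q - H).totalDegree ≤ n :=
    (MvPolynomial.totalDegree_sub _ _).trans (max_le hQdeg hHh.totalDegree_le)
  refine ⟨H, shift (-a) (Q - H), hHh, (totalDegree_shift_le _ _).trans hdegL, fun x => ?_, ?_, ?_⟩
  · rw [polyFun_shift, polyFun_sub, hQ, polyFun_shift, ← sub_eq_add_neg, sub_add_cancel]
    ring
  · have e1 : shift a (shift (-a) (Q - H)) = Q - H := by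
      rw [shift_shift, add_neg_cancel, shift_zero]
    have h3 := hshift (shift (-a) (Q - H)) ((totalDegree_shift_le _ _).trans hdegL) 0 a 1 κ one_pos
      hκ fun i => by
        rw [mul_one, PiLp.zero_apply, zero_sub, abs_neg]
        exact (abs_apply_le_norm a i).trans ha
    rw [shift_zero, e1] at h3
    have h4 : pnorm n 1 (Q - H) ≤ m * A := by
      rw [pnorm, hm, ← nsmul_eq_mul]
      refine Finset.sum_le_card_nsmul _ _ _ fun α hα => ?_
      rw [one_pow, mul_one, MvPolynomial.coeff_sub, hHc]
      rcases (mem_multiIdx.1 hα).lt_or_eq with hlt | heq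
      · rw [if_neg hlt.ne, sub_zero]
        exact h1 α hlt
      · rw [if_pos heq, sub_self, norm_zero]
        exact hA
    calc _ ≤ _ := h3
      _ ≤ C₁ * κ ^ n * (m * A) := by gcongr
      _ ≤ _ := by
          have : 0 ≤ (m * M ^ n + 1) * A := by positivity
          linarith
  · intro x hx
    rw [polyFun_eq_sum hHh.totalDegree_le]
    refine (norm_sum_le _ _).trans ?_
    have h5 : ∑ α ∈ multiIdx d n, ‖H.coeff α * mono 𝕜 α (x - a)‖ ≤ m * (B * M ^ n) := by
      rw [hm, ← nsmul_eq_mul]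
      refine Finset.sum_le_card_nsmul _ _ _ fun α hα => ?_
      rw [hHc]
      split_ifs with heq
      · rw [norm_mul]
        have h6 : ‖mono 𝕜 α (x - a)‖ ≤ M ^ n := by
          rw [← heq]
          exact norm_mono_le fun i => (abs_apply_le_norm (x - a) i).trans hx
        gcongr
        exact h2 α heq
      · rw [zero_mul, norm_zero]
        positivity
    have : 0 ≤ (C₁ * κ ^ n * m + 1) * B := by positivity
    calc _ ≤ _ := h5
      _ ≤ _ := by linarith

lemma GoodModulus.logFactor_anti (hω : GoodModulus ω n q r Cω) {s t : ℝ} (hs : 0 < s) (hst : s ≤ t) :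
    logFactor ω n t ≤ logFactor ω n s :=
  max_le_max le_rfl (hω.integral_mono_left hs hst one_pos (n + 1))

/-- Approximation of the image of a function of the Zygmund class on the halves of cubes. -/
lemma ConeDomain.exists_image_approx (hω : GoodModulus ω n q r Cω) (hD : ConeDomain D c ρ M)
    (hΩ : IsCZSymbol (n + 1) Ω) (h1 : ∀ P : MvPolynomial (Fin d) 𝕜, P.totalDegree ≤ n →
      MemZygmund ω n D (restrictedCZ Ω D (polyFun P)))
    {C₀ : ℝ≥0} (h2 : ∀ (x₀ : Rn d) (ℓ : ℝ), 0 < ℓ → cube x₀ ℓ ⊆ D →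
      ∀ H : MvPolynomial (Fin d) 𝕜, H.IsHomogeneous n →
        ∃ S : MvPolynomial (Fin d) 𝕜, S.totalDegree ≤ n ∧
          avgL1 (cube x₀ ℓ)
              (fun x => restrictedCZ Ω D (fun z => polyFun H (z - x₀)) x - polyFun S x)
            ≤ C₀ * (⨆ x ∈ D, ‖polyFun H (x - x₀)‖ₑ) * ENNReal.ofReal (assocModulus ω n ℓ)) :
    ∃ C : ℝ, 0 < C ∧
    ∀ (N : ℝ) (h : Rn d → 𝕜) (p : Rn d → ℝ → MvPolynomial (Fin d) 𝕜),
      ApproxData ω n D c ρ N h p → ∀ (x₀ : Rn d) (ℓ : ℝ), 0 < ℓ → cube x₀ (2 * ℓ) ⊆ D →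
      ∃ S : MvPolynomial (Fin d) 𝕜, S.totalDegree ≤ n ∧
        avgL1 (cube x₀ ℓ) (fun x => restrictedCZ Ω D h x - polyFun S x) ≤
          ENNReal.ofReal (C * N * ω ℓ) := by
  obtain ⟨C₁, hC₁, herr⟩ := hD.exists_error_approx hω hΩ
  obtain ⟨C₂, hC₂, hco⟩ := hD.exists_coeff_bound hω 𝕜
  obtain ⟨C₃, hC₃, hpoly⟩ := hD.exists_polyFun_approx hω hΩ h1
  obtain ⟨κ₀, hκ₀⟩ := hD.isBounded.exists_norm_le
  obtain ⟨C₄, hC₄, hsplit⟩ := exists_split 𝕜 d n (le_max_left 1 κ₀) hD.one_le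
  obtain ⟨C₅, hC₅, hintg⟩ := hD.exists_integral_bound hω 𝕜
  have hCω := hω.const_pos
  refine ⟨C₀ * (C₄ * C₂) + C₃ * (C₄ * C₂) + C₁ * (Cω * 2 ^ q), by positivity,
    fun N h p H x₀ ℓ hℓ hcub => ?_⟩
  have hN := H.nonneg
  have hωℓ := hω.pos ℓ hℓ
  have h2ℓ : 0 < 2 * ℓ := by positivity
  have hcubℓ : cube x₀ ℓ ⊆ D := (cube_subset_cube_self x₀ (by linarith)).trans hcub
  have hx₀ : x₀ ∈ D := hcubℓ (self_mem_cube x₀ hℓ.le)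
  have hP := (H.approx x₀ (2 * ℓ) h2ℓ (by rwa [one_mul])).1
  set P := p x₀ (2 * ℓ) with hP_def
  have hJ0 : 0 < logFactor ω n ℓ := one_pos.trans_le (one_le_logFactor ω n ℓ)
  have hJ2 : 0 < logFactor ω n (2 * ℓ) := one_pos.trans_le (one_le_logFactor ω n _)
  -- `T` is of the size of the logarithmic factor and goes to condition (ii), `L` is bounded and
  -- goes to condition (i).
  obtain ⟨T, L, hT, hL, hsum, hLn, hTn⟩ := hsplit x₀ P (C₂ * N) (C₂ * N * logFactor ω n (2 * ℓ))
    ((hκ₀ x₀ hx₀).trans (le_max_right _ _)) hP (by positivity) (by positivity)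
    (fun α hα => (hco N h p H x₀ (2 * ℓ) h2ℓ hcub α).1 hα)
    (fun α hα => (hco N h p H x₀ (2 * ℓ) h2ℓ hcub α).2 hα)
  obtain ⟨S₁, hS₁, hS₁a⟩ := h2 x₀ ℓ hℓ hcubℓ T hT
  obtain ⟨S₂, hS₂, hS₂a⟩ := hpoly L hL x₀ ℓ hℓ hcubℓ
  -- The error estimate holds on half of a cube; it is applied to the double of the given one.
  obtain ⟨S₃, hS₃, hS₃a⟩ := herr N h p H x₀ (2 * ℓ) h2ℓ hcub
  rw [show 2 * ℓ / 2 = ℓ by ring] at hS₃a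
  have hTs : (fun z => polyFun T (z - x₀)) = polyFun (shift (-x₀) T) := by
    ext z
    rw [polyFun_shift, sub_eq_add_neg]
  have hTdeg : (shift (-x₀) T).totalDegree ≤ n := (totalDegree_shift_le _ _).trans hT.totalDegree_le
  rw [hTs] at hS₁a
  refine ⟨S₁ + S₂ + S₃, (MvPolynomial.totalDegree_add _ _).trans
    (max_le ((MvPolynomial.totalDegree_add _ _).trans (max_le hS₁ hS₂)) hS₃), ?_⟩
  set g : Rn d → 𝕜 := fun x => h x - polyFun P x with hg
  have hDm := hD.isOpen.measurableSet
  have hgI : IntegrableOn g D :=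
    (hintg N h p H).1.sub (hD.integrableOn_continuous (continuous_polyFun P))
  have hsplitT : ∀ x ∈ cube x₀ ℓ, restrictedCZ Ω D h x - polyFun (S₁ + S₂ + S₃) x =
      (restrictedCZ Ω D (polyFun (shift (-x₀) T)) x - polyFun S₁ x) +
      ((restrictedCZ Ω D (polyFun L) x - polyFun S₂ x) +
        (restrictedCZ Ω D g x - polyFun S₃ x)) := by
    intro x hx
    have hxD := hcubℓ hx
    obtain ⟨u, hu, -⟩ := hS₃a x hx
    have hu' : HasPV Ω D g x (restrictedCZ Ω D g x) := by rw [hu.restrictedCZ_eq hxD]; exact hu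
    have hI1 := hD.integrableOn_continuous (continuous_polyFun (shift (-x₀) T))
    have hI2 := hD.integrableOn_continuous (continuous_polyFun L)
    have hpv := (HasPV.add hΩ hD.dim_pos hDm hI1 hI2 (hD.hasPV_polyFun hω hΩ hTdeg hxD)
      (hD.hasPV_polyFun hω hΩ hL hxD)).add hΩ hD.dim_pos hDm (hI1.add hI2) hgI hu'
    rw [(hpv.congr (g := h) fun z _ => by
      rw [hg]
      simp only [hsum z, Pi.add_apply, ← congrFun hTs z]
      ring).restrictedCZ_eq hxD, polyFun_add, polyFun_add]
    ring
  rw [avgL1_congr (measurableSet_cube x₀ ℓ) hsplitT]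
  have hm : ∀ {R S : MvPolynomial (Fin d) 𝕜}, R.totalDegree ≤ n → AEStronglyMeasurable
      (fun x => restrictedCZ Ω D (polyFun R) x - polyFun S x) (volume.restrict (cube x₀ ℓ)) :=
    fun {R S} hR => ((hD.aestronglyMeasurable_restrictedCZ_polyFun hω hΩ hR).restrict).sub
      (continuous_polyFun S).aestronglyMeasurable
  have hb1 : avgL1 (cube x₀ ℓ) (fun x => restrictedCZ Ω D (polyFun (shift (-x₀) T)) x - polyFun S₁ x)
      ≤ ENNReal.ofReal (C₀ * (C₄ * C₂) * N * ω ℓ) := by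
    refine hS₁a.trans ?_
    have hsup : ⨆ x ∈ D, ‖polyFun T (x - x₀)‖ₑ ≤
        ENNReal.ofReal (C₄ * (C₂ * N * logFactor ω n ℓ)) := by
      refine iSup₂_le fun x hx => ?_
      rw [← ofReal_norm]
      refine ENNReal.ofReal_le_ofReal ((hTn x (hD.dist_le x hx x₀ hx₀)).trans ?_)
      gcongr
      exact hω.logFactor_anti hℓ (by linarith)
    calc _ ≤ (C₀ : ℝ≥0∞) * ENNReal.ofReal (C₄ * (C₂ * N * logFactor ω n ℓ)) *
          ENNReal.ofReal (assocModulus ω n ℓ) := by gcongr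
      _ = ENNReal.ofReal (C₀ * (C₄ * (C₂ * N * logFactor ω n ℓ)) * (ω ℓ / logFactor ω n ℓ)) := by
          rw [ENNReal.ofReal_mul (p := C₀ * _) (by positivity), ENNReal.ofReal_mul (p := C₀)
            (by positivity), ENNReal.ofReal_coe_nnreal]
          rfl
      -- The logarithmic factor of the coefficients cancels against the denominator of the
      -- associated modulus.
      _ = _ := by
          congr 1
          field_simp
  have hb2 : avgL1 (cube x₀ ℓ) (fun x => restrictedCZ Ω D (polyFun L) x - polyFun S₂ x)
      ≤ ENNReal.ofReal (C₃ * (C₄ * C₂) * N * ω ℓ) := by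
    refine hS₂a.trans (ENNReal.ofReal_le_ofReal ?_)
    calc _ ≤ C₃ * (C₄ * (C₂ * N)) * ω ℓ := by gcongr
      _ = _ := by ring
  have hb3 : avgL1 (cube x₀ ℓ) (fun x => restrictedCZ Ω D g x - polyFun S₃ x)
      ≤ ENNReal.ofReal (C₁ * (Cω * 2 ^ q) * N * ω ℓ) := by
    refine avgL1_le_of_ae_le ?_
    filter_upwards [ae_restrict_mem (measurableSet_cube x₀ ℓ)] with x hx
    obtain ⟨u, hu, hle⟩ := hS₃a x hx
    rw [hu.restrictedCZ_eq (hcubℓ hx)]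
    calc _ ≤ C₁ * N * ω (2 * ℓ) := hle
      _ ≤ C₁ * N * (Cω * 2 ^ q * ω ℓ) := by
          gcongr
          exact hω.le_mul_of_le one_le_two hℓ le_rfl h2ℓ.le
      _ = _ := by ring
  calc _ ≤ ENNReal.ofReal (C₀ * (C₄ * C₂) * N * ω ℓ) + (ENNReal.ofReal (C₃ * (C₄ * C₂) * N * ω ℓ) +
        ENNReal.ofReal (C₁ * (Cω * 2 ^ q) * N * ω ℓ)) :=
        (avgL1_add_le (hm hTdeg)).trans (add_le_add hb1
          ((avgL1_add_le (hm hL)).trans (add_le_add hb2 hb3)))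
    _ = _ := by
        rw [← ENNReal.ofReal_add (by positivity) (by positivity),
          ← ENNReal.ofReal_add (by positivity) (by positivity)]
        congr 1
        ring

lemma integrableOn_cube_of_avgL1 {a : Rn d} {ℓ : ℝ} (hℓ : 0 < ℓ) {f : Rn d → 𝕜}
    {S : MvPolynomial (Fin d) 𝕜} (hf : AEStronglyMeasurable f (volume.restrict (cube a ℓ)))
    (h : avgL1 (cube a ℓ) (fun x => f x - polyFun S x) < ∞) : IntegrableOn f (cube a ℓ) := by
  have hS : IntegrableOn (polyFun S) (cube a ℓ) :=
    (continuous_polyFun S).continuousOn.integrableOn_compact (isCompact_cube a hℓ.le)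
  have h1 : IntegrableOn (fun x => f x - polyFun S x) (cube a ℓ) := by
    refine ⟨hf.sub hS.aestronglyMeasurable, ?_⟩
    rw [avgL1, volume_cube a hℓ.le, ENNReal.div_lt_iff (Or.inl (by simpa using pow_pos hℓ d))
      (Or.inl ENNReal.ofReal_ne_top)] at h
    exact h.trans_le le_top
  exact (h1.add hS).congr (Eventually.of_forall fun x => by simp)

/-- The two conditions on polynomials imply the boundedness of the operator. -/
theorem ConeDomain.restrictedCZBounded (hω : GoodModulus ω n q r Cω) (hD : ConeDomain D c ρ M)
    (hΩ : IsCZSymbol (n + 1) Ω) (h1 : ∀ P : MvPolynomial (Fin d) 𝕜, P.totalDegree ≤ n →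
      MemZygmund ω n D (restrictedCZ Ω D (polyFun P)))
    {C₀ : ℝ≥0} (h2 : ∀ (x₀ : Rn d) (ℓ : ℝ), 0 < ℓ → cube x₀ ℓ ⊆ D →
      ∀ H : MvPolynomial (Fin d) 𝕜, H.IsHomogeneous n →
        ∃ S : MvPolynomial (Fin d) 𝕜, S.totalDegree ≤ n ∧
          avgL1 (cube x₀ ℓ)
              (fun x => restrictedCZ Ω D (fun z => polyFun H (z - x₀)) x - polyFun S x)
            ≤ C₀ * (⨆ x ∈ D, ‖polyFun H (x - x₀)‖ₑ) * ENNReal.ofReal (assocModulus ω n ℓ)) :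
    RestrictedCZBounded ω n Ω D := by
  obtain ⟨C₁, hC₁, himg⟩ := hD.exists_image_approx hω hΩ h1 h2
  obtain ⟨C₂, hC₂, hinner⟩ := hω.exists_inner_bound 𝕜 d (κ := 2) one_le_two
  obtain ⟨C₃, hC₃, hcore⟩ := hD.exists_core_bound hω hΩ
  obtain ⟨C₄, hC₄, hintg⟩ := hD.exists_integral_bound hω 𝕜
  have hd := hD.dim_pos'
  have hDm := hD.isOpen.measurableSet
  set v : ℝ := volume.real D with hv
  set B : ℝ := C₂ * C₁ + C₃ * v with hB
  -- The plan is to show that the image has approximation data of its own, with constant `B N`; its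
  -- `L¹` norm then follows from the same general bound as for `h`.
  have key : ∀ (N : ℝ) (h : Rn d → 𝕜) (p : Rn d → ℝ → MvPolynomial (Fin d) 𝕜),
      ApproxData ω n D c ρ N h p → MemZygmund ω n D (restrictedCZ Ω D h) ∧
        zygmundNorm ω n D (restrictedCZ Ω D h) ≤ ENNReal.ofReal ((B + C₄ * B) * N) := by
    intro N h p H
    have hN := H.nonneg
    have hBN : 0 ≤ B * N := by positivity
    have hTm : AEStronglyMeasurable (restrictedCZ Ω D h) :=
      hΩ.aestronglyMeasurable_restrictedCZ hDm (hintg N h p H).1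
        fun y hy => hD.exists_hasPV hω hΩ H hy
    have hex : ∀ x₀ ℓ, ∃ S : MvPolynomial (Fin d) 𝕜, 0 < ℓ → cube x₀ (2 * ℓ) ⊆ D →
        S.totalDegree ≤ n ∧ avgL1 (cube x₀ ℓ) (fun x => restrictedCZ Ω D h x - polyFun S x) ≤
          ENNReal.ofReal (C₁ * N * ω ℓ) := by
      intro x₀ ℓ
      by_cases hc : 0 < ℓ ∧ cube x₀ (2 * ℓ) ⊆ D
      · obtain ⟨S, hS⟩ := himg N h p H x₀ ℓ hc.1 hc.2
        exact ⟨S, fun _ _ => hS⟩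
      · exact ⟨0, fun h1 h2 => absurd ⟨h1, h2⟩ hc⟩
    choose S hS using hex
    have hloc : LocallyIntegrableOn (restrictedCZ Ω D h) D := by
      intro y hy
      obtain ⟨ε, hε, hball⟩ := Metric.isOpen_iff.1 hD.isOpen y hy
      have hℓ : 0 < ε / (2 * d) := by positivity
      have hcub : cube y (2 * (ε / (2 * d))) ⊆ D := by
        refine (cube_subset_ball hD.dim_pos y (by positivity)).trans ?_
        rwa [show d * (2 * (ε / (2 * d))) = ε by field_simp]
      refine ⟨cube y (ε / (2 * d)), mem_nhdsWithin_of_mem_nhds ?_,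
        integrableOn_cube_of_avgL1 hℓ hTm.restrict
          ((hS y _ hℓ hcub).2.trans_lt ENNReal.ofReal_lt_top)⟩
      exact mem_of_superset (Metric.closedBall_mem_nhds y (by positivity))
        (closedBall_subset_cube y _)
    -- The estimate reaches only cubes whose doubles lie in `D`; the inner bound with `κ = 2`
    -- extends it to all cubes, using the polynomial of the concentric half cube.
    have hall : CubeApprox ω n D 1 (B * N) (restrictedCZ Ω D h) fun a ℓ => S a (ℓ / 2) := by
      intro a ℓ hℓ hcub
      rw [one_mul] at hcub
      have hωℓ := hω.pos ℓ hℓ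
      refine ⟨(hS a (ℓ / 2) (by positivity)
        (by rwa [mul_div_cancel₀ _ two_ne_zero])).1, avgL1_le_of_ae_le ?_⟩
      filter_upwards [ae_restrict_mem (measurableSet_cube a ℓ),
        ae_restrict_of_ae (ae_lebesguePoint hD.dim_pos hD.isOpen hloc)] with x hx hL
      refine (hinner D (C₁ * N) _ S (by positivity) hloc (fun a ℓ hℓ hc => hS a ℓ hℓ hc) a ℓ x hℓ hcub
        hx (hL (hcub hx))).trans ?_
      have : 0 ≤ C₃ * v * N * ω ℓ := by positivity
      rw [hB]
      linarith
    have hcoreI : ∫⁻ x in core D c ρ, ‖restrictedCZ Ω D h x‖ₑ ≤ ENNReal.ofReal (B * N) := by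
      calc _ ≤ ∫⁻ _ in core D c ρ, ENNReal.ofReal (C₃ * N) := by
            refine setLIntegral_mono' ConeDomain.isClosed_core.measurableSet fun y hy => ?_
            rw [← ofReal_norm]
            exact ENNReal.ofReal_le_ofReal (hcore N h p H y hy)
        _ = ENNReal.ofReal (C₃ * N) * volume (core D c ρ) := by simp
        _ ≤ ENNReal.ofReal (C₃ * N) * ENNReal.ofReal v := by
            gcongr
            rw [hv, ofReal_measureReal hD.volume_lt_top.ne]
            exact measure_mono hD.core_subset
        _ = ENNReal.ofReal (C₃ * N * v) := (ENNReal.ofReal_mul (by positivity)).symm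
        _ ≤ _ := by
            refine ENNReal.ofReal_le_ofReal ?_
            have : 0 ≤ C₂ * C₁ * N := by positivity
            rw [hB]
            linarith
    have hAD : ApproxData ω n D c ρ (B * N) (restrictedCZ Ω D h) fun a ℓ => S a (ℓ / 2) :=
      ⟨hBN, hloc, hall, hcoreI⟩
    have hsemi : zygmundSeminorm ω n D (restrictedCZ Ω D h) ≤ ENNReal.ofReal (B * N) :=
      zygmundSeminorm_le fun a ℓ hℓ hcub => by
        obtain ⟨h3, h4⟩ := hall a ℓ hℓ (by rwa [one_mul])
        exact ⟨_, h3, h4.trans_eq (ENNReal.ofReal_mul hBN)⟩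
    refine ⟨⟨hloc, hsemi.trans_lt ENNReal.ofReal_lt_top⟩, ?_⟩
    calc _ ≤ ENNReal.ofReal (B * N) + ENNReal.ofReal (C₄ * (B * N)) :=
          add_le_add hsemi (hintg _ _ _ hAD).2.2
      _ = _ := by
          rw [← ENNReal.ofReal_add (by positivity) (by positivity)]
          congr 1
          ring
  have hB0 : 0 < B := by positivity
  set A : ℝ := B + C₄ * B with hA
  have hA0 : 0 < A := by positivity
  refine ⟨⟨A, hA0.le⟩, fun f hf => ?_⟩
  have hfD := (hD.restrictedCZWellDefined hω hΩ f hf).1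
  have hz : zygmundNorm ω n D f ≠ ∞ := (ENNReal.add_lt_top.2 ⟨hf.2, hfD.2⟩).ne
  -- Approximation data need a constant strictly above the norm; the excess `ε` is sent to zero at
  -- the end.
  have hle : ∀ ε : ℝ, 0 < ε → MemZygmund ω n D (restrictedCZ Ω D f) ∧
      zygmundNorm ω n D (restrictedCZ Ω D f) ≤
        ENNReal.ofReal (A * ((zygmundNorm ω n D f).toReal + ε)) := by
    intro ε hε
    have hlt : zygmundNorm ω n D f < ENNReal.ofReal ((zygmundNorm ω n D f).toReal + ε) := by
      rw [ENNReal.ofReal_add ENNReal.toReal_nonneg hε.le, ENNReal.ofReal_toReal hz]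
      exact ENNReal.lt_add_right hz (by simpa using hε)
    obtain ⟨p, H⟩ := exists_approxData (c := c) (ρ := ρ) hω hf.1
      (le_self_add.trans_lt hlt) (((lintegral_mono_set hD.core_subset).trans le_add_self).trans hlt.le)
    exact key _ f p H
  refine ⟨(hle 1 one_pos).1, ?_⟩
  have hlim : Tendsto (fun ε : ℝ => ENNReal.ofReal (A * ((zygmundNorm ω n D f).toReal + ε)))
      (𝓝[>] 0) (𝓝 (ENNReal.ofReal (A * ((zygmundNorm ω n D f).toReal + 0)))) :=
    (ENNReal.continuous_ofReal.comp (by fun_prop)).continuousWithinAt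
  refine (ge_of_tendsto hlim (by
    filter_upwards [self_mem_nhdsWithin] with ε hε using (hle ε hε).2)).trans_eq ?_
  rw [add_zero, ENNReal.ofReal_mul hA0.le, ENNReal.ofReal_toReal hz, ENNReal.ofReal,
    Real.toNNReal_of_nonneg hA0.le]
  rfl

end Sufficiency

/-! ### Test functions -/

section TestFunctions

variable {ω : ℝ → ℝ} {n : ℕ} {q r Cω : ℝ} {D : Set (Rn d)} {c ρ M : ℝ}

/-- Dyadic sums interpolating between smoothness at large scales and size at small scales. -/
lemma GoodModulus.exists_dyadic_sum_bound (hω : GoodModulus ω n q r Cω) : ∃ C : ℝ, 0 < C ∧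
    ∀ (s τ : ℝ) (m : ℕ), 0 < s → 0 < τ →
      ∑ j ∈ Finset.range m, ω (2 ^ j * s) * min 1 ((τ / (2 ^ j * s)) ^ (n + 1)) ≤ C * ω τ := by
  have hC := hω.const_pos
  have h2r : 0 < (2 : ℝ) ^ r - 1 := sub_pos.2 (Real.one_lt_rpow one_lt_two hω.r_pos)
  have h2q : 0 < 1 - (2 : ℝ) ^ (q - (n + 1)) :=
    sub_pos.2 (Real.rpow_lt_one_of_one_lt_of_neg one_lt_two (by linarith [hω.q_lt]))
  refine ⟨Cω * (2 ^ r - 1)⁻¹ * (Cω * 2 ^ q) + Cω * (1 - 2 ^ (q - (n + 1)))⁻¹ * Cω, by positivity,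
    fun s τ m hs hτ => ?_⟩
  have hωτ := hω.pos τ hτ
  have hterm : ∀ j : ℕ, 0 ≤ ω (2 ^ j * s) * min 1 ((τ / (2 ^ j * s)) ^ (n + 1)) := fun j => by
    have := hω.pos (2 ^ j * s) (by positivity)
    positivity
  have hex : ∃ k : ℕ, τ ≤ 2 ^ k * s := by
    obtain ⟨k, hk⟩ := pow_unbounded_of_one_lt (τ / s) (one_lt_two : (1 : ℝ) < 2)
    exact ⟨k, ((div_lt_iff₀ hs).1 hk).le⟩
  classical
  set k := Nat.find hex with hk_def
  -- The sum is split at the first scale above `τ`: below it the minimum is replaced by `1` and the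
  -- sum is dominated by its top, above it the power `n + 1 > q` makes the terms decay.
  have hk : τ ≤ 2 ^ k * s := Nat.find_spec hex
  have hsmall : ∑ j ∈ Finset.range k, ω (2 ^ j * s) * min 1 ((τ / (2 ^ j * s)) ^ (n + 1)) ≤
      Cω * (2 ^ r - 1)⁻¹ * (Cω * 2 ^ q * ω τ) := by
    rcases Nat.eq_zero_or_pos k with h0 | h0
    · rw [h0, Finset.range_zero, Finset.sum_empty]
      positivity
    have h1 : 2 ^ k * s ≤ 2 * τ := by
      have h2 : ¬ τ ≤ 2 ^ (k - 1) * s := Nat.find_min hex (by omega)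
      obtain ⟨i, hi⟩ : ∃ i, k = i + 1 := ⟨k - 1, by omega⟩
      rw [hi, Nat.add_sub_cancel] at h2
      rw [hi, pow_succ]
      linarith
    have h2 := hω.sum_le_top one_lt_two hs (k := 0) (by simpa using hω.r_pos) k
    simp only [pow_zero, div_one, Nat.cast_zero, sub_zero] at h2
    calc _ ≤ ∑ j ∈ Finset.range k, ω (2 ^ j * s) := Finset.sum_le_sum fun j _ =>
          mul_le_of_le_one_right (hω.pos _ (by positivity)).le (min_le_left _ _)
      _ ≤ _ := h2
      _ ≤ _ := by
          gcongr
          exact hω.le_mul_of_le one_le_two hτ h1 (by positivity)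
  have hlarge : ∑ j ∈ Finset.range m,
      ω (2 ^ (k + j) * s) * min 1 ((τ / (2 ^ (k + j) * s)) ^ (n + 1)) ≤
      Cω * (1 - 2 ^ (q - (n + 1)))⁻¹ * (Cω * ω τ) := by
    set s' := 2 ^ k * s with hs'
    have hs'0 : 0 < s' := by positivity
    have h1 := hω.sum_div_pow_succ_le one_lt_two hs'0 m
    have h3 : ω s' ≤ Cω * (s' / τ) ^ (n + 1) * ω τ := by
      refine (hω.le_of_ge τ s' hτ hk).trans ?_
      have h4 : (s' / τ) ^ q ≤ (s' / τ) ^ (n + 1) := by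
        rw [← Real.rpow_natCast (s' / τ) (n + 1)]
        refine Real.rpow_le_rpow_of_exponent_le ((one_le_div hτ).2 hk) ?_
        push_cast
        exact hω.q_lt.le
      gcongr
    calc _ ≤ ∑ j ∈ Finset.range m, τ ^ (n + 1) * (ω (2 ^ j * s') / (2 ^ j * s') ^ (n + 1)) := by
          refine Finset.sum_le_sum fun j _ => ?_
          have e : (2 : ℝ) ^ (k + j) * s = 2 ^ j * s' := by rw [hs', pow_add]; ring
          have := hω.pos (2 ^ j * s') (by positivity)
          rw [e]
          calc _ ≤ ω (2 ^ j * s') * (τ / (2 ^ j * s')) ^ (n + 1) := by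
                gcongr
                exact min_le_right _ _
            _ = _ := by rw [div_pow]; ring
      _ ≤ τ ^ (n + 1) * (Cω * (1 - 2 ^ (q - (n + 1)))⁻¹ * (ω s' / s' ^ (n + 1))) := by
          rw [← Finset.mul_sum]
          gcongr
      _ ≤ τ ^ (n + 1) * (Cω * (1 - 2 ^ (q - (n + 1)))⁻¹ *
            (Cω * (s' / τ) ^ (n + 1) * ω τ / s' ^ (n + 1))) := by gcongr
      _ = _ := by
          rw [div_pow]
          field_simp
  calc _ ≤ ∑ j ∈ Finset.range (k + m), ω (2 ^ j * s) * min 1 ((τ / (2 ^ j * s)) ^ (n + 1)) :=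
        Finset.sum_le_sum_of_subset_of_nonneg (Finset.range_subset_range.2 (by omega))
          fun j _ _ => hterm j
    _ ≤ Cω * (2 ^ r - 1)⁻¹ * (Cω * 2 ^ q * ω τ) +
          Cω * (1 - 2 ^ (q - (n + 1)))⁻¹ * (Cω * ω τ) := by
        rw [Finset.sum_range_add]
        exact add_le_add hsmall hlarge
    _ = _ := by ring

lemma contDiff_mono (α : Fin d →₀ ℕ) {k : WithTop ℕ∞} : ContDiff ℝ k (mono 𝕜 α) := by
  unfold mono
  refine contDiff_prod fun i _ => ContDiff.pow ?_ _
  exact (RCLike.ofRealCLM (K := 𝕜)).contDiff.comp (EuclideanSpace.proj (𝕜 := ℝ) i).contDiff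

/-- Polynomial approximation of a smooth compactly supported function. -/
lemma exists_smooth_approx (n : ℕ) {F : Rn d → 𝕜} (hF : ContDiff ℝ (n + 1) F)
    (hs : HasCompactSupport F) : ∃ B : ℝ, 0 < B ∧ (∀ x, ‖F x‖ ≤ B) ∧
    ∀ a : Rn d, ∃ P : MvPolynomial (Fin d) 𝕜, P.totalDegree ≤ n ∧
      ∀ x, ‖F x - polyFun P x‖ ≤ B * ‖x - a‖ ^ (n + 1) := by
  obtain ⟨B₁, hB₁⟩ := hs.exists_bound_of_continuous hF.continuous
  obtain ⟨B₂, hB₂⟩ := (hs.iteratedFDeriv (𝕜 := ℝ) (n + 1)).exists_bound_of_continuous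
    (hF.continuous_iteratedFDeriv (by exact_mod_cast le_rfl))
  refine ⟨max 1 (max B₁ B₂), by positivity,
    fun x => (hB₁ x).trans ((le_max_left _ _).trans (le_max_right _ _)), fun a => ?_⟩
  obtain ⟨S, hS, hSval⟩ := exists_polyFun_eq_formSum n (taylorCoeff F a) a
  refine ⟨S, hS, fun x => ?_⟩
  have h := norm_sub_taylor_le (n := n) (F := F) (z := a) (v := x - a)
    (fun t _ => hF.contDiffAt) fun t _ => (hB₂ _).trans
      ((le_max_right B₁ _).trans (le_max_right 1 _))
  rwa [add_sub_cancel, ← hSval] at h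

/-- Substituting `t⁻¹ (x - a)` into a polynomial. -/
lemma exists_polyFun_rescale {P : MvPolynomial (Fin d) 𝕜} (hP : P.totalDegree ≤ n) (a : Rn d)
    (t : ℝ) : ∃ R : MvPolynomial (Fin d) 𝕜, R.totalDegree ≤ n ∧
      ∀ x, polyFun R x = polyFun P (t • (x - a)) := by
  refine ⟨shift (-a) (∑ α ∈ multiIdx d n,
    MvPolynomial.monomial α (P.coeff α * ((t ^ α.degree : ℝ) : 𝕜))), ?_, fun x => ?_⟩
  · refine (totalDegree_shift_le _ _).trans (MvPolynomial.totalDegree_finsetSum_le fun α hα => ?_)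
    refine (MvPolynomial.totalDegree_monomial_le _ _).trans ?_
    have : (α.sum fun _ => id) = α.degree := by
      rw [Finsupp.sum_fintype _ _ (by simp), Finsupp.degree_eq_sum]
      rfl
    rw [this]
    exact mem_multiIdx.1 hα
  · rw [polyFun_shift, polyFun_sum, polyFun_eq_sum hP, ← sub_eq_add_neg]
    refine Finset.sum_congr rfl fun α _ => ?_
    rw [polyFun_monomial, mono_smul]
    ring

/-- A smooth cut-off equal to `1` on the ball of radius `2 d`. -/
def cutoff (hd : 0 < d) : ContDiffBump (0 : Rn d) where
  rIn := 2 * d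
  rOut := 4 * d
  rIn_pos := by positivity
  rIn_lt_rOut := by
    have : (0 : ℝ) < d := by exact_mod_cast hd
    linarith

/-- The function `H` multiplied by the cut-off. -/
def cutPoly (hd : 0 < d) (H : MvPolynomial (Fin d) 𝕜) (x : Rn d) : 𝕜 :=
  ((cutoff hd x : ℝ) : 𝕜) * polyFun H x

lemma continuous_cutPoly (hd : 0 < d) (H : MvPolynomial (Fin d) 𝕜) : Continuous (cutPoly hd H) :=
  (RCLike.continuous_ofReal.comp (cutoff hd).continuous).mul (continuous_polyFun H)

/-- Approximation of rescaled cut-off polynomials on cubes. -/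
lemma exists_cutPoly_approx (hd : 0 < d) (𝕜 : Type*) [RCLike 𝕜] (n : ℕ) : ∃ B : ℝ, 0 < B ∧
    ∀ H : MvPolynomial (Fin d) 𝕜, H.totalDegree ≤ n → (∀ x, ‖cutPoly hd H x‖ ≤ B * pnorm n 1 H) ∧
    ∀ (x₀ a : Rn d) (t τ : ℝ), 0 < t → 0 < τ → ∃ P : MvPolynomial (Fin d) 𝕜, P.totalDegree ≤ n ∧
      ∀ x ∈ cube a τ, ‖cutPoly hd H (t⁻¹ • (x - x₀)) - polyFun P x‖ ≤
        B * pnorm n 1 H * min 1 ((τ / t) ^ (n + 1)) := by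
  have hd0 : (0 : ℝ) < d := by exact_mod_cast hd
  -- Working monomial by monomial makes the final constants linear in the coefficients of `H`.
  have hsm : ∀ α : Fin d →₀ ℕ, ∃ B : ℝ, 0 < B ∧
      (∀ x, ‖((cutoff hd x : ℝ) : 𝕜) * mono 𝕜 α x‖ ≤ B) ∧
      ∀ a : Rn d, ∃ P : MvPolynomial (Fin d) 𝕜, P.totalDegree ≤ n ∧
      ∀ x, ‖((cutoff hd x : ℝ) : 𝕜) * mono 𝕜 α x - polyFun P x‖ ≤ B * ‖x - a‖ ^ (n + 1) := by
    intro α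
    refine exists_smooth_approx n (ContDiff.mul ?_ (contDiff_mono α)) ?_
    · exact (RCLike.ofRealCLM (K := 𝕜)).contDiff.comp (cutoff hd).contDiff
    · refine HasCompactSupport.mul_right ?_
      exact (cutoff hd).hasCompactSupport.comp_left (g := fun r : ℝ => (r : 𝕜)) (by simp)
  choose B hB hbd hap using hsm
  choose P hPdeg hP using hap
  set B₀ : ℝ := ∑ α ∈ multiIdx d n, B α with hB₀
  have hBle : ∀ α ∈ multiIdx d n, B α ≤ B₀ := fun α hα =>
    Finset.single_le_sum (fun β _ => (hB β).le) hα
  have hB₀0 : 0 ≤ B₀ := Finset.sum_nonneg fun β _ => (hB β).le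
  have hcut : ∀ (H : MvPolynomial (Fin d) 𝕜), H.totalDegree ≤ n → ∀ x, cutPoly hd H x =
      ∑ α ∈ multiIdx d n, H.coeff α * (((cutoff hd x : ℝ) : 𝕜) * mono 𝕜 α x) := by
    intro H hH x
    rw [cutPoly, polyFun_eq_sum hH, Finset.mul_sum]
    exact Finset.sum_congr rfl fun α _ => by ring
  have hsum : ∀ (H : MvPolynomial (Fin d) 𝕜) (g : (Fin d →₀ ℕ) → 𝕜) (E : ℝ), 0 ≤ E →
      (∀ α ∈ multiIdx d n, ‖g α‖ ≤ B α * E) →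
      ‖∑ α ∈ multiIdx d n, H.coeff α * g α‖ ≤ B₀ * pnorm n 1 H * E := by
    intro H g E hE hg
    refine (norm_sum_le _ _).trans ?_
    calc _ ≤ ∑ α ∈ multiIdx d n, ‖H.coeff α‖ * (B₀ * E) := by
          refine Finset.sum_le_sum fun α hα => ?_
          rw [norm_mul]
          gcongr
          exact (hg α hα).trans (by gcongr; exact hBle α hα)
      _ = _ := by
          rw [← Finset.sum_mul, pnorm]
          simp only [one_pow, mul_one]
          ring
  refine ⟨B₀ * (1 + d ^ (n + 1)) + 1, by positivity, fun H hH => ?_⟩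
  have hpn := pnorm_nonneg (n := n) zero_le_one H
  have hB' : B₀ * pnorm n 1 H ≤ (B₀ * (1 + d ^ (n + 1)) + 1) * pnorm n 1 H := by
    gcongr
    have : 0 ≤ B₀ * (d : ℝ) ^ (n + 1) := by positivity
    linarith
  have hbound : ∀ x, ‖cutPoly hd H x‖ ≤ (B₀ * (1 + d ^ (n + 1)) + 1) * pnorm n 1 H := by
    intro x
    rw [hcut H hH]
    refine (hsum H _ 1 zero_le_one fun α _ => by rw [mul_one]; exact hbd α x).trans ?_
    rwa [mul_one]
  refine ⟨hbound, fun x₀ a t τ ht hτ => ?_⟩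
  -- On cubes smaller than the scale of the bump, its Taylor polynomial is used; on larger ones the
  -- zero polynomial and boundedness suffice.
  rcases le_total τ t with h | h
  · set b : Rn d := t⁻¹ • (a - x₀) with hb
    have hdegR : (∑ α ∈ multiIdx d n, MvPolynomial.C (H.coeff α) * P α b).totalDegree ≤ n :=
      MvPolynomial.totalDegree_finsetSum_le fun α _ => by
        refine (MvPolynomial.totalDegree_mul _ _).trans ?_
        rw [MvPolynomial.totalDegree_C, zero_add]
        exact hPdeg α b
    obtain ⟨R, hR, hRval⟩ := exists_polyFun_rescale hdegR x₀ t⁻¹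
    refine ⟨R, hR, fun x hx => ?_⟩
    have hxa : ‖t⁻¹ • (x - x₀) - b‖ ≤ d * (τ / t) := by
      rw [hb, ← smul_sub, sub_sub_sub_cancel_right, norm_smul, norm_inv, Real.norm_of_nonneg ht.le]
      have h1 := cube_subset_closedBall a hτ.le hx
      rw [Metric.mem_closedBall, dist_eq_norm] at h1
      calc t⁻¹ * ‖x - a‖ ≤ t⁻¹ * (d * (τ / 2)) := by gcongr
        _ ≤ t⁻¹ * (d * τ) := by gcongr; linarith
        _ = _ := by ring
    rw [hRval, hcut H hH, polyFun_sum, ← Finset.sum_sub_distrib]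
    simp only [polyFun_C_mul, ← mul_sub]
    refine (hsum H _ ((d * (τ / t)) ^ (n + 1)) (by positivity) fun α _ =>
      (hP α b _).trans (by have := (hB α).le; gcongr)).trans ?_
    have hmin : min 1 ((τ / t) ^ (n + 1)) = (τ / t) ^ (n + 1) :=
      min_eq_right (pow_le_one₀ (by positivity) ((div_le_one ht).2 h))
    rw [hmin, mul_pow]
    have : 0 ≤ (B₀ + 1) * (pnorm n 1 H * (τ / t) ^ (n + 1)) := by positivity
    linarith
  · refine ⟨0, by simp, fun x _ => ?_⟩
    have hmin : min 1 ((τ / t) ^ (n + 1)) = 1 :=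
      min_eq_left (one_le_pow₀ ((one_le_div ht).2 h))
    rw [polyFun_zero, sub_zero, hmin, mul_one]
    exact hbound _

/-- The test function: a polynomial made of order `ω` at every scale between `ℓ` and `1`. -/
def testFun (hd : 0 < d) (ω : ℝ → ℝ) (ℓ : ℝ) (m : ℕ) (H : MvPolynomial (Fin d) 𝕜) (x₀ x : Rn d) : 𝕜 :=
  polyFun H (x - x₀) + ∑ j ∈ Finset.range m,
    ((ω (2 ^ j * ℓ) : ℝ) : 𝕜) * cutPoly hd H ((2 ^ j * ℓ)⁻¹ • (x - x₀))

lemma continuous_testFun (hd : 0 < d) (ω : ℝ → ℝ) (ℓ : ℝ) (m : ℕ) (H : MvPolynomial (Fin d) 𝕜)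
    (x₀ : Rn d) : Continuous (testFun hd ω ℓ m H x₀) := by
  unfold testFun
  refine ((continuous_polyFun H).comp (by fun_prop)).add
    (continuous_finsetSum _ fun j _ => continuous_const.mul ?_)
  exact (continuous_cutPoly hd H).comp (by fun_prop)

lemma norm_polyFun_sub_le_pnorm {H : MvPolynomial (Fin d) 𝕜} (hH : H.totalDegree ≤ n) {w : Rn d}
    {μ : ℝ} (hμ : 1 ≤ μ) (hw : ‖w‖ ≤ μ) : ‖polyFun H w‖ ≤ μ ^ n * pnorm n 1 H := by
  have h1 := norm_polyFun_le hH (a := 0) (x := w) (τ := μ) fun i => by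
    simpa using (abs_apply_le_norm w i).trans hw
  rw [shift_zero] at h1
  refine h1.trans ?_
  simpa using pnorm_mul_le zero_le_one hμ H

/-- The test functions are bounded in the Zygmund space. -/
lemma ConeDomain.exists_testFun_norm_bound (hω : GoodModulus ω n q r Cω) (𝕜 : Type*) [RCLike 𝕜]
    (hD : ConeDomain D c ρ M) : ∃ C : ℝ, 0 < C ∧
    ∀ (H : MvPolynomial (Fin d) 𝕜), H.totalDegree ≤ n → ∀ (x₀ : Rn d) (ℓ : ℝ) (m : ℕ), x₀ ∈ D →
      0 < ℓ → (∀ j < m, 2 ^ j * ℓ ≤ 1) →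
      MemZygmund ω n D (testFun hD.dim_pos ω ℓ m H x₀) ∧
      zygmundNorm ω n D (testFun hD.dim_pos ω ℓ m H x₀) ≤ ENNReal.ofReal (C * pnorm n 1 H) := by
  obtain ⟨B, hB, hcut⟩ := exists_cutPoly_approx hD.dim_pos 𝕜 n
  obtain ⟨C₁, hC₁, hdy⟩ := hω.exists_dyadic_sum_bound
  have hω1 := hω.pos 1 one_pos
  have hM := hD.one_le
  set v : ℝ := volume.real D with hv
  refine ⟨C₁ * B + (M ^ n + C₁ * ω 1 * B) * v, by positivity,
    fun H hH x₀ ℓ m hx₀ hℓ hm => ?_⟩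
  obtain ⟨hbd, hap⟩ := hcut H hH
  have hpn := pnorm_nonneg (n := n) zero_le_one H
  have hωj : ∀ j : ℕ, 0 < ω (2 ^ j * ℓ) := fun j => hω.pos _ (by positivity)
  have hsemi : zygmundSeminorm ω n D (testFun hD.dim_pos ω ℓ m H x₀) ≤
      ENNReal.ofReal (C₁ * B * pnorm n 1 H) := by
    refine zygmundSeminorm_le fun a τ hτ hcub => ?_
    choose P hPdeg hP using fun j : ℕ => hap x₀ a (2 ^ j * ℓ) τ (by positivity) hτ
    refine ⟨shift (-x₀) H + ∑ j ∈ Finset.range m,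
      MvPolynomial.C ((ω (2 ^ j * ℓ) : ℝ) : 𝕜) * P j, ?_, ?_⟩
    · refine (MvPolynomial.totalDegree_add _ _).trans (max_le
        ((totalDegree_shift_le _ _).trans hH) ?_)
      refine MvPolynomial.totalDegree_finsetSum_le fun j _ => ?_
      refine (MvPolynomial.totalDegree_mul _ _).trans ?_
      rw [MvPolynomial.totalDegree_C, zero_add]
      exact hPdeg j
    · rw [← ENNReal.ofReal_mul (by positivity)]
      refine avgL1_le_of_ae_le ?_
      filter_upwards [ae_restrict_mem (measurableSet_cube a τ)] with x hx
      have e1 : testFun hD.dim_pos ω ℓ m H x₀ x - polyFun (shift (-x₀) H + ∑ j ∈ Finset.range m,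
          MvPolynomial.C ((ω (2 ^ j * ℓ) : ℝ) : 𝕜) * P j) x =
          ∑ j ∈ Finset.range m, ((ω (2 ^ j * ℓ) : ℝ) : 𝕜) *
            (cutPoly hD.dim_pos H ((2 ^ j * ℓ)⁻¹ • (x - x₀)) - polyFun (P j) x) := by
        rw [testFun, polyFun_add, polyFun_shift, polyFun_sum, ← sub_eq_add_neg,
          add_sub_add_left_eq_sub, ← Finset.sum_sub_distrib]
        simp only [polyFun_C_mul, mul_sub]
      rw [e1]
      refine (norm_sum_le _ _).trans ?_
      calc _ ≤ ∑ j ∈ Finset.range m, (B * pnorm n 1 H) *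
            (ω (2 ^ j * ℓ) * min 1 ((τ / (2 ^ j * ℓ)) ^ (n + 1))) := by
            refine Finset.sum_le_sum fun j _ => ?_
            rw [norm_mul, RCLike.norm_ofReal, abs_of_pos (hωj j)]
            calc _ ≤ ω (2 ^ j * ℓ) * (B * pnorm n 1 H * min 1 ((τ / (2 ^ j * ℓ)) ^ (n + 1))) := by
                  have := (hωj j).le
                  gcongr
                  exact hP j x hx
              _ = _ := by ring
        _ ≤ (B * pnorm n 1 H) * (C₁ * ω τ) := by
            rw [← Finset.mul_sum]
            -- The polynomial `H(x - x₀)` was approximated exactly, so only the dyadic sum of bumps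
            -- remains.
            gcongr
            exact hdy ℓ τ m hℓ hτ
        _ = _ := by ring
  have hL1 : ∫⁻ x in D, ‖testFun hD.dim_pos ω ℓ m H x₀ x‖ₑ ≤
      ENNReal.ofReal ((M ^ n + C₁ * ω 1 * B) * v * pnorm n 1 H) := by
    -- All scales used are at most `1`, so the dyadic bound at `τ = 1` has every minimum equal to
    -- `1`.
    have hsum1 : ∑ j ∈ Finset.range m, ω (2 ^ j * ℓ) ≤ C₁ * ω 1 := by
      refine le_trans (Finset.sum_le_sum fun j hj => ?_) (hdy ℓ 1 m hℓ one_pos)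
      rw [min_eq_left (one_le_pow₀ ((one_le_div (by positivity)).2 (hm j (Finset.mem_range.1 hj)))),
        mul_one]
    have hpt : ∀ x ∈ D, ‖testFun hD.dim_pos ω ℓ m H x₀ x‖ ≤
        (M ^ n + C₁ * ω 1 * B) * pnorm n 1 H := by
      intro x hx
      rw [testFun]
      refine (norm_add_le _ _).trans ?_
      rw [add_mul]
      refine add_le_add (norm_polyFun_sub_le_pnorm hH hM (hD.dist_le x hx x₀ hx₀))
        ((norm_sum_le _ _).trans ?_)
      calc _ ≤ ∑ j ∈ Finset.range m, ω (2 ^ j * ℓ) * (B * pnorm n 1 H) := by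
            refine Finset.sum_le_sum fun j _ => ?_
            rw [norm_mul, RCLike.norm_ofReal, abs_of_pos (hωj j)]
            have := (hωj j).le
            gcongr
            exact hbd _
        _ ≤ C₁ * ω 1 * (B * pnorm n 1 H) := by
            rw [← Finset.sum_mul]
            gcongr
        _ = _ := by ring
    calc _ ≤ ∫⁻ _ in D, ENNReal.ofReal ((M ^ n + C₁ * ω 1 * B) * pnorm n 1 H) := by
          refine setLIntegral_mono' hD.isOpen.measurableSet fun x hx => ?_
          rw [← ofReal_norm]
          exact ENNReal.ofReal_le_ofReal (hpt x hx)
      _ = ENNReal.ofReal ((M ^ n + C₁ * ω 1 * B) * pnorm n 1 H) * ENNReal.ofReal v := by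
          rw [setLIntegral_const, hv, ofReal_measureReal hD.volume_lt_top.ne]
      _ = _ := by
          rw [← ENNReal.ofReal_mul (by positivity)]
          congr 1
          ring
  refine ⟨⟨(hD.integrableOn_continuous (continuous_testFun _ ω ℓ m H x₀)).locallyIntegrableOn,
    hsemi.trans_lt ENNReal.ofReal_lt_top⟩, (add_le_add hsemi hL1).trans_eq ?_⟩
  rw [← ENNReal.ofReal_add (by positivity) (by positivity)]
  congr 1
  ring

end TestFunctions

/-! ### Necessity -/

section Necessity

variable {ω : ℝ → ℝ} {n : ℕ} {q r Cω : ℝ} {D : Set (Rn d)} {c ρ M : ℝ} {Ω : Rn d → 𝕜}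

lemma polyFun_smul_of_isHomogeneous {H : MvPolynomial (Fin d) 𝕜} (hH : H.IsHomogeneous n) (t : ℝ)
    (x : Rn d) : polyFun H (t • x) = ((t ^ n : ℝ) : 𝕜) * polyFun H x := by
  rw [polyFun_eq_sum hH.totalDegree_le, polyFun_eq_sum hH.totalDegree_le, Finset.mul_sum]
  refine Finset.sum_congr rfl fun α _ => ?_
  by_cases hα : H.coeff α = 0
  · rw [hα, zero_mul, zero_mul, mul_zero]
  · rw [mono_smul, show α.degree = n by
      rw [Finsupp.degree_eq_weight_one]
      exact hH hα]
    ring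

/-- The coefficients of a polynomial are controlled by its maximum over the domain. -/
lemma ConeDomain.exists_pnorm_le_iSup (hD : ConeDomain D c ρ M) (𝕜 : Type*) [RCLike 𝕜] (n : ℕ) :
    ∃ C : ℝ, 0 < C ∧ ∀ H : MvPolynomial (Fin d) 𝕜, H.totalDegree ≤ n → ∀ x₀ ∈ D,
      ENNReal.ofReal (pnorm n 1 H) ≤ ENNReal.ofReal C * ⨆ x ∈ D, ‖polyFun H (x - x₀)‖ₑ := by
  obtain ⟨C₁, hC₁, h1⟩ := exists_pnorm_le_avgL1 𝕜 d n
  obtain ⟨C₂, hC₂, h2⟩ := exists_pnorm_shift_le 𝕜 d n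
  obtain ⟨b, hb⟩ := hD.nonempty
  obtain ⟨ε, hε, hball⟩ := Metric.isOpen_iff.1 hD.isOpen b hb
  have hd := hD.dim_pos'
  have hM := hD.one_le
  set τ : ℝ := min 1 (ε / d) with hτ_def
  have hτ : 0 < τ := by positivity
  have hτ1 : τ ≤ 1 := min_le_left _ _
  have hcub : cube b τ ⊆ D := by
    refine (cube_subset_ball hD.dim_pos b hτ).trans ((Metric.ball_subset_ball ?_).trans hball)
    rw [mul_comm, ← le_div_iff₀ (by positivity)]
    exact min_le_right _ _
  refine ⟨τ⁻¹ ^ n * (C₂ * (M / τ) ^ n * C₁), by positivity, fun H hH x₀ hx₀ => ?_⟩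
  set s : ℝ≥0∞ := ⨆ x ∈ D, ‖polyFun H (x - x₀)‖ₑ with hs
  have hs_top : s ≠ ∞ := by
    refine ne_top_of_le_ne_top (ENNReal.ofReal_ne_top (r := M ^ n * pnorm n 1 H))
      (iSup₂_le fun x hx => ?_)
    rw [← ofReal_norm]
    exact ENNReal.ofReal_le_ofReal (norm_polyFun_sub_le_pnorm hH hM (hD.dist_le x hx x₀ hx₀))
  have hle : ∀ x ∈ D, ‖polyFun (shift (-x₀) H) x‖ ≤ s.toReal := fun x hx => by
    rw [polyFun_shift, ← sub_eq_add_neg, ← toReal_enorm]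
    exact ENNReal.toReal_mono hs_top (le_iSup₂ (f := fun x _ => ‖polyFun H (x - x₀)‖ₑ) x hx)
  have hdeg : (shift (-x₀) H).totalDegree ≤ n := (totalDegree_shift_le _ _).trans hH
  have h3 := pnorm_le_of_norm_le hC₁ h1 hdeg hτ fun x hx => hle x (hcub hx)
  have h4 := h2 _ hdeg x₀ b τ (M / τ) hτ ((one_le_div hτ).2 (hτ1.trans hM)) fun i => by
    rw [div_mul_cancel₀ _ hτ.ne']
    exact (abs_apply_le_norm (x₀ - b) i).trans (hD.dist_le x₀ hx₀ b hb)
  rw [shift_shift, add_neg_cancel, shift_zero] at h4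
  have h5 := pnorm_mul_le (n := n) (μ := τ⁻¹) hτ.le ((one_le_inv₀ hτ).2 hτ1) H
  rw [inv_mul_cancel₀ hτ.ne'] at h5
  rw [← ENNReal.ofReal_toReal hs_top, ← ENNReal.ofReal_mul (by positivity)]
  refine ENNReal.ofReal_le_ofReal (h5.trans ?_)
  calc _ ≤ τ⁻¹ ^ n * (C₂ * (M / τ) ^ n * (C₁ * s.toReal)) := by
        gcongr
        exact h4.trans (by gcongr)
    _ = _ := by ring

lemma polyFun_sub_cutPoly_eq_zero (hd : 0 < d) (H : MvPolynomial (Fin d) 𝕜) {w : Rn d}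
    (hw : ‖w‖ ≤ 2 * d) : polyFun H w - cutPoly hd H w = 0 := by
  rw [cutPoly, (cutoff hd).one_of_mem_closedBall (by simpa [cutoff] using hw)]
  simp

/-- The difference vanishes for `‖w‖ ≤ 2d`, and elsewhere `‖w‖ ≥ 1`, so any power `p ≥ n` dominates
the growth of `H`. -/
lemma norm_polyFun_sub_cutPoly_le (hd : 0 < d) {H : MvPolynomial (Fin d) 𝕜} (hH : H.totalDegree ≤ n)
    {p : ℝ} (hp : n ≤ p) (w : Rn d) :
    ‖polyFun H w - cutPoly hd H w‖ ≤ pnorm n 1 H * ‖w‖ ^ p := by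
  have hpn := pnorm_nonneg (n := n) zero_le_one H
  have hd1 : (1 : ℝ) ≤ d := by exact_mod_cast hd
  rcases le_total ‖w‖ (2 * d) with h | h
  · rw [polyFun_sub_cutPoly_eq_zero hd H h, norm_zero]
    positivity
  have hw : 1 ≤ ‖w‖ := by linarith
  have e : polyFun H w - cutPoly hd H w = ((1 - cutoff hd w : ℝ) : 𝕜) * polyFun H w := by
    rw [cutPoly]
    push_cast
    ring
  have h0 := (cutoff hd).nonneg' w
  have h1 := (cutoff hd).le_one (x := w)
  rw [e, norm_mul, RCLike.norm_ofReal, abs_of_nonneg (by linarith)]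
  calc _ ≤ 1 * (‖w‖ ^ n * pnorm n 1 H) := by
        gcongr
        · linarith
        · exact norm_polyFun_sub_le_pnorm hH hw le_rfl
    _ ≤ 1 * (‖w‖ ^ p * pnorm n 1 H) := by
        rw [← Real.rpow_natCast]
        gcongr
    _ = _ := by ring

/-- The multiple of the polynomial that the test function agrees with near its centre. -/
def dyadicWeight (ω : ℝ → ℝ) (n : ℕ) (ℓ : ℝ) (m : ℕ) : ℝ :=
  1 + ∑ j ∈ Finset.range m, ω (2 ^ j * ℓ) / (2 ^ j * ℓ) ^ n

/-- The difference between the multiple of the polynomial and the test function. -/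
def testRem (hd : 0 < d) (ω : ℝ → ℝ) (ℓ : ℝ) (m : ℕ) (H : MvPolynomial (Fin d) 𝕜) (x₀ x : Rn d) :
    𝕜 :=
  ∑ j ∈ Finset.range m, ((ω (2 ^ j * ℓ) : ℝ) : 𝕜) *
    (polyFun H ((2 ^ j * ℓ)⁻¹ • (x - x₀)) - cutPoly hd H ((2 ^ j * ℓ)⁻¹ • (x - x₀)))

/-- Without the cut-offs, homogeneity turns the copy at scale `t = 2^j ℓ` into `ω(t) / t ^ n` times
`H`; these multiples add up to the weight. -/
lemma testFun_add_testRem (hd : 0 < d) (ω : ℝ → ℝ) (ℓ : ℝ) (m : ℕ)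
    {H : MvPolynomial (Fin d) 𝕜} (hH : H.IsHomogeneous n) (x₀ x : Rn d) :
    testFun hd ω ℓ m H x₀ x + testRem hd ω ℓ m H x₀ x =
      ((dyadicWeight ω n ℓ m : ℝ) : 𝕜) * polyFun H (x - x₀) := by
  rw [testFun, testRem, add_assoc, ← Finset.sum_add_distrib, dyadicWeight]
  push_cast
  rw [add_mul, one_mul, Finset.sum_mul]
  congr 1
  refine Finset.sum_congr rfl fun j _ => ?_
  rw [polyFun_smul_of_isHomogeneous hH]
  push_cast
  rw [inv_pow]
  ring

lemma continuous_testRem (hd : 0 < d) (ω : ℝ → ℝ) (ℓ : ℝ) (m : ℕ) (H : MvPolynomial (Fin d) 𝕜)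
    (x₀ : Rn d) : Continuous (testRem hd ω ℓ m H x₀) := by
  unfold testRem
  refine continuous_finsetSum _ fun j _ => continuous_const.mul (Continuous.sub ?_ ?_)
  · exact (continuous_polyFun H).comp (by fun_prop)
  · exact (continuous_cutPoly hd H).comp (by fun_prop)

/-- All the scales are at least `ℓ`, so every cut-off equals `1` on the ball of radius `2 d ℓ`. -/
lemma testRem_eq_zero (hd : 0 < d) (ω : ℝ → ℝ) {ℓ : ℝ} (hℓ : 0 < ℓ) (m : ℕ)
    (H : MvPolynomial (Fin d) 𝕜) {x₀ x : Rn d} (hx : ‖x - x₀‖ ≤ 2 * (d * ℓ)) :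
    testRem hd ω ℓ m H x₀ x = 0 := by
  refine Finset.sum_eq_zero fun j _ => ?_
  rw [polyFun_sub_cutPoly_eq_zero, mul_zero]
  rw [norm_smul, norm_inv, Real.norm_of_nonneg (by positivity), inv_mul_le_iff₀ (by positivity)]
  refine hx.trans ?_
  have h1 : (1 : ℝ) ≤ 2 ^ j := one_le_pow₀ one_le_two
  calc 2 * (d * ℓ) = 1 * (2 * (d * ℓ)) := (one_mul _).symm
    _ ≤ 2 ^ j * (2 * (d * ℓ)) := by gcongr
    _ = _ := by ring

/-- An exponent `p` strictly above `q` turns the sum over scales into a convergent geometric series,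
uniformly in `m`. -/
lemma GoodModulus.norm_testRem_le (hω : GoodModulus ω n q r Cω) (hd : 0 < d) {p : ℝ} (hp : q < p)
    {ℓ : ℝ} (hℓ : 0 < ℓ) (m : ℕ) {H : MvPolynomial (Fin d) 𝕜} (hH : H.totalDegree ≤ n)
    (x₀ x : Rn d) : ‖testRem hd ω ℓ m H x₀ x‖ ≤
      Cω * (1 - 2 ^ (q - p))⁻¹ * pnorm n 1 H * ω ℓ * (1 + ‖x₀ - x‖ / ℓ) ^ p := by
  have hpn := pnorm_nonneg (n := n) zero_le_one H
  have hωℓ := hω.pos ℓ hℓ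
  have hCω := hω.const_pos
  have hp0 : 0 < p := hω.q_pos.trans hp
  set u := ‖x₀ - x‖ with hu
  have hu0 : 0 ≤ u := norm_nonneg _
  refine (norm_sum_le _ _).trans ?_
  calc _ ≤ ∑ j ∈ Finset.range m,
        Cω * pnorm n 1 H * ω ℓ * (u / ℓ) ^ p * ((2 : ℝ) ^ j) ^ (q - p) := by
        refine Finset.sum_le_sum fun j _ => ?_
        have h2j : (1 : ℝ) ≤ 2 ^ j := one_le_pow₀ one_le_two
        have h1 := hω.le_of_ge ℓ (2 ^ j * ℓ) hℓ (le_mul_of_one_le_left hℓ.le h2j)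
        rw [mul_div_cancel_right₀ _ hℓ.ne'] at h1
        have h2 := norm_polyFun_sub_cutPoly_le hd hH (hω.lt_q.le.trans hp.le)
          ((2 ^ j * ℓ)⁻¹ • (x - x₀))
        have e : ‖(2 ^ j * ℓ)⁻¹ • (x - x₀)‖ = (u / ℓ) / 2 ^ j := by
          rw [norm_smul, norm_inv, Real.norm_of_nonneg (by positivity), norm_sub_rev, ← hu]
          field_simp
        rw [e, Real.div_rpow (by positivity) (by positivity)] at h2
        have hωj := hω.pos (2 ^ j * ℓ) (by positivity)
        rw [norm_mul, RCLike.norm_ofReal, abs_of_pos hωj]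
        calc _ ≤ (Cω * (2 ^ j) ^ q * ω ℓ) * (pnorm n 1 H * ((u / ℓ) ^ p / (2 ^ j) ^ p)) := by
              gcongr
          _ = _ := by
              rw [Real.rpow_sub (by positivity)]
              ring
    _ ≤ Cω * pnorm n 1 H * ω ℓ * (u / ℓ) ^ p * (1 - 2 ^ (q - p))⁻¹ := by
        rw [← Finset.mul_sum]
        gcongr
        exact sum_pow_rpow_le_of_neg one_lt_two (by linarith) m
    _ ≤ Cω * pnorm n 1 H * ω ℓ * (1 + u / ℓ) ^ p * (1 - 2 ^ (q - p))⁻¹ := by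
        have : 0 < 1 - (2 : ℝ) ^ (q - p) :=
          sub_pos.2 (Real.rpow_lt_one_of_one_lt_of_neg one_lt_two (by linarith))
        gcongr
        linarith
    _ = _ := by ring

/-- Approximation of the image of the remainder. -/
lemma ConeDomain.exists_testRem_approx (hω : GoodModulus ω n q r Cω) (hD : ConeDomain D c ρ M)
    (hΩ : IsCZSymbol (n + 1) Ω) : ∃ C : ℝ, 0 < C ∧ ∀ H : MvPolynomial (Fin d) 𝕜, H.totalDegree ≤ n →
      ∀ (x₀ : Rn d) (ℓ : ℝ) (m : ℕ), 0 < ℓ → cube x₀ ℓ ⊆ D →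
      ∃ S : MvPolynomial (Fin d) 𝕜, S.totalDegree ≤ n ∧ ∀ y ∈ cube x₀ ℓ, ∃ v,
        HasPV Ω D (testRem hD.dim_pos ω ℓ m H x₀) y v ∧
          ‖v - polyFun S y‖ ≤ C * pnorm n 1 H * ω ℓ := by
  have hd := hD.dim_pos'
  have hDm := hD.isOpen.measurableSet
  have hCω := hω.const_pos
  -- `p` must exceed `q` for the sum over scales and stay below `n + 1` for the far-field integral.
  obtain ⟨p, hqp, hpn⟩ := exists_between hω.q_lt
  obtain ⟨C₁, hC₁, hfar⟩ := exists_far_integral_bound (𝕜 := 𝕜) (n := n) hD.dim_pos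
    (hω.q_pos.trans hqp) hpn
  obtain ⟨C₂, hC₂, hfield⟩ := hΩ.exists_far_field hD.dim_pos
  have h2p : 0 < 1 - (2 : ℝ) ^ (q - p) :=
    sub_pos.2 (Real.rpow_lt_one_of_one_lt_of_neg one_lt_two (by linarith))
  refine ⟨C₂ * (C₁ * (Cω * (1 - 2 ^ (q - p))⁻¹)), by positivity, fun H hH x₀ ℓ m hℓ hcub => ?_⟩
  have hpnn := pnorm_nonneg (n := n) zero_le_one H
  have hωℓ := hω.pos ℓ hℓ
  set g := testRem hD.dim_pos ω ℓ m H x₀ with hg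
  have hgI : IntegrableOn g D := hD.integrableOn_continuous (continuous_testRem _ ω ℓ m H x₀)
  set E := D \ Metric.ball x₀ (2 * (d * ℓ)) with hE
  have hEm : MeasurableSet E := MeasurableSet.diff hDm measurableSet_ball
  have hEfar : ∀ x ∈ E, 2 * (d * ℓ) ≤ ‖x₀ - x‖ := fun x hx => by
    have := hx.2
    rwa [Metric.mem_ball, not_lt, dist_comm, dist_eq_norm] at this
  have hzero : ∀ x ∈ Metric.ball x₀ (2 * (d * ℓ)), g x = 0 := fun x hx => by
    rw [Metric.mem_ball, dist_eq_norm] at hx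
    exact testRem_eq_zero _ ω hℓ m H hx.le
  obtain ⟨S, hS, hSb⟩ := hfield x₀ (d * ℓ) E g (by positivity) hEm
    (hgI.mono_set sdiff_subset) hEfar
  have hI := hfar x₀ ℓ (Cω * (1 - 2 ^ (q - p))⁻¹ * pnorm n 1 H * ω ℓ) E g hℓ (by positivity) hEm
    hEfar (Eventually.of_forall fun x _ => hω.norm_testRem_le hD.dim_pos hqp hℓ m hH x₀ x)
  refine ⟨S, hS, fun y hy => ⟨∫ x in E, g x * czKernel Ω (y - x), ?_, ?_⟩⟩
  · have hyD := hcub hy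
    have hyB : y ∈ Metric.ball x₀ (2 * (d * ℓ)) :=
      Metric.ball_subset_ball (by nlinarith) (cube_subset_ball hD.dim_pos x₀ hℓ hy)
    -- Around `y` the remainder vanishes, so the principal value is an ordinary integral over the
    -- far region.
    obtain ⟨s, hs, hball⟩ := Metric.isOpen_iff.1 (hD.isOpen.inter Metric.isOpen_ball) y ⟨hyD, hyB⟩
    have h0 : ∀ x ∈ Metric.ball y s, g x = 0 := fun x hx => hzero x (hball hx).2
    have hpv := hΩ.hasPV hD.dim_pos hDm hgI (v := 0) hs (hball.trans inter_subset_left) one_pos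
      le_rfl (Eventually.of_forall fun x hx => by rw [h0 x hx]; simp)
    have e1 : ∫ x in Metric.ball y s, (g x - 0) * czKernel Ω (y - x) = 0 :=
      setIntegral_eq_zero_of_forall_eq_zero fun x hx => by rw [h0 x hx]; simp
    have e2 : ∫ x in D \ Metric.ball y s, g x * czKernel Ω (y - x) =
        ∫ x in E, g x * czKernel Ω (y - x) := by
      refine setIntegral_eq_of_subset_of_forall_sdiff_eq_zero
        (MeasurableSet.diff hDm measurableSet_ball)
        (sdiff_subset_sdiff_right (hball.trans inter_subset_right)) fun x hx => ?_
      rw [hzero x (by_contra fun h => hx.2 ⟨hx.1.1, h⟩), zero_mul]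
    rwa [e1, e2, zero_add] at hpv
  · have hyn : ‖y - x₀‖ ≤ d * ℓ := by
      have := cube_subset_ball hD.dim_pos x₀ hℓ hy
      rw [Metric.mem_ball, dist_eq_norm] at this
      exact this.le
    calc _ ≤ C₂ * (d * ℓ) ^ (n + 1) * ∫ x in E, ‖g x‖ * (‖x₀ - x‖ ^ (d + n + 1))⁻¹ := hSb y hyn
      _ = C₂ * ((d * ℓ) ^ (n + 1) * ∫ x in E, ‖g x‖ * (‖x₀ - x‖ ^ (d + n + 1))⁻¹) := by ring
      _ ≤ C₂ * (C₁ * (Cω * (1 - 2 ^ (q - p))⁻¹ * pnorm n 1 H * ω ℓ)) :=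
          mul_le_mul_of_nonneg_left hI hC₂.le
      _ = _ := by ring

/-- Boundedness of the operator forces the logarithmic gain on homogeneous polynomials. -/
theorem ConeDomain.exists_homogeneous_approx (hω : GoodModulus ω n q r Cω)
    (hD : ConeDomain D c ρ M) (hΩ : IsCZSymbol (n + 1) Ω) (hT : RestrictedCZBounded ω n Ω D) :
    ∃ C : ℝ≥0, ∀ (x₀ : Rn d) (ℓ : ℝ), 0 < ℓ → cube x₀ ℓ ⊆ D →
      ∀ H : MvPolynomial (Fin d) 𝕜, H.IsHomogeneous n →
        ∃ S : MvPolynomial (Fin d) 𝕜, S.totalDegree ≤ n ∧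
          avgL1 (cube x₀ ℓ)
              (fun x => restrictedCZ Ω D (fun z => polyFun H (z - x₀)) x - polyFun S x)
            ≤ C * (⨆ x ∈ D, ‖polyFun H (x - x₀)‖ₑ) * ENNReal.ofReal (assocModulus ω n ℓ) := by
  obtain ⟨C₀, hC₀⟩ := hT
  obtain ⟨C₁, hC₁, htest⟩ := hD.exists_testFun_norm_bound hω 𝕜
  obtain ⟨C₂, hC₂, hrem⟩ := hD.exists_testRem_approx hω hΩ
  obtain ⟨C₃, hC₃, hsup⟩ := hD.exists_pnorm_le_iSup 𝕜 n
  have hCω := hω.const_pos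
  have hDm := hD.isOpen.measurableSet
  set B : ℝ := Cω * 2 ^ q * (C₀ * C₁ + 1 + C₂) with hB
  have hB0 : 0 < B := by positivity
  refine ⟨⟨B * C₃, by positivity⟩, fun x₀ ℓ hℓ hcub H hH => ?_⟩
  have hdeg := hH.totalDegree_le
  have hx₀ := hcub (self_mem_cube x₀ hℓ.le)
  have hωℓ := hω.pos ℓ hℓ
  have hJ : 0 < logFactor ω n ℓ := one_pos.trans_le (one_le_logFactor ω n ℓ)
  -- The zero polynomial is treated apart, since the strict bound needed for approximation data
  -- requires a positive norm.
  rcases (pnorm_nonneg (n := n) zero_le_one H).eq_or_lt with h0 | hpn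
  · have hz : (fun z => polyFun H (z - x₀)) = fun _ => 0 := by
      ext z
      have := norm_polyFun_sub_le_pnorm hdeg (le_max_left 1 ‖z - x₀‖) (le_max_right _ _)
      rw [← h0, mul_zero] at this
      exact norm_le_zero_iff.1 this
    refine ⟨0, by simp, ?_⟩
    have hpv : ∀ x, HasPV Ω D (fun _ => 0) x 0 := fun x => by
      simp only [HasPV, indicator_zero]
      have : czTruncated Ω (fun _ => 0) x = fun _ => 0 := by
        ext ε
        simp [czTruncated]
      rw [this]
      exact tendsto_const_nhds
    rw [hz, avgL1_congr (g := fun _ => 0) (measurableSet_cube x₀ ℓ) fun x hx => by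
      rw [(hpv x).restrictedCZ_eq (hcub hx), polyFun_zero, sub_zero]]
    simp [avgL1]
  have hex : ∃ m : ℕ, 1 ≤ 2 ^ m * ℓ := by
    obtain ⟨k, hk⟩ := pow_unbounded_of_one_lt (1 / ℓ) (one_lt_two : (1 : ℝ) < 2)
    exact ⟨k, ((div_lt_iff₀ hℓ).1 hk).le⟩
  classical
  -- The first scale reaching `1`: the scales used are at most `1`, and they exhaust the integral
  -- defining the logarithmic factor.
  set m := Nat.find hex with hm_def
  have hm : 1 ≤ 2 ^ m * ℓ := Nat.find_spec hex
  have hmj : ∀ j < m, 2 ^ j * ℓ ≤ 1 := fun j hj => (not_le.1 (Nat.find_min hex hj)).le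
  set W := dyadicWeight ω n ℓ m with hW
  have hW1 : 1 ≤ W := by
    rw [hW, dyadicWeight, le_add_iff_nonneg_right]
    exact Finset.sum_nonneg fun j _ => by
      have := hω.pos (2 ^ j * ℓ) (by positivity)
      positivity
  have hW0 : 0 < W := one_pos.trans_le hW1
  have hJW : logFactor ω n ℓ ≤ Cω * 2 ^ q * W := hω.logFactor_le_sum hℓ hm
  set f := testFun hD.dim_pos ω ℓ m H x₀ with hf
  set g := testRem hD.dim_pos ω ℓ m H x₀ with hg
  obtain ⟨hfmem, hfnorm⟩ := htest H hdeg x₀ ℓ m hx₀ hℓ hmj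
  obtain ⟨hfI, hfpv⟩ := hD.restrictedCZWellDefined hω hΩ f hfmem
  have hgI : IntegrableOn g D := hD.integrableOn_continuous (continuous_testRem _ ω ℓ m H x₀)
  obtain ⟨hTf, hTfn⟩ := hC₀ f hfmem
  have hlt : zygmundNorm ω n D (restrictedCZ Ω D f) <
      ENNReal.ofReal ((C₀ * C₁ + 1) * pnorm n 1 H) := by
    calc _ ≤ (C₀ : ℝ≥0∞) * ENNReal.ofReal (C₁ * pnorm n 1 H) := hTfn.trans (by gcongr)
      _ = ENNReal.ofReal (C₀ * (C₁ * pnorm n 1 H)) := by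
          rw [ENNReal.ofReal_mul C₀.coe_nonneg, ENNReal.ofReal_coe_nnreal]
      _ < _ := by
          rw [ENNReal.ofReal_lt_ofReal_iff (by positivity)]
          linarith
  obtain ⟨P, hP⟩ := exists_approxData (c := c) (ρ := ρ) hω hTf.1 (le_self_add.trans_lt hlt)
    (((lintegral_mono_set hD.core_subset).trans le_add_self).trans hlt.le)
  obtain ⟨hS₁, hS₁a⟩ := hP.approx x₀ ℓ hℓ (by rwa [one_mul])
  set S₁ := P x₀ ℓ with hS₁_def
  obtain ⟨S₂, hS₂, hS₂a⟩ := hrem H hdeg x₀ ℓ m hℓ hcub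
  -- Near the cube the test function is `W` times the homogeneous polynomial, so its approximant is
  -- divided by `W`; this division is the source of the gain.
  refine ⟨MvPolynomial.C (((W⁻¹ : ℝ)) : 𝕜) * (S₁ + S₂), ?_, ?_⟩
  · refine (MvPolynomial.totalDegree_mul _ _).trans ?_
    rw [MvPolynomial.totalDegree_C, zero_add]
    exact (MvPolynomial.totalDegree_add _ _).trans (max_le hS₁ hS₂)
  have hval : ∀ x ∈ cube x₀ ℓ, restrictedCZ Ω D (fun z => polyFun H (z - x₀)) x -
      polyFun (MvPolynomial.C (((W⁻¹ : ℝ)) : 𝕜) * (S₁ + S₂)) x =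
      ((W⁻¹ : ℝ) : 𝕜) * ((restrictedCZ Ω D f x - polyFun S₁ x) +
        (restrictedCZ Ω D g x - polyFun S₂ x)) := by
    intro x hx
    have hxD := hcub hx
    obtain ⟨u, hu⟩ := hfpv x hxD
    have hu : HasPV Ω D f x u := hu
    obtain ⟨v, hv, -⟩ := hS₂a x hx
    have hpv := ((hu.add hΩ hD.dim_pos hDm hfI hgI hv).const_mul hDm ((W⁻¹ : ℝ) : 𝕜)).congr
      (g := fun z => polyFun H (z - x₀)) fun z _ => by
        rw [testFun_add_testRem _ ω ℓ m hH, ← mul_assoc, ← RCLike.ofReal_mul,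
          inv_mul_cancel₀ hW0.ne', RCLike.ofReal_one, one_mul]
    rw [hpv.restrictedCZ_eq hxD, hu.restrictedCZ_eq hxD, hv.restrictedCZ_eq hxD, polyFun_C_mul,
      polyFun_add]
    ring
  have hfm : AEStronglyMeasurable (fun x => restrictedCZ Ω D f x - polyFun S₁ x)
      (volume.restrict (cube x₀ ℓ)) :=
    ((hΩ.aestronglyMeasurable_restrictedCZ hDm hfI hfpv).restrict).sub
      (continuous_polyFun S₁).aestronglyMeasurable
  have hb2 : avgL1 (cube x₀ ℓ) (fun x => restrictedCZ Ω D g x - polyFun S₂ x) ≤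
      ENNReal.ofReal (C₂ * pnorm n 1 H * ω ℓ) := by
    refine avgL1_le_of_ae_le ?_
    filter_upwards [ae_restrict_mem (measurableSet_cube x₀ ℓ)] with x hx
    obtain ⟨v, hv, hle⟩ := hS₂a x hx
    rwa [hv.restrictedCZ_eq (hcub hx)]
  rw [avgL1_congr (measurableSet_cube x₀ ℓ) hval, avgL1_const_mul, ← ofReal_norm,
    RCLike.norm_ofReal, abs_of_pos (inv_pos.2 hW0)]
  calc _ ≤ ENNReal.ofReal W⁻¹ * (ENNReal.ofReal ((C₀ * C₁ + 1) * pnorm n 1 H * ω ℓ) +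
        ENNReal.ofReal (C₂ * pnorm n 1 H * ω ℓ)) := by
        gcongr
        exact (avgL1_add_le hfm).trans (add_le_add hS₁a hb2)
    _ = ENNReal.ofReal (W⁻¹ * ((C₀ * C₁ + 1 + C₂) * pnorm n 1 H * ω ℓ)) := by
        rw [← ENNReal.ofReal_add (by positivity) (by positivity),
          ← ENNReal.ofReal_mul (by positivity)]
        congr 1
        ring
    _ ≤ ENNReal.ofReal (B * pnorm n 1 H * (ω ℓ / logFactor ω n ℓ)) := by
        refine ENNReal.ofReal_le_ofReal ?_
        have h1 : W⁻¹ ≤ Cω * 2 ^ q / logFactor ω n ℓ := by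
          rw [le_div_iff₀ hJ, inv_mul_le_iff₀ hW0]
          linarith
        calc _ ≤ Cω * 2 ^ q / logFactor ω n ℓ * ((C₀ * C₁ + 1 + C₂) * pnorm n 1 H * ω ℓ) := by
              gcongr
          _ = _ := by
              rw [hB]
              ring
    _ = ENNReal.ofReal B * ENNReal.ofReal (pnorm n 1 H) * ENNReal.ofReal (assocModulus ω n ℓ) := by
        rw [ENNReal.ofReal_mul (by positivity), ENNReal.ofReal_mul hB0.le]
        rfl
    _ ≤ ENNReal.ofReal B * (ENNReal.ofReal C₃ * ⨆ x ∈ D, ‖polyFun H (x - x₀)‖ₑ) *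
          ENNReal.ofReal (assocModulus ω n ℓ) := by
        gcongr
        exact hsup H hdeg x₀ hx₀
    _ = _ := by
        rw [← mul_assoc, ← ENNReal.ofReal_mul hB0.le, ENNReal.ofReal,
          Real.toNNReal_of_nonneg (by positivity)]
        rfl

end Necessity

end ZygmundTP

end

open ZygmundTP in
theorem theorem3 {𝕜 : Type*} [RCLike 𝕜] {d : ℕ} (hd : 0 < d) (n : ℕ)
    (ω : ℝ → ℝ) (hω : IsModulusOfOrder ω n)
    (D : Set (Rn d)) (hD : IsBoundedLipschitzDomain D)
    (Ω : Rn d → 𝕜) (hΩ : IsCZSymbol (n + 1) Ω) :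
    RestrictedCZWellDefined ω n Ω D ∧
    (RestrictedCZBounded ω n Ω D ↔
      (∀ P : MvPolynomial (Fin d) 𝕜, P.totalDegree ≤ n →
        MemZygmund ω n D (restrictedCZ Ω D (D.indicator (polyFun P)))) ∧
      (∃ C : ℝ≥0, ∀ (x₀ : Rn d) (ℓ : ℝ), 0 < ℓ → cube x₀ ℓ ⊆ D →
        ∀ H : MvPolynomial (Fin d) 𝕜, H.IsHomogeneous n →
          ∃ S : MvPolynomial (Fin d) 𝕜, S.totalDegree ≤ n ∧
            avgL1 (cube x₀ ℓ)
                (fun x => restrictedCZ Ω D (D.indicator fun z => polyFun H (z - x₀)) x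
                  - polyFun S x)
              ≤ C * (⨆ x ∈ D, ‖polyFun H (x - x₀)‖ₑ)
                * ENNReal.ofReal (assocModulus ω n ℓ))) := by
  obtain ⟨q, r, Cω, hω'⟩ := hω.exists_goodModulus
  obtain ⟨c, ρ, M, hD'⟩ := hD.exists_coneDomain hd
  -- The operator extends functions by zero itself, so the inner truncations to `D` are redundant.
  simp only [restrictedCZ_indicator]
  refine ⟨hD'.restrictedCZWellDefined hω' hΩ, fun hT => ⟨fun P hP => ?_,
    hD'.exists_homogeneous_approx hω' hΩ hT⟩, fun ⟨h1, C, h2⟩ => hD'.restrictedCZBounded hω' hΩ h1 h2⟩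
  obtain ⟨C, hC⟩ := hT
  exact (hC _ (memZygmund_polyFun hD' hP)).1
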